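/- Let $\mathcal A$ be a complex unital algebra, $\mathcal B\subseteq\mathcal A$ a unital subalgebra, and let $(\mathcal A,\mathcal B,E,E')$ be an operator-valued infinitesimal (OVI) probability space: $E,E':\mathcal A\to\mathcal B$ are linear, $E(b)=b$, $E(bab')=bE(a)b'$, $E'(1)=0$ and $E'(bab')=bE'(a)b'$ for all $a\in\mathcal A$, $b,b'\in\mathcal B$. **Partitions.** Let $\mathcal{NC}(n)$ be the lattice of non-crossing partitions of $\{1,\dots,n\}$ ordered by refinement ($\sigma\le\pi$ if every block of $\sigma$ is contained in a block of $\pi$), with largest element $1_n$ and Möbius function $\mathrm{Mob}$; let $\mathcal I(n)\subseteq\mathcal{NC}(n)$ be the set of interval partitions and $\mathcal{NC}_{irr}(n)$ the set of those $\pi\in\mathcal{NC}(n)$ for which $1$ and $n$ lie in the same block. Write $|\pi|$ for the number of blocks of $\pi$. A block $W$ is nested in a block $V$ if $W\subseteq[\min V,\max V]$. Put $$\tau(\pi)!=\prod_{V\in\pi}\bigl|\{W\in\pi: W\subseteq[\min V,\max V]\}\bigr|,\qquad \omega(\pi)=\sum_{k=1}^n\frac{(-1)^{k+1}}{k}\,\omega_k(\pi),$$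 where $\omega_k(\pi)$ is the number of surjective maps $f$ from the set of blocks of $\pi$ onto $\{1,\dots,k\}$ such that $f(V)<f(W)$ whenever $V\neq W$ and $V$ is nested in $W$. **Multiplicative extension.** For a sequence of maps $f_n:\mathcal A^n\to\mathcal B$, $n\ge 1$, and $\pi\in\mathcal{NC}(n)$, define $f_\pi:\mathcal A^n\to\mathcal B$ recursively: $f_{1_n}=f_n$, and if $\pi\ne 1_n$ then $$f_\pi(x_1,\dots,x_n)=f_{\pi\setminus V}\bigl(x_1,\dots,x_{l-1},\,x_lf_k(x_{l+1},\dots,x_{l+k}),\,x_{l+k+1},\dots,x_n\bigr),$$ where $V=\{l+1,\dots,l+k\}$ is the block of $\pi$ with the largest minimum (it is an interval, and $l\ge1$; for the maps below any other interval block with $l\ge 1$ gives the same result). For a second sequence $\partial f_n:\mathcal A^n\to\mathcal B$ and $V\in\pi$ let $\partial f_{\pi,V}$ be obtained as $f_\pi$, but using $\partial f_{|V|}$ in place of $f_{|V|}$ for the block $V$, and put $\partial f_\pi=\sum_{V\in\pi}\partial f_{\pi,V}$. **Cumulants.** Let $E_n(a_1,\dots,a_n)=E(a_1\cdots a_n)$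 and $\partial E_n(a_1,\dots,a_n)=E'(a_1\cdots a_n)$. The free, Boolean and monotone operator-valued cumulants $r^{\mathcal B}_n,\beta^{\mathcal B}_n,h^{\mathcal B}_n:\mathcal A^n\to\mathcal B$ are defined recursively by $$E_n=\sum_{\pi\in\mathcal{NC}(n)}r^{\mathcal B}_\pi,\qquad E_n=\sum_{\pi\in\mathcal I(n)}\beta^{\mathcal B}_\pi,\qquad E_n=\sum_{\pi\in\mathcal{NC}(n)}\frac1{\tau(\pi)!}h^{\mathcal B}_\pi\qquad(n\ge1).$$ The corresponding OVI cumulants $\partial r^{\mathcal B}_n,\partial\beta^{\mathcal B}_n,\partial h^{\mathcal B}_n:\mathcal A^n\to\mathcal B$ are defined by $$\partial r^{\mathcal B}_n=\sum_{\pi\in\mathcal{NC}(n)}\mathrm{Mob}(\pi,1_n)\,\partial E_\pi,\qquad \partial\beta^{\mathcal B}_n=\sum_{\pi\in\mathcal I(n)}(-1)^{|\pi|-1}\,\partial E_\pi,\qquad \partial E_n=\sum_{\pi\in\mathcal{NC}(n)}\frac1{\tau(\pi)!}\,\partial h^{\mathcal B}_\pi,$$ the last formula being a recursion for $\partial h^{\mathcal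 B}_n$. **Theorem.** For every $n\ge1$, as maps $\mathcal A^n\to\mathcal B$, $$\partial\beta^{\mathcal B}_n=\sum_{\pi\in\mathcal{NC}_{irr}(n)}\partial r^{\mathcal B}_\pi,\qquad \partial r^{\mathcal B}_n=\sum_{\pi\in\mathcal{NC}_{irr}(n)}(-1)^{|\pi|-1}\,\partial\beta^{\mathcal B}_\pi,$$ $$\partial\beta^{\mathcal B}_n=\sum_{\pi\in\mathcal{NC}_{irr}(n)}\frac1{\tau(\pi)!}\,\partial h^{\mathcal B}_\pi,\qquad \partial r^{\mathcal B}_n=\sum_{\pi\in\mathcal{NC}_{irr}(n)}\frac{(-1)^{|\pi|-1}}{\tau(\pi)!}\,\partial h^{\mathcal B}_\pi,$$ $$\partial h^{\mathcal B}_n=\sum_{\pi\in\mathcal{NC}_{irr}(n)}\omega(\pi)\,\partial\beta^{\mathcal B}_\pi,\qquad \partial h^{\mathcal B}_n=\sum_{\pi\in\mathcal{NC}_{irr}(n)}(-1)^{|\pi|-1}\omega(\pi)\,\partial r^{\mathcal B}_\pi.$$ -/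

import Mathlib

open scoped BigOperators

namespace OVI

/-! ## Operator-valued infinitesimal probability spaces -/

/-- `(A, B, E, E')` is an operator-valued infinitesimal probability space over the unital
subalgebra `B` of the complex unital algebra `A`. -/
structure IsOVISpace {A : Type*} [Ring A] [Algebra ℂ A] (B : Subalgebra ℂ A)
    (E E' : A →ₗ[ℂ] B) : Prop where
  map_coe : ∀ b : B, E (b : A) = b
  map_bimodule : ∀ (b b' : B) (a : A), E ((b : A) * a * (b' : A)) = b * E a * b'
  inf_map_one : E' 1 = 0
  inf_map_bimodule : ∀ (b b' : B) (a : A), E' ((b : A) * a * (b' : A)) = b * E' a * b'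

/-! ## Non-crossing partitions -/

/-- No two distinct blocks `V`, `W` satisfy `i < j < k < l` with `i, k ∈ V` and `j, l ∈ W`. -/
def IsNonCrossing {n : ℕ} (π : Finpartition (Finset.univ : Finset (Fin n))) : Prop :=
  ∀ V ∈ π.parts, ∀ W ∈ π.parts, V ≠ W →
    ¬ ∃ i j k l : Fin n, i < j ∧ j < k ∧ k < l ∧ i ∈ V ∧ k ∈ V ∧ j ∈ W ∧ l ∈ W

/-- Non-crossing partitions of an `n`-element chain. The order inherited from `Finpartition` is
`σ ≤ π` iff every block of `σ` is contained in a block of `π`. -/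
abbrev NC (n : ℕ) : Type := {π : Finpartition (Finset.univ : Finset (Fin n)) // IsNonCrossing π}

noncomputable instance instFintypeNC (n : ℕ) : Fintype (NC n) := Fintype.ofFinite _

open Classical in
noncomputable instance instLocallyFiniteOrderNC (n : ℕ) : LocallyFiniteOrder (NC n) :=
  Fintype.toLocallyFiniteOrder

/-- The partition `1_n` with a single block (for `n ≥ 1`). -/
def oneNC (n : ℕ) : NC n :=
  ⟨⊤, fun _ hV _ hW hne =>
    (hne (Finpartition.parts_top_subsingleton _ hV hW)).elim⟩

/-- The blocks of a non-crossing partition. -/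
def blocks {n : ℕ} (π : NC n) : Finset (Finset (Fin n)) := π.1.parts

/-- The number `|π|` of blocks. -/
def size {n : ℕ} (π : NC n) : ℕ := (blocks π).card

/-- Interval partitions: every block consists of consecutive points. -/
def IsInterval {n : ℕ} (π : NC n) : Prop :=
  ∀ V ∈ blocks π, ∀ i ∈ V, ∀ k ∈ V, ∀ j : Fin n, i ≤ j → j ≤ k → j ∈ V

/-- Irreducible partitions: the first and the last point lie in the same block. -/
def IsIrreducible {n : ℕ} (π : NC n) : Prop :=
  ∃ V ∈ blocks π, ∀ i : Fin n, (i.val = 0 ∨ i.val + 1 = n) → i ∈ V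

open Classical in
/-- The set `I(n)` of interval partitions. -/
noncomputable def intervalNC (n : ℕ) : Finset (NC n) := Finset.univ.filter IsInterval

open Classical in
/-- The set of irreducible non-crossing partitions. -/
noncomputable def irrNC (n : ℕ) : Finset (NC n) := Finset.univ.filter IsIrreducible

/-- `W ⊆ [min V, max V]`. -/
def NestedIn {n : ℕ} (W V : Finset (Fin n)) : Prop :=
  ∀ w ∈ W, (∃ i ∈ V, i ≤ w) ∧ (∃ k ∈ V, w ≤ k)

open Classical in
/-- The tree factorial `τ(π)!`. -/
noncomputable def treeFactorial {n : ℕ} (π : NC n) : ℕ :=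
  ∏ V ∈ blocks π, ((blocks π).filter fun W => NestedIn W V).card

/-- Increasing colourings of the blocks of `π` by exactly `k` colours: all `k` colours are used,
and a block nested inside a different block has the smaller colour. -/
def IsIncreasingColoring {n k : ℕ} (π : NC n) (f : {V // V ∈ blocks π} → Fin k) : Prop :=
  Function.Surjective f ∧ ∀ V W, V ≠ W → NestedIn V.1 W.1 → f V < f W

/-- The number `ω_k(π)` of increasing colourings with exactly `k` colours. -/
noncomputable def omegaCount (k : ℕ) {n : ℕ} (π : NC n) : ℕ :=
  Nat.card {f : {V // V ∈ blocks π} → Fin k // IsIncreasingColoring π f}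

/-- The coefficient `ω(π) = ∑_{k=1}^n (-1)^{k+1} ω_k(π) / k`. -/
noncomputable def omega {n : ℕ} (π : NC n) : ℚ :=
  ∑ k ∈ Finset.Icc 1 n, (-1 : ℚ) ^ (k + 1) / (k : ℚ) * (omegaCount k π : ℚ)

/-! ## Multiplicative extension of a sequence of maps to non-crossing partitions -/

section Multiplicative

variable {A : Type*} [Ring A] [Algebra ℂ A] {B : Subalgebra ℂ A}

/-- `V` is the block of `P` with the largest minimum and `l` is the largest point smaller than
`min V` in the other blocks. For the blocks of a non-crossing partition with at least two blocks,
such a pair exists and is unique, `V` is an interval of the set of points covered by `P`, and `l`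
is the point immediately before it. -/
def IsLastBlock {n : ℕ} (P : Finset (Finset (Fin n))) (V : Finset (Fin n)) (l : Fin n) : Prop :=
  V ∈ P ∧ (∀ W ∈ P, W ≠ V → ∃ w ∈ W, ∀ v ∈ V, w < v) ∧
    IsGreatest {i | (∃ W ∈ P, W ≠ V ∧ i ∈ W) ∧ ∀ v ∈ V, i < v} l

/-- `f_k(x_{v_1}, …, x_{v_k})` for the block `V = {v_1 < ⋯ < v_k}`, where `f = F V`. -/
def blockValue {n : ℕ} (F : Finset (Fin n) → ∀ k : ℕ, (Fin k → A) → B)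
    (V : Finset (Fin n)) (x : Fin n → A) : B :=
  F V V.card (fun i => x (V.orderEmbOfFin rfl i))

open Classical in
/-- Nested evaluation along a family of blocks, where the block `V` is evaluated by the sequence
of maps `F V`. If there are at least two blocks, take the last interval block
`V = {v_1 < ⋯ < v_k}`, with preceding point `l`, replace `x_l` by `x_l f_k(x_{v_1}, …, x_{v_k})`
and delete `V`; if there is a single block, evaluate it (the sum then has one term). -/
noncomputable def nestedValue {n : ℕ} (F : Finset (Fin n) → ∀ k : ℕ, (Fin k → A) → B)
    (P : Finset (Finset (Fin n))) (x : Fin n → A) : B :=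
  if h : ∃ p : Finset (Fin n) × Fin n, IsLastBlock P p.1 p.2 then
    nestedValue F (P.erase h.choose.1)
      (Function.update x h.choose.2 (x h.choose.2 * (blockValue F h.choose.1 x : A)))
  else ∑ V ∈ P, blockValue F V x
termination_by P.card
decreasing_by exact Finset.card_erase_lt_of_mem h.choose_spec.1

/-- The map `f_π` of the multiplicative family determined by the sequence `f`. -/
noncomputable def multMap (f : ∀ k : ℕ, (Fin k → A) → B) {n : ℕ} (π : NC n) (x : Fin n → A) : B :=
  nestedValue (fun _ => f) (blocks π) x

open Classical in
/-- The map `∂f_{π,V}`: as `f_π`, but with `∂f` in place of `f` on the block `V`. -/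
noncomputable def partialMapAt (f df : ∀ k : ℕ, (Fin k → A) → B) {n : ℕ} (π : NC n)
    (V : Finset (Fin n)) (x : Fin n → A) : B :=
  nestedValue (fun W => if W = V then df else f) (blocks π) x

/-- The map `∂f_π = ∑_{V ∈ π} ∂f_{π,V}`. -/
noncomputable def partialMap (f df : ∀ k : ℕ, (Fin k → A) → B) {n : ℕ} (π : NC n)
    (x : Fin n → A) : B :=
  ∑ V ∈ blocks π, partialMapAt f df π V x

/-- The maps `(a_1, …, a_n) ↦ φ(a_1 ⋯ a_n)`. -/
def moment (φ : A →ₗ[ℂ] B) (n : ℕ) (a : Fin n → A) : B := φ (List.ofFn a).prod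

open Classical in
/-- The sequence `f` determined recursively by `m_n = f_n + ∑_{π ∈ S(n), π ≠ 1_n} c(π) f_π`.
The maps `f_π` on the right-hand side only involve `f_k` with `k < n`. -/
noncomputable def cumulantSeq (S : ∀ n, Finset (NC n)) (c : ∀ n, NC n → ℂ)
    (m : ∀ n : ℕ, (Fin n → A) → B) (n : ℕ) (a : Fin n → A) : B :=
  m n a - ∑ π ∈ (S n).erase (oneNC n), c n π •
    multMap (fun k b => if _h : k < n then cumulantSeq S c m k b else 0) π a
termination_by n

open Classical in
/-- The sequence `∂f` determined recursively, for a given sequence `f`, by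
`m_n = ∂f_n + ∑_{π ∈ S(n), π ≠ 1_n} c(π) ∂f_π`.
The maps `∂f_π` on the right-hand side only involve `∂f_k` with `k < n`. -/
noncomputable def infCumulantSeq (S : ∀ n, Finset (NC n)) (c : ∀ n, NC n → ℂ)
    (f m : ∀ n : ℕ, (Fin n → A) → B) (n : ℕ) (a : Fin n → A) : B :=
  m n a - ∑ π ∈ (S n).erase (oneNC n), c n π •
    partialMap f (fun k b => if _h : k < n then infCumulantSeq S c f m k b else 0) π a
termination_by n

/-! ## Cumulants -/

/-- Free cumulants: `E(a_1 ⋯ a_n) = ∑_{π ∈ NC(n)} r_π(a_1, …, a_n)`. -/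
noncomputable def freeCumulant (E : A →ₗ[ℂ] B) (n : ℕ) (a : Fin n → A) : B :=
  cumulantSeq (fun _ => Finset.univ) (fun _ _ => 1) (moment E) n a

/-- Boolean cumulants: `E(a_1 ⋯ a_n) = ∑_{π ∈ I(n)} β_π(a_1, …, a_n)`. -/
noncomputable def booleanCumulant (E : A →ₗ[ℂ] B) (n : ℕ) (a : Fin n → A) : B :=
  cumulantSeq intervalNC (fun _ _ => 1) (moment E) n a

/-- Monotone cumulants: `E(a_1 ⋯ a_n) = ∑_{π ∈ NC(n)} (1 / τ(π)!) h_π(a_1, …, a_n)`. -/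
noncomputable def monotoneCumulant (E : A →ₗ[ℂ] B) (n : ℕ) (a : Fin n → A) : B :=
  cumulantSeq (fun _ => Finset.univ) (fun _ π => 1 / (treeFactorial π : ℂ)) (moment E) n a

open Classical in
/-- Infinitesimal free cumulants: `∂r_n = ∑_{π ∈ NC(n)} Mob(π, 1_n) ∂E_π`. -/
noncomputable def infFreeCumulant (E E' : A →ₗ[ℂ] B) (n : ℕ) (a : Fin n → A) : B :=
  ∑ π : NC n, IncidenceAlgebra.mu ℂ π (oneNC n) • partialMap (moment E) (moment E') π a

/-- Infinitesimal Boolean cumulants: `∂β_n = ∑_{π ∈ I(n)} (-1)^{|π|-1} ∂E_π`. -/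
noncomputable def infBooleanCumulant (E E' : A →ₗ[ℂ] B) (n : ℕ) (a : Fin n → A) : B :=
  ∑ π ∈ intervalNC n, (-1 : ℂ) ^ (size π - 1) • partialMap (moment E) (moment E') π a

/-- Infinitesimal monotone cumulants:
`E'(a_1 ⋯ a_n) = ∑_{π ∈ NC(n)} (1 / τ(π)!) ∂h_π(a_1, …, a_n)`. -/
noncomputable def infMonotoneCumulant (E E' : A →ₗ[ℂ] B) (n : ℕ) (a : Fin n → A) : B :=
  infCumulantSeq (fun _ => Finset.univ) (fun _ π => 1 / (treeFactorial π : ℂ))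
    (monotoneCumulant E) (moment E') n a

/-! ## The defining moment-cumulant formulas -/

theorem nestedValue_congr {n : ℕ} {F G : Finset (Fin n) → ∀ k : ℕ, (Fin k → A) → B}
    (P : Finset (Finset (Fin n))) (x : Fin n → A)
    (h : ∀ V ∈ P, F V V.card = G V V.card) : nestedValue F P x = nestedValue G P x := by
  induction hk : P.card using Nat.strong_induction_on generalizing P x with
  | _ k ih =>
    rw [nestedValue, nestedValue]
    split_ifs with hp
    · have hV := hp.choose_spec.1
      have e : blockValue F hp.choose.1 x = blockValue G hp.choose.1 x := by
        simp only [blockValue, h _ hV]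
      rw [e]
      exact ih _ (hk ▸ Finset.card_erase_lt_of_mem hV) _ _
        (fun W hW => h W (Finset.mem_of_mem_erase hW)) rfl
    · exact Finset.sum_congr rfl fun V hV => by simp only [blockValue, h _ hV]

theorem card_block_lt {n : ℕ} {π : NC n} (hπ : π ≠ oneNC n) {V : Finset (Fin n)}
    (hV : V ∈ blocks π) : V.card < n := by
  by_contra hlt
  have hu : V = Finset.univ := by
    rw [← Finset.card_eq_iff_eq_univ, Fintype.card_fin]
    have := Finset.card_le_univ V
    rw [Fintype.card_fin] at this
    omega
  apply hπ
  apply Subtype.ext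
  rw [oneNC, eq_top_iff]
  intro W _
  exact ⟨V, hV, hu ▸ Finset.subset_univ W⟩

theorem blocks_oneNC {n : ℕ} (hn : 1 ≤ n) : blocks (oneNC n) = {Finset.univ} := by
  have : Nonempty (Fin n) := ⟨⟨0, hn⟩⟩
  have hsub := Finpartition.parts_top_subset (Finset.univ : Finset (Fin n))
  refine (Finset.subset_singleton_iff.1 hsub).resolve_left ?_
  intro h0
  have := Finpartition.parts_eq_empty_iff.1 h0
  exact Finset.univ_nonempty.ne_empty this

theorem nestedValue_single {n : ℕ} (hn : 1 ≤ n)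
    (F : Finset (Fin n) → ∀ k : ℕ, (Fin k → A) → B) (x : Fin n → A) :
    nestedValue F {Finset.univ} x = F Finset.univ n x := by
  rw [nestedValue, dif_neg]
  · rw [Finset.sum_singleton, blockValue]
    have key : ∀ (k : ℕ) (hk : (Finset.univ : Finset (Fin n)).card = k) (hkn : k = n),
        F Finset.univ k (fun i => x (Finset.univ.orderEmbOfFin hk i)) = F Finset.univ n x := by
      rintro k hk rfl
      congr 1
      funext i
      have := Finset.orderEmbOfFin_unique (s := (Finset.univ : Finset (Fin k))) hk (f := id)
        (fun _ => Finset.mem_univ _) strictMono_id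
      rw [← this]
      rfl
    exact key _ rfl (by simp)
  · rintro ⟨⟨V, l⟩, hV, -, ⟨⟨W, hW, hne, -⟩, -⟩, -⟩
    simp only [Finset.mem_singleton] at hV hW
    exact hne (hW.trans hV.symm)

theorem multMap_oneNC {n : ℕ} (hn : 1 ≤ n) (f : ∀ k : ℕ, (Fin k → A) → B) (x : Fin n → A) :
    multMap f (oneNC n) x = f n x := by
  rw [multMap, blocks_oneNC hn, nestedValue_single hn]

theorem partialMap_oneNC {n : ℕ} (hn : 1 ≤ n) (f df : ∀ k : ℕ, (Fin k → A) → B)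
    (x : Fin n → A) : partialMap f df (oneNC n) x = df n x := by
  rw [partialMap, blocks_oneNC hn, Finset.sum_singleton, partialMapAt, blocks_oneNC hn,
    nestedValue_single hn, if_pos rfl]

theorem oneNC_mem_intervalNC {n : ℕ} (hn : 1 ≤ n) : oneNC n ∈ intervalNC n := by
  classical
  refine Finset.mem_filter.2 ⟨Finset.mem_univ _, ?_⟩
  intro V hV i _ k _ j _ _
  rw [blocks_oneNC hn, Finset.mem_singleton] at hV
  exact hV ▸ Finset.mem_univ j

theorem cumulantSeq_spec (S : ∀ n, Finset (NC n)) (c : ∀ n, NC n → ℂ)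
    (m : ∀ n : ℕ, (Fin n → A) → B) {n : ℕ} (hn : 1 ≤ n) (hS : oneNC n ∈ S n)
    (hc : c n (oneNC n) = 1) (a : Fin n → A) :
    m n a = ∑ π ∈ S n, c n π • multMap (cumulantSeq S c m) π a := by
  classical
  rw [← Finset.add_sum_erase _ _ hS, hc, one_smul, multMap_oneNC hn]
  conv_rhs => rw [cumulantSeq]
  rw [eq_comm, sub_add, sub_eq_self, sub_eq_zero]
  refine Finset.sum_congr (by congr!) fun π hπ => ?_
  congr 1
  refine nestedValue_congr _ _ fun V hV => ?_
  funext b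
  exact dif_pos (card_block_lt (Finset.ne_of_mem_erase hπ) hV)

theorem infCumulantSeq_spec (S : ∀ n, Finset (NC n)) (c : ∀ n, NC n → ℂ)
    (f m : ∀ n : ℕ, (Fin n → A) → B) {n : ℕ} (hn : 1 ≤ n) (hS : oneNC n ∈ S n)
    (hc : c n (oneNC n) = 1) (a : Fin n → A) :
    m n a = ∑ π ∈ S n, c n π • partialMap f (infCumulantSeq S c f m) π a := by
  classical
  rw [← Finset.add_sum_erase _ _ hS, hc, one_smul, partialMap_oneNC hn]
  conv_rhs => rw [infCumulantSeq]
  rw [eq_comm, sub_add, sub_eq_self, sub_eq_zero]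
  refine Finset.sum_congr (by congr!) fun π hπ => ?_
  congr 1
  refine Finset.sum_congr rfl fun V _ => ?_
  refine nestedValue_congr _ _ fun W hW => ?_
  split_ifs with hWV
  · funext b
    exact dif_pos (card_block_lt (Finset.ne_of_mem_erase hπ) hW)
  · rfl

theorem treeFactorial_oneNC {n : ℕ} (hn : 1 ≤ n) : treeFactorial (oneNC n) = 1 := by
  classical
  rw [treeFactorial, blocks_oneNC hn, Finset.prod_singleton, Finset.card_eq_one]
  refine ⟨Finset.univ, ?_⟩
  rw [Finset.filter_eq_self]
  intro W _ w _
  exact ⟨⟨w, Finset.mem_univ w, le_rfl⟩, ⟨w, Finset.mem_univ w, le_rfl⟩⟩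

theorem moment_eq_sum_free (E : A →ₗ[ℂ] B) {n : ℕ} (hn : 1 ≤ n) (a : Fin n → A) :
    E (List.ofFn a).prod = ∑ π : NC n, multMap (freeCumulant E) π a := by
  have h := cumulantSeq_spec (fun _ => Finset.univ) (fun _ _ => 1) (moment E) hn
    (Finset.mem_univ _) rfl a
  simp only [one_smul] at h
  exact h

theorem moment_eq_sum_boolean (E : A →ₗ[ℂ] B) {n : ℕ} (hn : 1 ≤ n) (a : Fin n → A) :
    E (List.ofFn a).prod = ∑ π ∈ intervalNC n, multMap (booleanCumulant E) π a := by
  have h := cumulantSeq_spec intervalNC (fun _ _ => 1) (moment E) hn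
    (oneNC_mem_intervalNC hn) rfl a
  simp only [one_smul] at h
  exact h

theorem moment_eq_sum_monotone (E : A →ₗ[ℂ] B) {n : ℕ} (hn : 1 ≤ n) (a : Fin n → A) :
    E (List.ofFn a).prod =
      ∑ π : NC n, (1 / (treeFactorial π : ℂ)) • multMap (monotoneCumulant E) π a :=
  cumulantSeq_spec (fun _ => Finset.univ) (fun _ π => 1 / (treeFactorial π : ℂ)) (moment E) hn
    (Finset.mem_univ _) (by simp [treeFactorial_oneNC hn]) a

theorem infMoment_eq_sum_monotone (E E' : A →ₗ[ℂ] B) {n : ℕ} (hn : 1 ≤ n) (a : Fin n → A) :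
    E' (List.ofFn a).prod =
      ∑ π : NC n, (1 / (treeFactorial π : ℂ)) •
        partialMap (monotoneCumulant E) (infMonotoneCumulant E E') π a :=
  infCumulantSeq_spec (fun _ => Finset.univ) (fun _ π => 1 / (treeFactorial π : ℂ))
    (monotoneCumulant E) (moment E') hn
    (Finset.mem_univ _) (by simp [treeFactorial_oneNC hn]) a

end Multiplicative

end OVI

/-!
Every map `E_s = E + s E'`, `s ∈ ℂ`, is again right `B`-linear, and it has free, Boolean and
monotone cumulants of its own. These are polynomials in `s`, and their derivatives in `s` are the
infinitesimal cumulants, because the derivative of a multiplicative extension `f_π` is `∂f_π`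
(`NCFam.polyDeriv_val`). Hence the six identities are the derivatives at `s = 0` of the six
relations between the ordinary cumulants of `E_s` (`cumulant_relations`). For the free cumulants
the derivative is read off from Möbius inversion (`freeCumulant_eq_sum_mu`, by way of
`NCFam.val_eq_sum_refinements`), for the Boolean ones from the alternating sum over the interval
partitions (`boolean_eq_neg_ncWord`). The monotone cumulants are polynomial in `s` since they are
expressed by the Boolean ones, and their derivative satisfies the recursion that defines `∂h`,
which has only one solution (`eq_of_sum_dval_eq`).

To prove the ordinary relations, a sequence of maps is encoded as a function `f` on words. Such an
`f` acts on strictly upper triangular matrices `Y` by sums over paths (`hat`),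
`f(Y)ᵢⱼ = ∑ f(Y_{i k₁}, Y_{k₁ k₂}, …, Y_{k_r j})`, and it is recovered from this action at
matrices supported on the first superdiagonal. Let `c` be a weight on partitions which is
multiplicative on juxtapositions, let `M` be the weighted sum of the `f_π` over all non-crossing
partitions, `I` the one over the irreducible partitions, and `O` the sum over the irreducible
partitions where the outer block is left out of the weight. Splitting off the first irreducible
component gives `M(Y) = 1 + I(Y) M(Y)`, that is `M = (1 - I)⁻¹` (`hat_ncWord`); splitting off the
block of the first point gives `f(Y M(Y)) = O(Y) M(Y)` (`hat_mul_hat_ncWord`). Right `B`-linearity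
enters here, for it makes the order in which the blocks are evaluated irrelevant (`val_union_eq`).

The relation `M = (1 - I)⁻¹` alone gives `β = ∑ r_π` and `β = ∑ h_π / τ(π)!` over the irreducible
partitions, since for the Boolean cumulants `I = β`. The others come from the effect of the outer
block on a weight. For the sign `(-1)^|π|` it is a change of sign, so that `O = -I`, and the
substitutions `Y ↦ Y M(Y)` attached to `β` and to `r` invert each other (`eq_neg_irrWord`). For
`t^|π| / τ(π)!` it is integration in `t`, so that `O` is the derivative of
`I_t = ∑ t^|π| / τ(π)! h_π` (`outerWord_tree`). Thus `D_t = 1 - I_t` solves `D' = -h(Y D⁻¹) D`,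
and the maps `Y ↦ Y (1 - I_t(Y))⁻¹` form a one-parameter semigroup under composition
(`hat_irrWord_tree_comp`). For the polynomial in `t` whose value at a natural number `k` is the
number of strictly increasing colourings of the blocks of `π` by `k` colours, it is summation in
`t`, so that `O` is the difference `X_{t+1} - X_t` of the sums `X_t` over the irreducible
partitions with these weights (`outerWord_omega`). If these are formed from `g = I_z`, then
`X_k = I_{zk}` for natural numbers `k`, by induction with the semigroup property, hence
`X_t = I_{zt}` for all `t`, both sides being polynomials. The linear coefficient of the colouring
polynomial is `ω(π)`, so comparison of the derivatives at `t = 0` yields `z h = ∑ ω(π) g_π`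
(`irrWord_omega_eq`). Now `z = 1`, `g = β` expresses `h` by `β`; the weight `X_{-1}` changes sign
with the outer block too, whence `r = -X_{-1} = -I_{-1}`, the formula for `r` in terms of `h`; and
finally `z = -1`, `g = -r` expresses `h` by `r`.
-/

namespace OVI

/-! ### Families of blocks and nested evaluation over a linear order -/

section Families

variable {α : Type*} [LinearOrder α]

/-- The set of points covered by a family of blocks. -/
def supp (P : Finset (Finset α)) : Finset α := P.biUnion id

/-- `P` is a set of pairwise disjoint, nonempty blocks without crossings, i.e. a non-crossing
partition of its support `supp P`. -/
structure NCFam (P : Finset (Finset α)) : Prop where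
  nonempty : ∀ V ∈ P, V.Nonempty
  disjoint : ∀ V ∈ P, ∀ W ∈ P, V ≠ W → Disjoint V W
  noncrossing : ∀ V ∈ P, ∀ W ∈ P, V ≠ W →
    ¬ ∃ i j k l : α, i < j ∧ j < k ∧ k < l ∧ i ∈ V ∧ k ∈ V ∧ j ∈ W ∧ l ∈ W

theorem mem_supp {P : Finset (Finset α)} {i : α} : i ∈ supp P ↔ ∃ V ∈ P, i ∈ V := by
  simp [supp]

@[simp] theorem supp_empty : supp (∅ : Finset (Finset α)) = ∅ := rfl

@[simp] theorem supp_singleton (V : Finset α) : supp {V} = V := by simp [supp]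

theorem supp_union (P Q : Finset (Finset α)) : supp (P ∪ Q) = supp P ∪ supp Q := by
  simp [supp, Finset.union_biUnion]

theorem supp_insert (V : Finset α) (Q : Finset (Finset α)) :
    supp (insert V Q) = V ∪ supp Q := by
  simp [supp]

theorem supp_mono {P Q : Finset (Finset α)} (h : P ⊆ Q) : supp P ⊆ supp Q :=
  Finset.biUnion_subset_biUnion_of_subset_left _ h

theorem subset_supp {P : Finset (Finset α)} {V : Finset α} (h : V ∈ P) : V ⊆ supp P :=
  fun _ hi => mem_supp.2 ⟨V, h, hi⟩

theorem NCFam.mono {P Q : Finset (Finset α)} (hP : NCFam P) (h : Q ⊆ P) : NCFam Q :=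
  ⟨fun V hV => hP.nonempty V (h hV), fun V hV W hW => hP.disjoint V (h hV) W (h hW),
    fun V hV W hW => hP.noncrossing V (h hV) W (h hW)⟩

theorem NCFam.eq_of_mem {P : Finset (Finset α)} (hP : NCFam P) {V W : Finset α} (hV : V ∈ P)
    (hW : W ∈ P) {i : α} (hi : i ∈ V) (hi' : i ∈ W) : V = W := by
  by_contra h
  exact Finset.disjoint_left.1 (hP.disjoint V hV W hW h) hi hi'

theorem NCFam.notMem_supp_erase {P : Finset (Finset α)} (hP : NCFam P) {V : Finset α}
    (hV : V ∈ P) {i : α} (hi : i ∈ V) : i ∉ supp (P.erase V) := by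
  intro h
  obtain ⟨W, hW, hiW⟩ := mem_supp.1 h
  exact (Finset.mem_erase.1 hW).1 (hP.eq_of_mem (Finset.mem_of_mem_erase hW) hV hiW hi)

theorem NCFam.empty : NCFam (∅ : Finset (Finset α)) := ⟨by simp, by simp, by simp⟩

/-- `V` is the block of `P` with the largest minimum and `l` is the largest point below `V` in the
other blocks. -/
def IsLast (P : Finset (Finset α)) (V : Finset α) (l : α) : Prop :=
  V ∈ P ∧ (∀ W ∈ P, W ≠ V → ∃ w ∈ W, ∀ v ∈ V, w < v) ∧
    IsGreatest {i | (∃ W ∈ P, W ≠ V ∧ i ∈ W) ∧ ∀ v ∈ V, i < v} l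

theorem IsLast.mem_supp_erase {P : Finset (Finset α)} {V : Finset α} {l : α} (h : IsLast P V l) :
    l ∈ supp (P.erase V) := by
  obtain ⟨-, -, ⟨⟨W, hW, hne, hl⟩, -⟩, -⟩ := h
  exact mem_supp.2 ⟨W, Finset.mem_erase.2 ⟨hne, hW⟩, hl⟩

theorem IsLast.lt {P : Finset (Finset α)} {V : Finset α} {l : α} (h : IsLast P V l) {v : α}
    (hv : v ∈ V) : l < v := h.2.2.1.2 v hv

theorem IsLast.le {P : Finset (Finset α)} {V : Finset α} {l : α} (h : IsLast P V l) {i : α}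
    (hi : i ∈ supp (P.erase V)) (hlt : ∀ v ∈ V, i < v) : i ≤ l := by
  obtain ⟨W, hW, hiW⟩ := mem_supp.1 hi
  exact h.2.2.2 ⟨⟨W, Finset.mem_of_mem_erase hW, Finset.ne_of_mem_erase hW, hiW⟩, hlt⟩

theorem IsLast.unique {P : Finset (Finset α)} {V V' : Finset α} {l l' : α}
    (h : IsLast P V l) (h' : IsLast P V' l') : V = V' ∧ l = l' := by
  have hV : V = V' := by
    by_contra hne
    obtain ⟨w, hw, h1⟩ := h.2.1 V' h'.1 (Ne.symm hne)
    obtain ⟨w', hw', h2⟩ := h'.2.1 V h.1 hne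
    exact lt_asymm (h1 w' hw') (h2 w hw)
  subst hV
  exact ⟨rfl, h.2.2.unique h'.2.2⟩

theorem NCFam.exists_isLast {P : Finset (Finset α)} (hP : NCFam P) (h : 1 < P.card) :
    ∃ V l, IsLast P V l := by
  classical
  have hne : P.Nonempty := Finset.card_pos.1 (by omega)
  obtain ⟨V, hV, hmax⟩ := Finset.exists_max_image P.attach
    (fun V => V.1.min' (hP.nonempty V.1 V.2)) (by simpa using hne)
  have key : ∀ W ∈ P, W ≠ V.1 → ∃ w ∈ W, ∀ v ∈ V.1, w < v := by
    intro W hW hWV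
    refine ⟨W.min' (hP.nonempty W hW), Finset.min'_mem _ _, fun v hv => ?_⟩
    have h1 := hmax ⟨W, hW⟩ (Finset.mem_attach _ _)
    have h2 : V.1.min' (hP.nonempty V.1 V.2) ≤ v := Finset.min'_le _ _ hv
    refine lt_of_le_of_ne (h1.trans h2) fun h3 => hWV ?_
    refine hP.eq_of_mem hW V.2 (Finset.min'_mem _ (hP.nonempty W hW)) (h3 ▸ hv)
  obtain ⟨W, hW, hWV⟩ : ∃ W ∈ P, W ≠ V.1 := by
    obtain ⟨a, ha, b, hb, hab⟩ := Finset.one_lt_card.1 h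
    by_cases h : a = V.1
    · exact ⟨b, hb, fun h' => hab (h.trans h'.symm)⟩
    · exact ⟨a, ha, h⟩
  obtain ⟨w, hw, hwV⟩ := key W hW hWV
  set S := (supp (P.erase V.1)).filter (fun i => ∀ v ∈ V.1, i < v) with hS
  have hSne : S.Nonempty := ⟨w, Finset.mem_filter.2
    ⟨mem_supp.2 ⟨W, Finset.mem_erase.2 ⟨hWV, hW⟩, hw⟩, hwV⟩⟩
  refine ⟨V.1, S.max' hSne, V.2, key, ?_, ?_⟩
  · have := Finset.mem_filter.1 (S.max'_mem hSne)
    obtain ⟨U, hU, hiU⟩ := mem_supp.1 this.1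
    exact ⟨⟨U, Finset.mem_of_mem_erase hU, Finset.ne_of_mem_erase hU, hiU⟩, this.2⟩
  · rintro i ⟨⟨U, hU, hne, hi⟩, hlt⟩
    exact S.le_max' _ (Finset.mem_filter.2
      ⟨mem_supp.2 ⟨U, Finset.mem_erase.2 ⟨hne, hU⟩, hi⟩, hlt⟩)

/-- The block with the largest minimum has no points of other blocks between its points. -/
theorem IsLast.convex {P : Finset (Finset α)} (hP : NCFam P) {V : Finset α} {l : α}
    (h : IsLast P V l) {a b c : α} (ha : a ∈ V) (hb : b ∈ V) (hc : c ∈ supp (P.erase V))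
    (hac : a < c) (hcb : c < b) : False := by
  obtain ⟨W, hW, hcW⟩ := mem_supp.1 hc
  obtain ⟨hne, hW⟩ := Finset.mem_erase.1 hW
  obtain ⟨w, hw, hwV⟩ := h.2.1 W hW hne
  exact hP.noncrossing W hW V h.1 hne ⟨w, a, c, b, hwV a ha, hac, hcb, hw, hcW, ha, hb⟩

variable {A : Type*} [Ring A]

/-- The value of a function of words on the word read off along a block. -/
def blockVal (F : Finset α → List A → A) (V : Finset α) (x : α → A) : A :=
  F V (V.sort.map x)

open Classical in
/-- Nested evaluation along a family of blocks of a linear order, the block `V` being evaluated by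
the function of words `F V`. The empty family has value `1`. -/
noncomputable def val (F : Finset α → List A → A) (P : Finset (Finset α)) (x : α → A) : A :=
  if h : ∃ p : Finset α × α, IsLast P p.1 p.2 then
    val F (P.erase h.choose.1)
      (Function.update x h.choose.2 (x h.choose.2 * blockVal F h.choose.1 x))
  else if P = ∅ then 1 else ∑ V ∈ P, blockVal F V x
termination_by P.card
decreasing_by exact Finset.card_erase_lt_of_mem h.choose_spec.1

@[simp] theorem val_empty (F : Finset α → List A → A) (x : α → A) : val F ∅ x = 1 := by
  rw [val, dif_neg, if_pos rfl]
  rintro ⟨p, hp, -⟩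
  simp at hp

@[simp] theorem val_singleton (F : Finset α → List A → A) (V : Finset α) (x : α → A) :
    val F {V} x = blockVal F V x := by
  rw [val, dif_neg, if_neg (by simp), Finset.sum_singleton]
  rintro ⟨⟨V', l⟩, hV, -, ⟨⟨W, hW, hne, -⟩, -⟩, -⟩
  simp only [Finset.mem_singleton] at hV hW
  exact hne (hW.trans hV.symm)

theorem IsLast.val_eq {P : Finset (Finset α)} {V : Finset α} {l : α} (h : IsLast P V l)
    (F : Finset α → List A → A) (x : α → A) :
    val F P x = val F (P.erase V) (Function.update x l (x l * blockVal F V x)) := by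
  have hp : ∃ p : Finset α × α, IsLast P p.1 p.2 := ⟨(V, l), h⟩
  rw [val, dif_pos hp]
  obtain ⟨h1, h2⟩ := hp.choose_spec.unique h
  rw [h1, h2]

/-- Induction along the removal of the last block. -/
theorem NCFam.induction {motive : (P : Finset (Finset α)) → NCFam P → Prop}
    (empty : motive ∅ NCFam.empty) (single : ∀ V : Finset α, ∀ h : NCFam {V}, motive {V} h)
    (peel : ∀ P V l, ∀ hP : NCFam P, IsLast P V l →
      motive (P.erase V) (hP.mono (Finset.erase_subset _ _)) → motive P hP)
    (P : Finset (Finset α)) (hP : NCFam P) : motive P hP := by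
  induction hk : P.card using Nat.strong_induction_on generalizing P with
  | _ k ih =>
    rcases Nat.lt_trichotomy P.card 1 with h | h | h
    · obtain rfl := Finset.card_eq_zero.1 (by omega : P.card = 0)
      exact empty
    · obtain ⟨V, rfl⟩ := Finset.card_eq_one.1 h
      exact single V hP
    · obtain ⟨V, l, hl⟩ := hP.exists_isLast h
      exact peel P V l hP hl (ih _ (hk ▸ Finset.card_erase_lt_of_mem hl.1) _
        (hP.mono (Finset.erase_subset _ _)) rfl)

theorem blockVal_congr {A : Type*} (F : Finset α → List A → A) {V : Finset α} {x y : α → A}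
    (h : ∀ i ∈ V, x i = y i) : blockVal F V x = blockVal F V y := by
  unfold blockVal
  congr 1
  exact List.map_congr_left fun i hi => h i ((Finset.mem_sort _).1 hi)

theorem NCFam.val_congr {P : Finset (Finset α)} (hP : NCFam P) {F G : Finset α → List A → A}
    {x y : α → A} (hF : ∀ V ∈ P, ∀ z, blockVal F V z = blockVal G V z)
    (h : ∀ i ∈ supp P, x i = y i) : val F P x = val G P y := by
  revert x y
  induction P, hP using NCFam.induction with
  | empty => intro x y _; simp
  | single V hV =>
    intro x y h
    rw [val_singleton, val_singleton, hF V (by simp)]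
    exact blockVal_congr _ fun i hi => h i (by simpa using hi)
  | peel P V l hP hl ih =>
    intro x y h
    rw [hl.val_eq, hl.val_eq]
    refine ih (fun W hW => hF W (Finset.mem_of_mem_erase hW)) fun i hi => ?_
    have hs : supp (P.erase V) ⊆ supp P := supp_mono (Finset.erase_subset _ _)
    rw [hF V hl.1, blockVal_congr G fun i hi => h i (subset_supp hl.1 hi),
      h l (hs hl.mem_supp_erase)]
    by_cases hil : i = l
    · subst hil; simp
    · simp [Function.update_of_ne hil, h i (hs hi)]

theorem NCFam.val_update_of_notMem {P : Finset (Finset α)} (hP : NCFam P)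
    (F : Finset α → List A → A) (x : α → A) {i : α} (hi : i ∉ supp P) (a : A) :
    val F P (Function.update x i a) = val F P x :=
  hP.val_congr (fun _ _ _ => rfl) fun _ hj =>
    Function.update_of_ne (ne_of_mem_of_not_mem hj hi) _ _

theorem blockVal_update_of_notMem {A : Type*} (F : Finset α → List A → A) {V : Finset α}
    (x : α → A) {i : α}
    (hi : i ∉ V) (a : A) : blockVal F V (Function.update x i a) = blockVal F V x :=
  blockVal_congr _ fun _ hj => Function.update_of_ne (ne_of_mem_of_not_mem hj hi) _ _

theorem exists_sort_map_update {A : Type*} {V : Finset α} {i : α} (hi : i ∈ V) (x : α → A) :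
    ∃ u v : List A, ∀ a : A, V.sort.map (Function.update x i a) = u ++ a :: v := by
  obtain ⟨s, t, hst⟩ := List.append_of_mem ((Finset.mem_sort (· ≤ ·)).2 hi)
  have hnd : (s ++ i :: t).Nodup := hst ▸ Finset.sort_nodup V (· ≤ ·)
  have hs : i ∉ s := fun h => by
    have := List.disjoint_of_nodup_append hnd h
    simp at this
  have ht : i ∉ t := (List.nodup_cons.1 (List.Nodup.of_append_right hnd)).1
  refine ⟨s.map x, t.map x, fun a => ?_⟩
  rw [hst, List.map_append, List.map_cons, Function.update_self]
  congr 1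
  · exact List.map_congr_left fun _ hj =>
      Function.update_of_ne (ne_of_mem_of_not_mem hj hs) _ _
  · congr 1
    exact List.map_congr_left fun _ hj =>
      Function.update_of_ne (ne_of_mem_of_not_mem hj ht) _ _

theorem exists_sort_map_update_max {A : Type*} {V : Finset α} {m : α} (hm : m ∈ V)
    (hmax : ∀ v ∈ V, v ≤ m)
    (x : α → A) :
    ∃ u : List A, ∀ a : A, V.sort.map (Function.update x m a) = u ++ [a] := by
  obtain ⟨s, t, hst⟩ := List.append_of_mem ((Finset.mem_sort (· ≤ ·)).2 hm)
  have hlt : (s ++ m :: t).Pairwise (· < ·) := hst ▸ (Finset.sortedLT_sort V).pairwise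
  have ht : t = [] := by
    by_contra h
    obtain ⟨b, hb⟩ := List.exists_mem_of_ne_nil t h
    have h1 : m < b := (List.pairwise_cons.1 (List.pairwise_append.1 hlt).2.1).1 b hb
    have h2 : b ∈ V := (Finset.mem_sort (· ≤ ·)).1 (by rw [hst]; simp [hb])
    exact absurd (hmax b h2) (not_le.2 h1)
  subst ht
  have hs : m ∉ s := fun h => lt_irrefl m ((List.pairwise_append.1 hlt).2.2 m h m (by simp))
  refine ⟨s.map x, fun a => ?_⟩
  rw [hst, List.map_append, List.map_cons, Function.update_self, List.map_nil]
  congr 1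
  exact List.map_congr_left fun _ hj =>
      Function.update_of_ne (ne_of_mem_of_not_mem hj hs) _ _

end Families

section Modular

variable {A : Type*} [Ring A] [Algebra ℂ A]

/-- `f` represents a sequence of multilinear maps `Aⁿ → B` that are right `B`-linear in the last
variable. -/
structure RightModular (B : Subalgebra ℂ A) (f : List A → A) : Prop where
  mem : ∀ w, f w ∈ B
  add : ∀ u v a a', f (u ++ (a + a') :: v) = f (u ++ a :: v) + f (u ++ a' :: v)
  smul : ∀ u v (c : ℂ) a, f (u ++ (c • a) :: v) = c • f (u ++ a :: v)
  right : ∀ u a, ∀ b ∈ B, f (u ++ [a * b]) = f (u ++ [a]) * b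

variable {α : Type*} [LinearOrder α] {B : Subalgebra ℂ A} {F : Finset α → List A → A}

theorem NCFam.val_mem {P : Finset (Finset α)} (hP : NCFam P)
    (hF : ∀ V ∈ P, RightModular B (F V)) (x : α → A) : val F P x ∈ B := by
  revert x
  induction P, hP using NCFam.induction with
  | empty => intro x; rw [val_empty]; exact B.one_mem
  | single V hV => intro x; rw [val_singleton]; exact (hF V (by simp)).mem _
  | peel P V l hP hl ih =>
    intro x
    rw [hl.val_eq]
    exact ih (fun W hW => hF W (Finset.mem_of_mem_erase hW)) _

theorem blockVal_update_add {V : Finset α} (hF : RightModular B (F V)) (x : α → A) {i : α}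
    (hi : i ∈ V) (a b : A) : blockVal F V (Function.update x i (a + b)) =
      blockVal F V (Function.update x i a) + blockVal F V (Function.update x i b) := by
  obtain ⟨u, v, h⟩ := exists_sort_map_update hi x
  simp only [blockVal, h, hF.add]

theorem blockVal_update_smul {V : Finset α} (hF : RightModular B (F V)) (x : α → A) {i : α}
    (hi : i ∈ V) (c : ℂ) (a : A) : blockVal F V (Function.update x i (c • a)) =
      c • blockVal F V (Function.update x i a) := by
  obtain ⟨u, v, h⟩ := exists_sort_map_update hi x
  simp only [blockVal, h, hF.smul]

theorem blockVal_update_mul_max {V : Finset α} (hF : RightModular B (F V)) (x : α → A) {m : α}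
    (hm : m ∈ V) (hmax : ∀ v ∈ V, v ≤ m) {b : A} (hb : b ∈ B) :
    blockVal F V (Function.update x m (x m * b)) = blockVal F V x * b := by
  obtain ⟨u, h⟩ := exists_sort_map_update_max hm hmax x
  conv_rhs => rw [← Function.update_eq_self m x]
  simp only [blockVal, h, hF.right _ _ b hb]

/-- Updating a point `i` of the remaining support and then peeling off the last block. -/
theorem IsLast.val_update {A : Type*} [Ring A] {P : Finset (Finset α)} (hP : NCFam P)
    {V : Finset α} {l : α}
    (hl : IsLast P V l) (F : Finset α → List A → A) (x : α → A) (i : α) (a : A) :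
    val F P (Function.update x i a) =
      if i ∈ V then val F (P.erase V)
        (Function.update x l (x l * blockVal F V (Function.update x i a)))
      else if i = l then val F (P.erase V) (Function.update x l (a * blockVal F V x))
      else val F (P.erase V)
        (Function.update (Function.update x l (x l * blockVal F V x)) i a) := by
  have hP' := hP.mono (Finset.erase_subset V P)
  have hlV : l ∉ V := fun h => lt_irrefl _ (hl.lt h)
  rw [hl.val_eq]
  split_ifs with h1 h2
  · have hil : i ≠ l := fun h => hlV (h ▸ h1)
    rw [Function.update_of_ne hil.symm, Function.update_comm hil,
      hP'.val_update_of_notMem _ _ (hP.notMem_supp_erase hl.1 h1)]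
  · subst h2
    rw [Function.update_self, Function.update_idem, blockVal_update_of_notMem _ _ hlV]
  · rw [Function.update_of_ne (Ne.symm h2), blockVal_update_of_notMem _ _ h1,
      Function.update_comm h2]

theorem NCFam.val_update_add {P : Finset (Finset α)} (hP : NCFam P)
    (hF : ∀ V ∈ P, RightModular B (F V)) (x : α → A) {i : α} (hi : i ∈ supp P) (a b : A) :
    val F P (Function.update x i (a + b)) =
      val F P (Function.update x i a) + val F P (Function.update x i b) := by
  revert x i a b
  induction P, hP using NCFam.induction with
  | empty => intro x i hi; simp at hi
  | single V hV =>
    intro x i hi a b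
    simp only [val_singleton]
    exact blockVal_update_add (hF V (by simp)) x (by simpa using hi) a b
  | peel P V l hP hl ih =>
    intro x i hi a b
    have hF' : ∀ W ∈ P.erase V, RightModular B (F W) :=
      fun W hW => hF W (Finset.mem_of_mem_erase hW)
    simp only [hl.val_update hP F x]
    split_ifs with h1 h2
    · rw [blockVal_update_add (hF V hl.1) x h1, mul_add, ih hF' x hl.mem_supp_erase]
    · rw [add_mul, ih hF' x hl.mem_supp_erase]
    · refine ih hF' _ ?_ a b
      obtain ⟨W, hW, hiW⟩ := mem_supp.1 hi
      exact mem_supp.2 ⟨W, Finset.mem_erase.2 ⟨fun h => h1 (h ▸ hiW), hW⟩, hiW⟩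

theorem NCFam.val_update_smul {P : Finset (Finset α)} (hP : NCFam P)
    (hF : ∀ V ∈ P, RightModular B (F V)) (x : α → A) {i : α} (hi : i ∈ supp P) (c : ℂ) (a : A) :
    val F P (Function.update x i (c • a)) = c • val F P (Function.update x i a) := by
  revert x i a
  induction P, hP using NCFam.induction with
  | empty => intro x i hi; simp at hi
  | single V hV =>
    intro x i hi a
    simp only [val_singleton]
    exact blockVal_update_smul (hF V (by simp)) x (by simpa using hi) c a
  | peel P V l hP hl ih =>
    intro x i hi a
    have hF' : ∀ W ∈ P.erase V, RightModular B (F W) :=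
      fun W hW => hF W (Finset.mem_of_mem_erase hW)
    simp only [hl.val_update hP F x]
    split_ifs with h1 h2
    · rw [blockVal_update_smul (hF V hl.1) x h1, mul_smul_comm, ih hF' x hl.mem_supp_erase]
    · rw [smul_mul_assoc, ih hF' x hl.mem_supp_erase]
    · refine ih hF' _ ?_ a
      obtain ⟨W, hW, hiW⟩ := mem_supp.1 hi
      exact mem_supp.2 ⟨W, Finset.mem_erase.2 ⟨fun h => h1 (h ▸ hiW), hW⟩, hiW⟩

/-- Nested evaluation as a linear map in the letter at the point `i` of the support. -/
noncomputable def NCFam.slot {P : Finset (Finset α)} (hP : NCFam P)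
    (hF : ∀ V ∈ P, RightModular B (F V)) (x : α → A) {i : α} (hi : i ∈ supp P) : A →ₗ[ℂ] A where
  toFun a := val F P (Function.update x i a)
  map_add' a b := hP.val_update_add hF x hi a b
  map_smul' c a := hP.val_update_smul hF x hi c a

/-- Right `B`-linearity in the last letter passes from the maps `F` to the nested values. -/
theorem NCFam.val_update_mul_max {P : Finset (Finset α)} (hP : NCFam P)
    (hF : ∀ V ∈ P, RightModular B (F V)) (x : α → A) {m : α} (hm : m ∈ supp P)
    (hmax : ∀ i ∈ supp P, i ≤ m) {b : A} (hb : b ∈ B) :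
    val F P (Function.update x m (x m * b)) = val F P x * b := by
  revert x m
  induction P, hP using NCFam.induction with
  | empty => intro x i hi; simp at hi
  | single V hV =>
    intro x m hm hmax
    simp only [val_singleton]
    exact blockVal_update_mul_max (hF V (by simp)) x (by simpa using hm)
      (by simpa using hmax) hb
  | peel P V l hP hl ih =>
    intro x m hm hmax
    have hF' : ∀ W ∈ P.erase V, RightModular B (F W) :=
      fun W hW => hF W (Finset.mem_of_mem_erase hW)
    have hVmax : ∀ v ∈ V, v ≤ m := fun v hv => hmax v (subset_supp hl.1 hv)
    have hsub := supp_mono (Finset.erase_subset V P)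
    have hVne := hP.nonempty V hl.1
    rw [hl.val_update hP F x, hl.val_eq F x]
    split_ifs with h1 h2
    · -- no point of the other blocks lies to the right of `V`, so `l` is their maximum
      have hlmax : ∀ i ∈ supp (P.erase V), i ≤ l := by
        intro i hi
        refine hl.le hi fun v hv => ?_
        have hne : ∀ v ∈ V, i ≠ v := fun v hv h => hP.notMem_supp_erase hl.1 hv (h ▸ hi)
        by_contra hvi
        exact hl.convex hP hv h1 hi (lt_of_le_of_ne (not_lt.1 hvi) (hne v hv).symm)
          (lt_of_le_of_ne (hmax i (hsub hi)) (hne m h1))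
      rw [blockVal_update_mul_max (hF V hl.1) x h1 hVmax hb]
      have := ih hF' (Function.update x l (x l * blockVal F V x)) hl.mem_supp_erase hlmax
      rw [← this, Function.update_idem, Function.update_self, mul_assoc]
    · obtain ⟨v, hv⟩ := hVne
      exact absurd (hVmax v hv) (not_le.2 (h2 ▸ hl.lt hv))
    · have hm' : m ∈ supp (P.erase V) := by
        obtain ⟨W, hW, hiW⟩ := mem_supp.1 hm
        exact mem_supp.2 ⟨W, Finset.mem_erase.2 ⟨fun h => h1 (h ▸ hiW), hW⟩, hiW⟩
      rw [← ih hF' _ hm' (fun i hi => hmax i (hsub hi)), Function.update_of_ne h2]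

/-- Any set `Q` of blocks whose support directly follows the point `l` of the remaining
support can be evaluated first, its value being multiplied to the letter at `l`. The block `V` of
largest minimum is removed, so that the number of blocks decreases, and put back on the side it
came from. -/
theorem val_union_eq {R Q : Finset (Finset α)} (hP : NCFam (R ∪ Q)) (hd : Disjoint R Q)
    (hF : ∀ V ∈ R ∪ Q, RightModular B (F V)) (x : α → A) {l : α} (hl : l ∈ supp R)
    (hlQ : ∀ q ∈ supp Q, l < q) (hRQ : ∀ s ∈ supp R, s ≤ l ∨ ∀ q ∈ supp Q, q < s) :
    val F (R ∪ Q) x = val F R (Function.update x l (x l * val F Q x)) := by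
  induction hk : (R ∪ Q).card using Nat.strong_induction_on generalizing R Q x l with
  | _ k ih =>
  rcases Q.eq_empty_or_nonempty with rfl | hQne
  · simp
  have hPR : NCFam R := hP.mono Finset.subset_union_left
  have hPQ : NCFam Q := hP.mono Finset.subset_union_right
  have hFR : ∀ V ∈ R, RightModular B (F V) := fun V hV => hF V (Finset.mem_union_left _ hV)
  have hFQ : ∀ V ∈ Q, RightModular B (F V) := fun V hV => hF V (Finset.mem_union_right _ hV)
  obtain ⟨W₀, hW₀, hlW₀⟩ := mem_supp.1 hl
  have hcard : 1 < (R ∪ Q).card := by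
    rw [Finset.card_union_of_disjoint hd]
    have := Finset.card_pos.2 hQne
    have := Finset.card_pos.2 ⟨W₀, hW₀⟩
    omega
  obtain ⟨V, m, hV⟩ := hP.exists_isLast hcard
  have hVne := hP.nonempty V hV.1
  have hlt : ((R ∪ Q).erase V).card < k := hk ▸ Finset.card_erase_lt_of_mem hV.1
  by_cases hVQ : V ∈ Q
  · -- `V` is attached to `l` if it is the only block of `Q`, and to a point of `Q` otherwise
    have hVR : V ∉ R := Finset.disjoint_right.1 hd hVQ
    have hVs : ∀ v ∈ V, v ∈ supp Q := fun v hv => subset_supp hVQ hv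
    by_cases hQV : Q = {V}
    · subst hQV
      have hlast : IsLast (R ∪ {V}) V l := by
        refine ⟨hV.1, hV.2.1, ⟨⟨W₀, Finset.mem_union_left _ hW₀, fun h => hVR (h ▸ hW₀), hlW₀⟩,
          fun v hv => hlQ v (by simpa using hv)⟩, ?_⟩
        rintro i ⟨⟨W, hW, hne, hi⟩, hiV⟩
        rcases Finset.mem_union.1 hW with hW | hW
        · obtain ⟨v, hv⟩ := hVne
          rcases hRQ i (mem_supp.2 ⟨W, hW, hi⟩) with h | h
          · exact h
          · exact absurd (h v (by simpa using hv)) (not_lt.2 (hiV v hv).le)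
        · exact absurd (Finset.mem_singleton.1 hW) hne
      rw [hlast.val_eq, val_singleton]
      congr 1
      ext W
      simp only [Finset.mem_erase, Finset.mem_union, Finset.mem_singleton]
      constructor
      · rintro ⟨h1, h2 | h2⟩
        exacts [h2, absurd h2 h1]
      · intro h
        exact ⟨fun h' => hVR (h' ▸ h), Or.inl h⟩
    · obtain ⟨W, hW, hWV⟩ : ∃ W ∈ Q, W ≠ V := by
        by_contra! h
        exact hQV (Finset.eq_singleton_iff_unique_mem.2 ⟨hVQ, h⟩)
      obtain ⟨w, hw, hwV⟩ := hV.2.1 W (Finset.mem_union_right _ hW) hWV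
      have hwm : w ≤ m := hV.le (mem_supp.2 ⟨W, Finset.mem_erase.2
        ⟨hWV, Finset.mem_union_right _ hW⟩, hw⟩) hwV
      have hlm : l < m := (hlQ w (subset_supp hW hw)).trans_le hwm
      obtain ⟨v₀, hv₀⟩ := hVne
      have hmR : m ∉ supp R := by
        intro h
        rcases hRQ m h with h | h
        · exact absurd hlm (not_lt.2 h)
        · exact lt_asymm (h v₀ (hVs v₀ hv₀)) (hV.lt hv₀)
      obtain ⟨⟨U, hU, hUV, hmU⟩, hmV⟩ := hV.2.2.1
      have hUQ : U ∈ Q := (Finset.mem_union.1 hU).resolve_left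
        fun h => hmR (mem_supp.2 ⟨U, h, hmU⟩)
      have hlast : IsLast Q V m := by
        refine ⟨hVQ, fun W hW => hV.2.1 W (Finset.mem_union_right _ hW),
          ⟨⟨U, hUQ, hUV, hmU⟩, hmV⟩, ?_⟩
        rintro i ⟨⟨W, hW, h⟩, hi⟩
        exact hV.2.2.2 ⟨⟨W, Finset.mem_union_right _ hW, h⟩, hi⟩
      have herase : (R ∪ Q).erase V = R ∪ Q.erase V := by
        rw [Finset.erase_union_distrib, Finset.erase_eq_of_notMem hVR]
      have hsub : supp (Q.erase V) ⊆ supp Q := supp_mono (Finset.erase_subset _ _)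
      rw [hV.val_eq, herase, ih _ hlt (R := R) (Q := Q.erase V) (l := l)
        (herase ▸ hP.mono (Finset.erase_subset _ _))
        (hd.mono_right (Finset.erase_subset _ _))
        (fun W hW => hF W (Finset.union_subset_union_right (Finset.erase_subset _ _) hW))
        _ hl (fun q hq => hlQ q (hsub hq))
        (fun s hs => (hRQ s hs).imp_right fun h q hq => h q (hsub hq)) (by rw [herase]),
        ← hlast.val_eq, Function.update_of_ne hlm.ne, Function.update_comm hlm.ne',
        hPR.val_update_of_notMem _ _ hmR]
  · have hVR : V ∈ R := (Finset.mem_union.1 hV.1).resolve_right hVQ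
    obtain ⟨v₀, hv₀⟩ := hVne
    obtain ⟨W₁, hW₁⟩ := hQne
    obtain ⟨w₁, hw₁, hw₁V⟩ := hV.2.1 W₁ (Finset.mem_union_right _ hW₁) (fun h => hVQ (h ▸ hW₁))
    have hlw₁ := hlQ w₁ (subset_supp hW₁ hw₁)
    have hlV : ∀ v ∈ V, l < v := fun v hv => hlw₁.trans (hw₁V v hv)
    have hQV : ∀ v ∈ V, ∀ q ∈ supp Q, q < v := fun v hv =>
      (hRQ v (subset_supp hVR hv)).resolve_left (not_le.2 (hlV v hv))
    have hlV' : l ∉ V := fun h => lt_irrefl _ (hlV l h)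
    have hW₀V : W₀ ≠ V := fun h => hlV' (h ▸ hlW₀)
    have hl' : l ∈ supp (R.erase V) := mem_supp.2 ⟨W₀, Finset.mem_erase.2 ⟨hW₀V, hW₀⟩, hlW₀⟩
    have hw₁m : w₁ ≤ m := hV.le (mem_supp.2 ⟨W₁, Finset.mem_erase.2
      ⟨fun h => hVQ (h ▸ hW₁), Finset.mem_union_right _ hW₁⟩, hw₁⟩) hw₁V
    have hlm : l < m := hlw₁.trans_le hw₁m
    have herase : (R ∪ Q).erase V = R.erase V ∪ Q := by
      rw [Finset.erase_union_distrib, Finset.erase_eq_of_notMem hVQ]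
    have hsub : supp (R.erase V) ⊆ supp R := supp_mono (Finset.erase_subset _ _)
    have hPRV := hPR.mono (Finset.erase_subset V R)
    have step := ih _ hlt (R := R.erase V) (Q := Q) (l := l)
        (herase ▸ hP.mono (Finset.erase_subset _ _))
        (hd.mono_left (Finset.erase_subset _ _))
        (fun W hW => hF W (Finset.union_subset_union_left (Finset.erase_subset _ _) hW))
        (Function.update x m (x m * blockVal F V x)) hl' hlQ
        (fun s hs => hRQ s (hsub hs)) (by rw [herase])
    rw [hV.val_eq, herase, step, Function.update_of_ne hlm.ne]
    obtain ⟨⟨U, hU, hUV, hmU⟩, hmV⟩ := hV.2.2.1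
    have hRlt : ∀ W ∈ R, W ≠ V → ∃ w ∈ W, ∀ v ∈ V, w < v := fun W hW =>
      hV.2.1 W (Finset.mem_union_left _ hW)
    by_cases hmQ : m ∈ supp Q
    · -- `V` follows the last point `m` of `Q`: as a block of `R` alone it is attached to `l`
      have hmax : ∀ q ∈ supp Q, q ≤ m := by
        intro q hq
        obtain ⟨W, hW, hqW⟩ := mem_supp.1 hq
        exact hV.le (mem_supp.2 ⟨W, Finset.mem_erase.2
          ⟨fun h => hVQ (h ▸ hW), Finset.mem_union_right _ hW⟩, hqW⟩) fun v hv => hQV v hv q hq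
      have hmR : m ∉ supp (R.erase V) := fun h => by
        rcases hRQ m (hsub h) with h | h
        · exact absurd hlm (not_lt.2 h)
        · exact lt_irrefl _ (h m hmQ)
      have hlast : IsLast R V l := by
        refine ⟨hVR, hRlt, ⟨⟨W₀, hW₀, hW₀V, hlW₀⟩, hlV⟩, ?_⟩
        rintro i ⟨⟨W, hW, hne, hi⟩, hiV⟩
        rcases hRQ i (subset_supp hW hi) with h | h
        · exact h
        · exact absurd (h m hmQ) (not_lt.2 (hV.2.2.2
            ⟨⟨W, Finset.mem_union_left _ hW, hne, hi⟩, hiV⟩))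
      rw [hPQ.val_update_mul_max hFQ x hmQ hmax (b := blockVal F V x) ((hF V hV.1).mem _),
        Function.update_comm hlm.ne', hPRV.val_update_of_notMem _ _ hmR,
        hlast.val_update hPR F x, if_neg hlV', if_pos rfl, mul_assoc]
    · have hUR : U ∈ R := (Finset.mem_union.1 hU).resolve_right
        fun h => hmQ (mem_supp.2 ⟨U, h, hmU⟩)
      have hlast : IsLast R V m := by
        refine ⟨hVR, hRlt, ⟨⟨U, hUR, hUV, hmU⟩, hmV⟩, ?_⟩
        rintro i ⟨⟨W, hW, h⟩, hi⟩
        exact hV.2.2.2 ⟨⟨W, Finset.mem_union_left _ hW, h⟩, hi⟩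
      rw [hPQ.val_update_of_notMem _ _ hmQ, hlast.val_update hPR F x, if_neg hlV',
        if_neg hlm.ne]

/-- The value of two consecutive families is the product of their values. -/
theorem val_union_eq_mul {R Q : Finset (Finset α)} (hP : NCFam (R ∪ Q))
    (hF : ∀ V ∈ R ∪ Q, RightModular B (F V)) (x : α → A)
    (hRQ : ∀ s ∈ supp R, ∀ q ∈ supp Q, s < q) : val F (R ∪ Q) x = val F R x * val F Q x := by
  have hPR : NCFam R := hP.mono Finset.subset_union_left
  rcases R.eq_empty_or_nonempty with rfl | ⟨V, hV⟩
  · simp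
  obtain ⟨i, hi⟩ := hPR.nonempty V hV
  have hne : (supp R).Nonempty := ⟨i, subset_supp hV hi⟩
  have hm := (supp R).max'_mem hne
  have hmax := fun i hi => (supp R).le_max' i hi
  have hd : Disjoint R Q := Finset.disjoint_left.2 fun W h h' => by
    obtain ⟨i, hi⟩ := hPR.nonempty W h
    exact lt_irrefl _ (hRQ i (subset_supp h hi) i (subset_supp h' hi))
  rw [val_union_eq hP hd hF x hm (fun q hq => hRQ _ hm q hq) fun s hs => Or.inl (hmax s hs)]
  exact hPR.val_update_mul_max (fun V hV => hF V (Finset.mem_union_left _ hV)) x hm hmax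
    ((hP.mono Finset.subset_union_right).val_mem
      (fun V hV => hF V (Finset.mem_union_right _ hV)) x)

end Modular

section Transport

variable {α β : Type*} [LinearOrder α] [LinearOrder β]

/-- The image of a family of blocks under an order embedding. -/
def mapFam (e : α ↪o β) (P : Finset (Finset α)) : Finset (Finset β) :=
  P.map (Finset.mapEmbedding e.toEmbedding).toEmbedding

theorem mem_mapFam {e : α ↪o β} {P : Finset (Finset α)} {W : Finset β} :
    W ∈ mapFam e P ↔ ∃ V ∈ P, V.map e.toEmbedding = W := by
  simp [mapFam, Finset.mapEmbedding]

theorem map_mem_mapFam {e : α ↪o β} {P : Finset (Finset α)} {V : Finset α} :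
    V.map e.toEmbedding ∈ mapFam e P ↔ V ∈ P := by
  rw [mem_mapFam]
  constructor
  · rintro ⟨V', h, h'⟩
    exact Finset.map_injective _ h' ▸ h
  · exact fun h => ⟨V, h, rfl⟩

theorem mapFam_injective (e : α ↪o β) : Function.Injective (mapFam e) :=
  Finset.map_injective _

theorem mapFam_erase (e : α ↪o β) (P : Finset (Finset α)) (V : Finset α) :
    mapFam e (P.erase V) = (mapFam e P).erase (V.map e.toEmbedding) := by
  simp [mapFam, Finset.map_erase, Finset.mapEmbedding]

theorem supp_mapFam (e : α ↪o β) (P : Finset (Finset α)) :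
    supp (mapFam e P) = (supp P).map e.toEmbedding := by
  ext i
  simp only [mem_supp, mem_mapFam, Finset.mem_map]
  constructor
  · rintro ⟨_, ⟨V, hV, rfl⟩, h⟩
    obtain ⟨j, hj, rfl⟩ := Finset.mem_map.1 h
    exact ⟨j, ⟨V, hV, hj⟩, rfl⟩
  · rintro ⟨j, ⟨V, hV, hj⟩, rfl⟩
    exact ⟨_, ⟨V, hV, rfl⟩, Finset.mem_map_of_mem _ hj⟩

theorem ncFam_mapFam_iff {e : α ↪o β} {P : Finset (Finset α)} : NCFam (mapFam e P) ↔ NCFam P := by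
  constructor
  · intro h
    refine ⟨fun V hV => ?_, fun V hV W hW hne => ?_, fun V hV W hW hne => ?_⟩
    · simpa using h.nonempty _ (map_mem_mapFam.2 hV)
    · simpa using h.disjoint _ (map_mem_mapFam.2 hV) _ (map_mem_mapFam.2 hW)
        (fun h => hne (Finset.map_injective _ h))
    · rintro ⟨i, j, k, l, h1, h2, h3, hi, hk, hj, hl⟩
      exact h.noncrossing _ (map_mem_mapFam.2 hV) _ (map_mem_mapFam.2 hW)
        (fun h => hne (Finset.map_injective _ h))
        ⟨e i, e j, e k, e l, e.strictMono h1, e.strictMono h2, e.strictMono h3,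
          Finset.mem_map_of_mem _ hi, Finset.mem_map_of_mem _ hk, Finset.mem_map_of_mem _ hj,
          Finset.mem_map_of_mem _ hl⟩
  · intro h
    refine ⟨fun V hV => ?_, fun V hV W hW hne => ?_, fun V hV W hW hne => ?_⟩
    all_goals obtain ⟨V, hV₀, rfl⟩ := mem_mapFam.1 hV
    · simpa using h.nonempty _ hV₀
    · obtain ⟨W, hW₀, rfl⟩ := mem_mapFam.1 hW
      simpa using h.disjoint _ hV₀ _ hW₀ (fun h' => hne (congrArg _ h'))
    · obtain ⟨W, hW₀, rfl⟩ := mem_mapFam.1 hW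
      rintro ⟨i', j', k', l', h1, h2, h3, hi, hk, hj, hl⟩
      obtain ⟨i, hi₀, rfl⟩ := Finset.mem_map.1 hi
      obtain ⟨j, hj₀, rfl⟩ := Finset.mem_map.1 hj
      obtain ⟨k, hk₀, rfl⟩ := Finset.mem_map.1 hk
      obtain ⟨l, hl₀, rfl⟩ := Finset.mem_map.1 hl
      exact h.noncrossing _ hV₀ _ hW₀ (fun h' => hne (congrArg _ h'))
        ⟨i, j, k, l, e.lt_iff_lt.1 h1, e.lt_iff_lt.1 h2, e.lt_iff_lt.1 h3, hi₀, hk₀, hj₀, hl₀⟩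

theorem IsLast.mapFam {P : Finset (Finset α)} {V : Finset α} {l : α} (h : IsLast P V l)
    (e : α ↪o β) : IsLast (mapFam e P) (V.map e.toEmbedding) (e l) := by
  refine ⟨map_mem_mapFam.2 h.1, fun W hW hne => ?_, ⟨?_, ?_⟩, ?_⟩
  · obtain ⟨W, hW₀, rfl⟩ := mem_mapFam.1 hW
    obtain ⟨w, hw, hwV⟩ := h.2.1 W hW₀ (fun h' => hne (congrArg _ h'))
    refine ⟨e w, Finset.mem_map_of_mem _ hw, fun v hv => ?_⟩
    obtain ⟨v, hv₀, rfl⟩ := Finset.mem_map.1 hv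
    exact e.strictMono (hwV v hv₀)
  · obtain ⟨⟨W, hW, hne, hl⟩, -⟩ := h.2.2.1
    exact ⟨_, map_mem_mapFam.2 hW, fun h => hne (Finset.map_injective _ h),
      Finset.mem_map_of_mem _ hl⟩
  · intro v hv
    obtain ⟨v, hv₀, rfl⟩ := Finset.mem_map.1 hv
    exact e.strictMono (h.lt hv₀)
  · rintro i ⟨⟨W, hW, hne, hi⟩, hiV⟩
    obtain ⟨W, hW₀, rfl⟩ := mem_mapFam.1 hW
    obtain ⟨i, hi₀, rfl⟩ := Finset.mem_map.1 hi
    refine e.monotone (h.2.2.2 ⟨⟨W, hW₀, fun h' => hne (congrArg _ h'), hi₀⟩, fun v hv => ?_⟩)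
    exact e.lt_iff_lt.1 (hiV _ (Finset.mem_map_of_mem _ hv))

theorem sort_map_orderEmbedding (e : α ↪o β) (V : Finset α) :
    (V.map e.toEmbedding).sort = V.sort.map e := by
  exact (StrictMonoOn.map_finsetSort e.toEmbedding V (e.strictMono.strictMonoOn _)).symm

variable {A : Type*} [Ring A]

theorem blockVal_map {A : Type*} (e : α ↪o β) (F : Finset β → List A → A) (V : Finset α)
    (x : β → A) :
    blockVal F (V.map e.toEmbedding) x =
      blockVal (fun W => F (W.map e.toEmbedding)) V (x ∘ e) := by
  simp only [blockVal, sort_map_orderEmbedding, List.map_map]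

theorem val_mapFam (e : α ↪o β) (F : Finset β → List A → A) {P : Finset (Finset α)}
    (hP : NCFam P) (x : β → A) :
    val F (mapFam e P) x = val (fun W => F (W.map e.toEmbedding)) P (x ∘ e) := by
  revert x
  induction P, hP using NCFam.induction with
  | empty => intro x; simp [mapFam]
  | single V hV =>
    intro x
    have : mapFam e {V} = {V.map e.toEmbedding} := by simp [mapFam, Finset.mapEmbedding]
    rw [this, val_singleton, val_singleton, blockVal_map]
  | peel P V l hP hl ih =>
    intro x
    rw [hl.val_eq, (hl.mapFam e).val_eq, ← mapFam_erase, ih, blockVal_map,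
      Function.update_comp_eq_of_injective _ e.injective]
    rfl

end Transport

/-! ### Sums over non-crossing partitions of a finite set of points -/

section NCFams

variable {α : Type*} [LinearOrder α]

open Classical in
/-- The non-crossing partitions of a finite set `S` of points of a linear order. -/
noncomputable def ncFams (S : Finset α) : Finset (Finset (Finset α)) :=
  S.powerset.powerset.filter fun P => NCFam P ∧ supp P = S

theorem mem_ncFams {S : Finset α} {P : Finset (Finset α)} :
    P ∈ ncFams S ↔ NCFam P ∧ supp P = S := by
  classical
  rw [ncFams, Finset.mem_filter, and_iff_right_iff_imp]
  rintro ⟨-, rfl⟩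
  exact Finset.mem_powerset.2 fun V hV => Finset.mem_powerset.2 (subset_supp hV)

theorem NCFam.eq_empty {P : Finset (Finset α)} (hP : NCFam P) (h : supp P = ∅) : P = ∅ := by
  by_contra hne
  obtain ⟨V, hV⟩ := Finset.nonempty_iff_ne_empty.2 hne
  obtain ⟨i, hi⟩ := hP.nonempty V hV
  have := subset_supp hV hi
  simp [h] at this

@[simp] theorem ncFams_empty : ncFams (∅ : Finset α) = {∅} := by
  ext P
  rw [mem_ncFams, Finset.mem_singleton]
  constructor
  · exact fun h => h.1.eq_empty h.2
  · rintro rfl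
    exact ⟨NCFam.empty, rfl⟩

theorem NCFam.union {P Q : Finset (Finset α)} (hP : NCFam P) (hQ : NCFam Q)
    (hd : Disjoint (supp P) (supp Q))
    (hconv : ∀ a ∈ supp P, ∀ b ∈ supp P, ∀ c ∈ supp Q, a < c → c < b → False) :
    NCFam (P ∪ Q) := by
  refine ⟨fun V hV => ?_, fun V hV W hW hne => ?_, fun V hV W hW hne => ?_⟩
  · rcases Finset.mem_union.1 hV with h | h
    exacts [hP.nonempty V h, hQ.nonempty V h]
  · rcases Finset.mem_union.1 hV with h | h <;> rcases Finset.mem_union.1 hW with h' | h'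
    · exact hP.disjoint V h W h' hne
    · exact hd.mono (subset_supp h) (subset_supp h')
    · exact (hd.mono (subset_supp h') (subset_supp h)).symm
    · exact hQ.disjoint V h W h' hne
  · rintro ⟨i, j, k, l, h1, h2, h3, hi, hk, hj, hl⟩
    rcases Finset.mem_union.1 hV with h | h <;> rcases Finset.mem_union.1 hW with h' | h'
    · exact hP.noncrossing V h W h' hne ⟨i, j, k, l, h1, h2, h3, hi, hk, hj, hl⟩
    · exact hconv i (subset_supp h hi) k (subset_supp h hk) j (subset_supp h' hj) h1 h2
    · exact hconv j (subset_supp h' hj) l (subset_supp h' hl) k (subset_supp h hk) h2 h3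
    · exact hQ.noncrossing V h W h' hne ⟨i, j, k, l, h1, h2, h3, hi, hk, hj, hl⟩

theorem filter_subset_union {S₁ S₂ : Finset α} (hd : Disjoint S₁ S₂) {P Q : Finset (Finset α)}
    (hP : ∀ V ∈ P, V ⊆ S₁) (hQ : ∀ V ∈ Q, V.Nonempty ∧ V ⊆ S₂) :
    (P ∪ Q).filter (· ⊆ S₁) = P := by
  ext V
  simp only [Finset.mem_filter, Finset.mem_union]
  constructor
  · rintro ⟨h | h, h'⟩
    · exact h
    · obtain ⟨⟨i, hi⟩, h2⟩ := hQ V h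
      exact (Finset.disjoint_left.1 hd (h' hi) (h2 hi)).elim
  · exact fun h => ⟨Or.inl h, hP V h⟩

open Classical in
/-- Non-crossing partitions of `S₁ ∪ S₂` refining `{S₁, S₂}` are pairs of non-crossing partitions,
provided that no point of `S₂` lies between two points of `S₁`. -/
theorem sum_ncFams_union {M : Type*} [AddCommMonoid M] {S₁ S₂ : Finset α} (hd : Disjoint S₁ S₂)
    (hconv : ∀ a ∈ S₁, ∀ b ∈ S₁, ∀ c ∈ S₂, a < c → c < b → False)
    (Φ : Finset (Finset α) → M) :
    ∑ P ∈ (ncFams (S₁ ∪ S₂)).filter (fun P => ∀ V ∈ P, V ⊆ S₁ ∨ V ⊆ S₂), Φ P =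
      ∑ P₁ ∈ ncFams S₁, ∑ P₂ ∈ ncFams S₂, Φ (P₁ ∪ P₂) := by
  rw [← Finset.sum_product']
  symm
  have hsub : ∀ {S : Finset α} {P : Finset (Finset α)}, P ∈ ncFams S →
      ∀ V ∈ P, V.Nonempty ∧ V ⊆ S := fun {S P} h V hV =>
    ⟨(mem_ncFams.1 h).1.nonempty V hV, (mem_ncFams.1 h).2 ▸ subset_supp hV⟩
  refine Finset.sum_bij' (fun p _ => p.1 ∪ p.2)
    (fun P _ => (P.filter (· ⊆ S₁), P.filter (· ⊆ S₂))) ?_ ?_ ?_ ?_ ?_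
  · rintro ⟨P, Q⟩ h
    obtain ⟨h1, h2⟩ := Finset.mem_product.1 h
    obtain ⟨hP, rfl⟩ := mem_ncFams.1 h1
    obtain ⟨hQ, rfl⟩ := mem_ncFams.1 h2
    refine Finset.mem_filter.2 ⟨mem_ncFams.2 ⟨hP.union hQ hd hconv, supp_union _ _⟩, ?_⟩
    intro V hV
    exact (Finset.mem_union.1 hV).imp (fun h => subset_supp h) fun h => subset_supp h
  · intro P hP
    obtain ⟨hP, hs⟩ := Finset.mem_filter.1 hP
    obtain ⟨hP, hsu⟩ := mem_ncFams.1 hP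
    refine Finset.mem_product.2 ⟨mem_ncFams.2 ⟨hP.mono (Finset.filter_subset _ _), ?_⟩,
      mem_ncFams.2 ⟨hP.mono (Finset.filter_subset _ _), ?_⟩⟩
    · refine Finset.Subset.antisymm (fun i hi => ?_) fun i hi => ?_
      · obtain ⟨V, hV, hiV⟩ := mem_supp.1 hi
        exact (Finset.mem_filter.1 hV).2 hiV
      · obtain ⟨V, hV, hiV⟩ := mem_supp.1 (hsu ▸ Finset.mem_union_left _ hi)
        refine mem_supp.2 ⟨V, Finset.mem_filter.2 ⟨hV, (hs V hV).resolve_right fun h => ?_⟩, hiV⟩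
        exact Finset.disjoint_left.1 hd hi (h hiV)
    · refine Finset.Subset.antisymm (fun i hi => ?_) fun i hi => ?_
      · obtain ⟨V, hV, hiV⟩ := mem_supp.1 hi
        exact (Finset.mem_filter.1 hV).2 hiV
      · obtain ⟨V, hV, hiV⟩ := mem_supp.1 (hsu ▸ Finset.mem_union_right _ hi)
        refine mem_supp.2 ⟨V, Finset.mem_filter.2 ⟨hV, (hs V hV).resolve_left fun h => ?_⟩, hiV⟩
        exact Finset.disjoint_left.1 hd (h hiV) hi
  · rintro ⟨P, Q⟩ h
    obtain ⟨h1, h2⟩ := Finset.mem_product.1 h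
    refine Prod.ext ?_ ?_
    · exact filter_subset_union hd (fun V hV => (hsub h1 V hV).2) (hsub h2)
    · simp only
      rw [Finset.union_comm]
      exact filter_subset_union hd.symm (fun V hV => (hsub h2 V hV).2) (hsub h1)
  · intro P hP
    obtain ⟨hP, hs⟩ := Finset.mem_filter.1 hP
    ext V
    simp only [Finset.mem_union, Finset.mem_filter]
    constructor
    · rintro (h | h) <;> exact h.1
    · exact fun h => (hs V h).imp (fun h' => ⟨h, h'⟩) fun h' => ⟨h, h'⟩
  · intros; rfl

/-- `W ⊆ [min V, max V]`. -/
def Nested (W V : Finset α) : Prop :=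
  ∀ w ∈ W, (∃ i ∈ V, i ≤ w) ∧ (∃ k ∈ V, w ≤ k)

theorem Nested.refl (V : Finset α) : Nested V V :=
  fun w hw => ⟨⟨w, hw, le_rfl⟩, ⟨w, hw, le_rfl⟩⟩

/-- No block of either family is nested in a block of the other one. -/
def Separated (Q R : Finset (Finset α)) : Prop :=
  ∀ V ∈ Q, ∀ W ∈ R, ¬ Nested V W ∧ ¬ Nested W V

theorem Separated.disjoint {Q R : Finset (Finset α)} (h : Separated Q R) : Disjoint Q R :=
  Finset.disjoint_left.2 fun V hV hV' => (h V hV V hV').1 (Nested.refl V)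

theorem separated_of_lt {Q R : Finset (Finset α)} (hQ : NCFam Q) (hR : NCFam R)
    (h : ∀ s ∈ supp Q, ∀ t ∈ supp R, s < t) : Separated Q R := by
  intro V hV W hW
  constructor
  · intro hn
    obtain ⟨v, hv⟩ := hQ.nonempty V hV
    obtain ⟨w, hw, hwv⟩ := (hn v hv).1
    exact absurd (h v (subset_supp hV hv) w (subset_supp hW hw)) (not_lt.2 hwv)
  · intro hn
    obtain ⟨w, hw⟩ := hR.nonempty W hW
    obtain ⟨v, hv, hwv⟩ := (hn w hw).2
    exact absurd (h v (subset_supp hV hv) w (subset_supp hW hw)) (not_lt.2 hwv)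

end NCFams

/-- A coefficient on families of blocks that is multiplicative on families without mutual nesting
and only depends on the relative position of the blocks. -/
structure TreeWeight (c : Finset (Finset ℕ) → ℂ) : Prop where
  empty : c ∅ = 1
  union : ∀ Q R, Separated Q R → c (Q ∪ R) = c Q * c R
  map : ∀ (e : ℕ ↪o ℕ) (P : Finset (Finset ℕ)), c (mapFam e P) = c P

section Sums

variable {A : Type*} [Ring A] [Algebra ℂ A]

/-- The sum `∑ c(P) f_P` over all non-crossing partitions `P` of `S`. -/
noncomputable def ncSum (c : Finset (Finset ℕ) → ℂ) (f : List A → A) (S : Finset ℕ) (x : ℕ → A) :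
    A :=
  ∑ P ∈ ncFams S, c P • val (fun _ => f) P x

open Classical in
/-- The irreducible non-crossing partitions of the interval `[i, k)`. -/
noncomputable def irrFams (i k : ℕ) : Finset (Finset (Finset ℕ)) :=
  (ncFams (Finset.Ico i k)).filter fun P => ∃ V ∈ P, i ∈ V ∧ ∃ m ∈ V, m + 1 = k

theorem mem_irrFams {i k : ℕ} {P : Finset (Finset ℕ)} :
    P ∈ irrFams i k ↔ P ∈ ncFams (Finset.Ico i k) ∧ ∃ V ∈ P, i ∈ V ∧ ∃ m ∈ V, m + 1 = k := by
  classical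
  rw [irrFams, Finset.mem_filter]

/-- The sum `∑ c(P) f_P` over all irreducible non-crossing partitions `P` of `[i, k)`. -/
noncomputable def irrSum (c : Finset (Finset ℕ) → ℂ) (f : List A → A) (i k : ℕ) (x : ℕ → A) : A :=
  ∑ P ∈ irrFams i k, c P • val (fun _ => f) P x

/-- A non-crossing partition of an interval is an irreducible partition of an initial segment,
followed by an arbitrary partition of the rest. -/
theorem sum_ncFams_Ico {M : Type*} [AddCommMonoid M] {i j : ℕ} (hij : i < j)
    (Φ : Finset (Finset ℕ) → M) :
    ∑ P ∈ ncFams (Finset.Ico i j), Φ P =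
      ∑ k ∈ Finset.Ioc i j, ∑ Q ∈ irrFams i k, ∑ R ∈ ncFams (Finset.Ico k j), Φ (Q ∪ R) := by
  classical
  let C : ℕ → Finset (Finset ℕ) → Prop := fun k P =>
    ∃ V ∈ P, i ∈ V ∧ (∃ m ∈ V, m + 1 = k) ∧ ∀ v ∈ V, v < k
  have h1 : ∀ k ∈ Finset.Ioc i j,
      ∑ Q ∈ irrFams i k, ∑ R ∈ ncFams (Finset.Ico k j), Φ (Q ∪ R) =
        ∑ P ∈ ncFams (Finset.Ico i j), if C k P then Φ P else 0 := by
    intro k hk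
    obtain ⟨hik, hkj⟩ := Finset.mem_Ioc.1 hk
    have hu : Finset.Ico i k ∪ Finset.Ico k j = Finset.Ico i j :=
      Finset.Ico_union_Ico_eq_Ico hik.le hkj
    have hd : Disjoint (Finset.Ico i k) (Finset.Ico k j) :=
      Finset.Ico_disjoint_Ico_consecutive _ _ _
    have := sum_ncFams_union hd
      (by simp only [Finset.mem_Ico]; omega) (fun P => if C k P then Φ P else 0)
    rw [hu] at this
    rw [irrFams, Finset.sum_filter]
    have h2 : ∑ P ∈ ncFams (Finset.Ico i j), (if C k P then Φ P else 0) =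
        ∑ P ∈ (ncFams (Finset.Ico i j)).filter
          (fun P => ∀ V ∈ P, V ⊆ Finset.Ico i k ∨ V ⊆ Finset.Ico k j),
          if C k P then Φ P else 0 := by
      symm
      refine Finset.sum_filter_of_ne fun P hP hne => ?_
      obtain ⟨V, hV, hiV, ⟨m, hm, hmk⟩, hlt⟩ : C k P := by
        by_contra h
        exact hne (if_neg h)
      obtain ⟨hP, hs⟩ := mem_ncFams.1 hP
      intro W hW
      have hWs : ∀ w ∈ W, i ≤ w ∧ w < j := fun w hw =>
        Finset.mem_Ico.1 (hs ▸ subset_supp hW hw)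
      by_cases hWV : W = V
      · subst hWV
        exact Or.inl fun w hw => Finset.mem_Ico.2 ⟨(hWs w hw).1, hlt w hw⟩
      · by_cases h : ∃ w ∈ W, w < k
        · obtain ⟨w, hw, hwk⟩ := h
          left
          intro w' hw'
          refine Finset.mem_Ico.2 ⟨(hWs w' hw').1, ?_⟩
          by_contra hkw'
          have hwi : w ≠ i := fun h => hWV (hP.eq_of_mem hW hV hw (h ▸ hiV))
          have hwm : w ≠ m := fun h => hWV (hP.eq_of_mem hW hV hw (h ▸ hm))
          have := (hWs w hw).1
          exact hP.noncrossing V hV W hW (Ne.symm hWV)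
            ⟨i, w, m, w', by omega, by omega, by omega, hiV, hm, hw, hw'⟩
        · push Not at h
          exact Or.inr fun w hw => Finset.mem_Ico.2 ⟨h w hw, (hWs w hw).2⟩
    rw [h2, this]
    refine Finset.sum_congr rfl fun Q hQ => ?_
    obtain ⟨hQ, hsQ⟩ := mem_ncFams.1 hQ
    have hC : ∀ R ∈ ncFams (Finset.Ico k j),
        (C k (Q ∪ R) ↔ ∃ V ∈ Q, i ∈ V ∧ ∃ m ∈ V, m + 1 = k) := by
      intro R hR
      obtain ⟨hR, hsR⟩ := mem_ncFams.1 hR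
      constructor
      · rintro ⟨V, hV, hiV, hm, -⟩
        refine ⟨V, (Finset.mem_union.1 hV).resolve_right fun h => ?_, hiV, hm⟩
        have := Finset.mem_Ico.1 (hsR ▸ subset_supp h hiV)
        omega
      · rintro ⟨V, hV, hiV, hm⟩
        exact ⟨V, Finset.mem_union_left _ hV, hiV, hm, fun v hv =>
          (Finset.mem_Ico.1 (hsQ ▸ subset_supp hV hv)).2⟩
    split_ifs with h
    · exact Finset.sum_congr rfl fun R hR => by rw [if_pos ((hC R hR).2 h)]
    · exact (Finset.sum_eq_zero fun R hR => by rw [if_neg fun h' => h ((hC R hR).1 h')]).symm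
  rw [Finset.sum_congr rfl h1, Finset.sum_comm]
  refine Finset.sum_congr rfl fun P hP => ?_
  obtain ⟨hP, hs⟩ := mem_ncFams.1 hP
  obtain ⟨V, hV, hiV⟩ := mem_supp.1 (hs ▸ Finset.mem_Ico.2 ⟨le_rfl, hij⟩ : i ∈ supp P)
  have hm := V.max'_mem ⟨i, hiV⟩
  have hmax := fun v hv => V.le_max' v hv
  set m := V.max' ⟨i, hiV⟩
  have hmj := Finset.mem_Ico.1 (hs ▸ subset_supp hV hm)
  rw [Finset.sum_eq_single (m + 1)]
  · rw [if_pos ⟨V, hV, hiV, ⟨m, hm, rfl⟩, fun v hv => Nat.lt_succ_of_le (hmax v hv)⟩]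
  · intro k _ hk
    rw [if_neg]
    rintro ⟨V', hV', hiV', ⟨m', hm', rfl⟩, hlt⟩
    obtain rfl := hP.eq_of_mem hV hV' hiV hiV'
    have h1 := hlt m hm
    have h2 := hmax m' hm'
    omega
  · intro h
    refine absurd (Finset.mem_Ioc.2 ⟨?_, ?_⟩) h <;> omega

/-- The sum over all partitions, split at the end of the first irreducible component. -/
theorem ncSum_Ico {B : Subalgebra ℂ A} {c : Finset (Finset ℕ) → ℂ} (hc : TreeWeight c)
    {f : List A → A} (hf : RightModular B f) (x : ℕ → A) {i j : ℕ} (hij : i < j) :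
    ncSum c f (Finset.Ico i j) x =
      ∑ k ∈ Finset.Ioc i j, irrSum c f i k x * ncSum c f (Finset.Ico k j) x := by
  rw [ncSum, sum_ncFams_Ico hij]
  refine Finset.sum_congr rfl fun k hk => ?_
  obtain ⟨hik, hkj⟩ := Finset.mem_Ioc.1 hk
  rw [irrSum, ncSum, Finset.sum_mul_sum]
  refine Finset.sum_congr rfl fun Q hQ => Finset.sum_congr rfl fun R hR => ?_
  obtain ⟨hQ, hsQ⟩ := mem_ncFams.1 (mem_irrFams.1 hQ).1
  obtain ⟨hR, hsR⟩ := mem_ncFams.1 hR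
  have hlt : ∀ s ∈ supp Q, ∀ t ∈ supp R, s < t := by
    rw [hsQ, hsR]
    simp only [Finset.mem_Ico]
    omega
  rw [hc.union _ _ (separated_of_lt hQ hR hlt), val_union_eq_mul (B := B) (hQ.union hR ?_ ?_)
    (fun _ _ => hf) x hlt, smul_mul_smul_comm]
  · exact Finset.disjoint_left.2 fun i h h' => lt_irrefl _ (hlt i h i h')
  · exact fun a _ b hb c hc _ h => lt_asymm h (hlt b hb c hc)

theorem ncSum_congr (c : Finset (Finset ℕ) → ℂ) {f g : List A → A} {S : Finset ℕ} {x y : ℕ → A}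
    (hfg : ∀ w, w.length ≤ S.card → f w = g w) (h : ∀ i ∈ S, x i = y i) :
    ncSum c f S x = ncSum c g S y := by
  refine Finset.sum_congr rfl fun P hP => ?_
  obtain ⟨hP', hs⟩ := mem_ncFams.1 hP
  rw [hP'.val_congr (fun V hV z => hfg _ ?_) (hs ▸ h)]
  rw [List.length_map, Finset.length_sort]
  exact Finset.card_le_card (hs ▸ subset_supp hV)

/-- The points of `[i, j)` after the point `v` and before the next point of `V`. -/
def gap (V : Finset ℕ) (j v : ℕ) : Finset ℕ :=
  (Finset.Ico (v + 1) j).filter fun m => ∀ w ∈ V, v < w → m < w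

theorem mem_gap {V : Finset ℕ} {j v m : ℕ} :
    m ∈ gap V j v ↔ v < m ∧ m < j ∧ ∀ w ∈ V, v < w → m < w := by
  simp [gap, and_assoc]

theorem notMem_gap {V : Finset ℕ} {j v m : ℕ} (hm : m ∈ V) : m ∉ gap V j v := fun h =>
  lt_irrefl _ ((mem_gap.1 h).2.2 m hm (mem_gap.1 h).1)

theorem gap_lt {V : Finset ℕ} {j v w m m' : ℕ} (hw : w ∈ V) (hvw : v < w) (hm : m ∈ gap V j v)
    (hm' : m' ∈ gap V j w) : m < m' :=
  ((mem_gap.1 hm).2.2 w hw hvw).trans (mem_gap.1 hm').1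

theorem exists_mem_gap {V : Finset ℕ} {i j m : ℕ} (hi : i ∈ V) (him : i < m) (hmj : m < j)
    (hm : m ∉ V) : ∃ v ∈ V, m ∈ gap V j v := by
  have hne : (V.filter (· < m)).Nonempty := ⟨i, Finset.mem_filter.2 ⟨hi, him⟩⟩
  have hv := Finset.mem_filter.1 ((V.filter (· < m)).max'_mem hne)
  refine ⟨_, hv.1, mem_gap.2 ⟨hv.2, hmj, fun w hw hlt => ?_⟩⟩
  by_contra h
  have hwm : w < m := lt_of_le_of_ne (not_lt.1 h) (fun h => hm (h ▸ hw))
  exact absurd ((V.filter (· < m)).le_max' w (Finset.mem_filter.2 ⟨hw, hwm⟩)) (not_le.2 hlt)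

theorem ncFam_insert {V : Finset ℕ} {j : ℕ} {R : Finset (Finset ℕ)} (hV : V.Nonempty)
    (hR : NCFam R) (h : ∀ W ∈ R, ∃ v ∈ V, W ⊆ gap V j v) : NCFam (insert V R) := by
  have hdis : ∀ W ∈ R, Disjoint V W := fun W hW => by
    obtain ⟨v, -, hv⟩ := h W hW
    exact Finset.disjoint_left.2 fun m hm hm' => notMem_gap hm (hv hm')
  refine ⟨fun W hW => ?_, fun W hW U hU hne => ?_, fun W hW U hU hne => ?_⟩
  · rcases Finset.mem_insert.1 hW with rfl | hW
    exacts [hV, hR.nonempty W hW]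
  · rcases Finset.mem_insert.1 hW with rfl | hW' <;> rcases Finset.mem_insert.1 hU with rfl | hU'
    · exact absurd rfl hne
    · exact hdis U hU'
    · exact (hdis W hW').symm
    · exact hR.disjoint W hW' U hU' hne
  · rintro ⟨a, b, c, d, h1, h2, h3, ha, hc, hb, hd⟩
    rcases Finset.mem_insert.1 hW with rfl | hW' <;> rcases Finset.mem_insert.1 hU with rfl | hU'
    · exact absurd rfl hne
    · obtain ⟨v, -, hv⟩ := h U hU'
      exact lt_asymm h3 ((mem_gap.1 (hv hd)).2.2 c hc ((mem_gap.1 (hv hb)).1.trans h2))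
    · obtain ⟨v, -, hv⟩ := h W hW'
      exact lt_asymm h2 ((mem_gap.1 (hv hc)).2.2 b hb ((mem_gap.1 (hv ha)).1.trans h1))
    · exact hR.noncrossing W hW' U hU' hne ⟨a, b, c, d, h1, h2, h3, ha, hc, hb, hd⟩

open Classical in
/-- The families of blocks filling the gaps of `V` after the points of `D ⊆ V`. -/
noncomputable def gapFams (V : Finset ℕ) (j : ℕ) (D : Finset ℕ) : Finset (Finset (Finset ℕ)) :=
  (ncFams (D.biUnion (gap V j))).filter fun R => ∀ W ∈ R, ∃ v ∈ D, W ⊆ gap V j v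

theorem mem_gapFams {V : Finset ℕ} {j : ℕ} {D : Finset ℕ} {R : Finset (Finset ℕ)} :
    R ∈ gapFams V j D ↔
      (NCFam R ∧ supp R = D.biUnion (gap V j)) ∧ ∀ W ∈ R, ∃ v ∈ D, W ⊆ gap V j v := by
  classical
  rw [gapFams, Finset.mem_filter, mem_ncFams]

theorem sum_gapFams_insert {M : Type*} [AddCommMonoid M] {V : Finset ℕ} {j d : ℕ} {D : Finset ℕ}
    (hdD : d ∉ D) (hDV : insert d D ⊆ V) (Φ : Finset (Finset ℕ) → M) :
    ∑ R ∈ gapFams V j (insert d D), Φ R =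
      ∑ G ∈ ncFams (gap V j d), ∑ R ∈ gapFams V j D, Φ (G ∪ R) := by
  classical
  have hdV : d ∈ V := hDV (Finset.mem_insert_self _ _)
  have hne : ∀ v ∈ D, v ≠ d := fun v hv h => hdD (h ▸ hv)
  have hlt : ∀ c ∈ D.biUnion (gap V j),
      (∀ a ∈ gap V j d, a < c) ∨ (∀ a ∈ gap V j d, c < a) := by
    intro c hc
    obtain ⟨v, hv, hcv⟩ := Finset.mem_biUnion.1 hc
    have hvV : v ∈ V := hDV (Finset.mem_insert_of_mem hv)
    rcases lt_or_gt_of_ne (hne v hv) with h | h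
    · exact Or.inr fun a ha => gap_lt hdV h hcv ha
    · exact Or.inl fun a ha => gap_lt hvV h ha hcv
  have hdis : Disjoint (gap V j d) (D.biUnion (gap V j)) := Finset.disjoint_left.2 fun m hm hm' =>
    (hlt m hm').elim (fun h => lt_irrefl _ (h m hm)) fun h => lt_irrefl _ (h m hm)
  have := sum_ncFams_union hdis (fun a ha b hb c hc h1 h2 =>
    (hlt c hc).elim (fun h => lt_asymm h2 (h b hb)) fun h => lt_asymm h1 (h a ha))
    (fun R => if ∀ W ∈ R, ∃ v ∈ insert d D, W ⊆ gap V j v then Φ R else 0)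
  rw [gapFams, Finset.biUnion_insert]
  have h2 : ∑ R ∈ ncFams (gap V j d ∪ D.biUnion (gap V j)),
      (if ∀ W ∈ R, ∃ v ∈ insert d D, W ⊆ gap V j v then Φ R else 0) =
      ∑ R ∈ (ncFams (gap V j d ∪ D.biUnion (gap V j))).filter
        (fun P => ∀ W ∈ P, W ⊆ gap V j d ∨ W ⊆ D.biUnion (gap V j)),
      if ∀ W ∈ R, ∃ v ∈ insert d D, W ⊆ gap V j v then Φ R else 0 := by
    symm
    refine Finset.sum_filter_of_ne fun R hR hne => ?_
    have h : ∀ W ∈ R, ∃ v ∈ insert d D, W ⊆ gap V j v := by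
      by_contra h
      exact hne (if_neg h)
    intro W hW
    obtain ⟨v, hv, hWv⟩ := h W hW
    rcases Finset.mem_insert.1 hv with rfl | hv
    · exact Or.inl hWv
    · exact Or.inr (hWv.trans (Finset.subset_biUnion_of_mem _ hv))
  rw [Finset.sum_filter, h2, this]
  refine Finset.sum_congr rfl fun G hG => ?_
  rw [gapFams, Finset.sum_filter]
  obtain ⟨hG, hsG⟩ := mem_ncFams.1 hG
  refine Finset.sum_congr rfl fun R hR => ?_
  obtain ⟨hR, hsR⟩ := mem_ncFams.1 hR
  refine if_congr ?_ rfl rfl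
  constructor
  · intro h W hW
    obtain ⟨v, hv, hWv⟩ := h W (Finset.mem_union_right _ hW)
    rcases Finset.mem_insert.1 hv with rfl | hv
    · obtain ⟨w, hw⟩ := hR.nonempty W hW
      exact (Finset.disjoint_left.1 hdis (hWv hw) (hsR ▸ subset_supp hW hw)).elim
    · exact ⟨v, hv, hWv⟩
  · intro h W hW
    rcases Finset.mem_union.1 hW with hW | hW
    · exact ⟨d, Finset.mem_insert_self _ _, hsG ▸ subset_supp hW⟩
    · obtain ⟨v, hv, hWv⟩ := h W hW
      exact ⟨v, Finset.mem_insert_of_mem hv, hWv⟩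

/-- Summing over all fillings of the gaps of `V` after the points of `D` multiplies every letter
at a point of `D` by the sum over all fillings of its gap. -/
theorem sum_gapFams {B : Subalgebra ℂ A} {c : Finset (Finset ℕ) → ℂ} (hc : TreeWeight c)
    {f : List A → A} (hf : RightModular B f) {V : Finset ℕ} (hV : V.Nonempty) (j : ℕ)
    (D : Finset ℕ) (hDV : D ⊆ V) (x : ℕ → A) :
    ∑ R ∈ gapFams V j D, c R • val (fun _ => f) (insert V R) x =
      blockVal (fun _ => f) V
        (fun v => if v ∈ D then x v * ncSum c f (gap V j v) x else x v) := by
  induction D using Finset.induction_on generalizing x with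
  | empty =>
    have : gapFams V j ∅ = {∅} := by
      ext R
      rw [mem_gapFams, Finset.biUnion_empty, ← mem_ncFams, ncFams_empty, Finset.mem_singleton]
      exact ⟨fun h => h.1, fun h => ⟨h, by simp [h]⟩⟩
    simp [this, hc.empty]
  | insert d D hdD ih =>
    have hdV : d ∈ V := hDV (Finset.mem_insert_self _ _)
    have hDV' : D ⊆ V := (Finset.subset_insert _ _).trans hDV
    rw [sum_gapFams_insert hdD hDV, Finset.sum_comm]
    set x' : ℕ → A := Function.update x d (x d * ncSum c f (gap V j d) x) with hx'
    have key : ∀ R ∈ gapFams V j D,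
        ∑ G ∈ ncFams (gap V j d), c (G ∪ R) • val (fun _ => f) (insert V (G ∪ R)) x =
          c R • val (fun _ => f) (insert V R) x' := by
      intro R hR
      obtain ⟨⟨hR, hsR⟩, hRg⟩ := mem_gapFams.1 hR
      have hRg' : ∀ W ∈ R, ∃ v ∈ V, W ⊆ gap V j v := fun W hW =>
        (hRg W hW).imp fun v hv => ⟨hDV' hv.1, hv.2⟩
      have hVR := ncFam_insert hV hR hRg'
      have hdS : d ∈ supp (insert V R) := subset_supp (Finset.mem_insert_self _ _) hdV
      have hS : ∀ s ∈ supp (insert V R), s ≤ d ∨ ∀ q ∈ gap V j d, q < s := by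
        intro s hs
        by_contra! h
        obtain ⟨hds, q, hq, hsq⟩ := h
        rw [supp_insert, hsR] at hs
        rcases Finset.mem_union.1 hs with hs | hs
        · exact absurd ((mem_gap.1 hq).2.2 s hs hds) (not_lt.2 hsq)
        · obtain ⟨v, hv, hsv⟩ := Finset.mem_biUnion.1 hs
          rcases lt_trichotomy v d with h | rfl | h
          · exact lt_asymm hds ((mem_gap.1 hsv).2.2 d hdV h)
          · exact hdD hv
          · exact absurd (gap_lt (hDV' hv) h hq hsv) (not_lt.2 hsq)
      have step : ∀ G ∈ ncFams (gap V j d),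
          c (G ∪ R) • val (fun _ => f) (insert V (G ∪ R)) x =
            c R • (hVR.slot (B := B) (fun _ _ => hf) x hdS)
              (x d * c G • val (fun _ => f) G x) := by
        intro G hG
        obtain ⟨hG, hsG⟩ := mem_ncFams.1 hG
        have hins : insert V (G ∪ R) = insert V R ∪ G := by
          rw [Finset.insert_union, Finset.union_comm]
        have hNC : NCFam (G ∪ R) := by
          refine hG.union hR ?_ ?_
          · rw [hsG, hsR]
            refine Finset.disjoint_left.2 fun m hm hm' => ?_
            have hmd := (mem_gap.1 hm).1
            rcases hS m (by rw [supp_insert, hsR]; exact Finset.mem_union_right _ hm') with h | h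
            · omega
            · exact lt_irrefl _ (h m hm)
          · rw [hsG, hsR]
            intro a ha b hb s hs h1 h2
            have hmd := (mem_gap.1 ha).1
            rcases hS s (by rw [supp_insert, hsR]; exact Finset.mem_union_right _ hs) with h | h
            · omega
            · exact lt_asymm h2 (h b hb)
        have hNCV : NCFam (insert V R ∪ G) := by
          rw [← hins]
          refine ncFam_insert (j := j) hV hNC fun W hW => ?_
          rcases Finset.mem_union.1 hW with h | h
          · exact ⟨d, hdV, hsG ▸ subset_supp h⟩
          · exact hRg' W h
        have hdisj : Disjoint (insert V R) G := by
          refine Finset.disjoint_left.2 fun W h h' => ?_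
          obtain ⟨w, hw⟩ := hG.nonempty W h'
          have hwg : w ∈ gap V j d := hsG ▸ subset_supp h' hw
          rcases hS w (subset_supp h hw) with h2 | h2
          · exact absurd (mem_gap.1 hwg).1 (not_lt.2 h2)
          · exact lt_irrefl _ (h2 w hwg)
        have hsep : Separated G R := by
          intro W hW U hU
          obtain ⟨v, hv, hUv⟩ := hRg U hU
          have hWd : W ⊆ gap V j d := hsG ▸ subset_supp hW
          obtain ⟨w, hw⟩ := hG.nonempty W hW
          obtain ⟨u, hu⟩ := hR.nonempty U hU
          rcases lt_or_gt_of_ne (show v ≠ d from fun h => hdD (h ▸ hv)) with h | h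
          · have hlt : ∀ u ∈ U, ∀ w ∈ W, u < w := fun u hu w hw =>
              gap_lt hdV h (hUv hu) (hWd hw)
            refine ⟨fun hn => ?_, fun hn => ?_⟩
            · obtain ⟨k, hk, hwk⟩ := (hn w hw).2
              exact absurd (hlt k hk w hw) (not_lt.2 hwk)
            · obtain ⟨k, hk, hwk⟩ := (hn u hu).1
              exact absurd (hlt u hu k hk) (not_lt.2 hwk)
          · have hlt : ∀ u ∈ U, ∀ w ∈ W, w < u := fun u hu w hw =>
              gap_lt (hDV' hv) h (hWd hw) (hUv hu)
            refine ⟨fun hn => ?_, fun hn => ?_⟩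
            · obtain ⟨k, hk, hwk⟩ := (hn w hw).1
              exact absurd (hlt k hk w hw) (not_lt.2 hwk)
            · obtain ⟨k, hk, hwk⟩ := (hn u hu).2
              exact absurd (hlt u hu k hk) (not_lt.2 hwk)
        rw [hc.union _ _ hsep, hins, val_union_eq hNCV hdisj (fun _ _ => hf) x hdS
          (fun q hq => (mem_gap.1 (hsG ▸ hq : q ∈ gap V j d)).1)
          (fun s hs => by rw [hsG]; exact hS s hs), mul_smul_comm, map_smul, smul_smul, mul_comm]
        rfl
      rw [Finset.sum_congr rfl step, ← Finset.smul_sum, ← map_sum, ← Finset.mul_sum]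
      rfl
    rw [Finset.sum_congr rfl key, ih hDV']
    refine blockVal_congr _ fun v hv => ?_
    have hcongr : ncSum c f (gap V j v) x' = ncSum c f (gap V j v) x :=
      ncSum_congr c (fun _ _ => rfl) fun m hm =>
        Function.update_of_ne (fun h => notMem_gap (j := j) (v := v) (h ▸ hdV) hm) _ _
    by_cases hvd : v = d
    · subst hvd
      simp [hdD, x']
    · simp [hvd, hcongr, x']

theorem mem_gapFams_self_iff {V : Finset ℕ} {i j : ℕ} (hV : V ⊆ Finset.Ico i j) (hi : i ∈ V)
    {R : Finset (Finset ℕ)} :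
    R ∈ gapFams V j V ↔ V ∉ R ∧ insert V R ∈ ncFams (Finset.Ico i j) := by
  rw [mem_gapFams, mem_ncFams]
  constructor
  · rintro ⟨⟨hR, hs⟩, hg⟩
    refine ⟨fun h => ?_, ncFam_insert ⟨i, hi⟩ hR hg, ?_⟩
    · obtain ⟨v, -, hv⟩ := hg V h
      exact notMem_gap hi (hv hi)
    · rw [supp_insert, hs]
      ext m
      constructor
      · intro hm
        rcases Finset.mem_union.1 hm with hm | hm
        · exact hV hm
        · obtain ⟨v, hv, hmv⟩ := Finset.mem_biUnion.1 hm
          have h1 := Finset.mem_Ico.1 (hV hv)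
          have h2 := mem_gap.1 hmv
          exact Finset.mem_Ico.2 ⟨by omega, by omega⟩
      · intro hm
        obtain ⟨h1, h2⟩ := Finset.mem_Ico.1 hm
        by_cases hmV : m ∈ V
        · exact Finset.mem_union_left _ hmV
        · obtain ⟨v, hv, hmv⟩ := exists_mem_gap hi
            (lt_of_le_of_ne h1 fun h => hmV (h ▸ hi)) h2 hmV
          exact Finset.mem_union_right _ (Finset.mem_biUnion.2 ⟨v, hv, hmv⟩)
  · rintro ⟨hVR, hP, hs⟩
    have hR : NCFam R := hP.mono (Finset.subset_insert _ _)
    have hg : ∀ W ∈ R, ∃ v ∈ V, W ⊆ gap V j v := by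
      intro W hW
      have hWs : ∀ w ∈ W, i ≤ w ∧ w < j := fun w hw =>
        Finset.mem_Ico.1 (hs ▸ subset_supp (Finset.mem_insert_of_mem hW) hw)
      have hWV : V ≠ W := fun h => hVR (h ▸ hW)
      have hdis := hP.disjoint V (Finset.mem_insert_self _ _) W (Finset.mem_insert_of_mem hW) hWV
      have hm := W.min'_mem (hR.nonempty W hW)
      have hmin := fun w hw => W.min'_le w hw
      set m := W.min' (hR.nonempty W hW)
      have hmV : m ∉ V := fun h => Finset.disjoint_left.1 hdis h hm
      obtain ⟨v, hv, hmv⟩ := exists_mem_gap hi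
        (lt_of_le_of_ne (hWs m hm).1 fun h => hmV (h ▸ hi)) (hWs m hm).2 hmV
      obtain ⟨h1, -, h3⟩ := mem_gap.1 hmv
      refine ⟨v, hv, fun w hw => mem_gap.2 ⟨h1.trans_le (hmin w hw), (hWs w hw).2, ?_⟩⟩
      intro u hu hvu
      by_contra huw
      have huw' : u < w := lt_of_le_of_ne (not_lt.1 huw) fun h =>
        Finset.disjoint_left.1 hdis hu (h ▸ hw)
      exact hP.noncrossing V (Finset.mem_insert_self _ _) W (Finset.mem_insert_of_mem hW) hWV
        ⟨v, m, u, w, h1, h3 u hu hvu, huw', hv, hu, hm, hw⟩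
    refine ⟨⟨hR, Finset.Subset.antisymm (fun m hm => ?_) fun m hm => ?_⟩, hg⟩
    · obtain ⟨W, hW, hmW⟩ := mem_supp.1 hm
      obtain ⟨v, hv, hWv⟩ := hg W hW
      exact Finset.mem_biUnion.2 ⟨v, hv, hWv hmW⟩
    · obtain ⟨v, hv, hmv⟩ := Finset.mem_biUnion.1 hm
      have h1 := Finset.mem_Ico.1 (hV hv)
      have h2 := mem_gap.1 hmv
      have : m ∈ supp (insert V R) := by
        rw [hs]
        exact Finset.mem_Ico.2 ⟨by omega, by omega⟩
      rw [supp_insert] at this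
      exact (Finset.mem_union.1 this).resolve_left fun h => notMem_gap h hmv

/-- Summation over the block `V` of the first point: removing `V` leaves independent
non-crossing partitions of the gaps of `V`. -/
theorem sum_ncFams_erase_first {B : Subalgebra ℂ A} {c : Finset (Finset ℕ) → ℂ}
    (hc : TreeWeight c) {f : List A → A} (hf : RightModular B f) {i j : ℕ} (hij : i < j)
    (x : ℕ → A) :
    ∑ P ∈ ncFams (Finset.Ico i j), c (P.filter (i ∉ ·)) • val (fun _ => f) P x =
      ∑ V ∈ (Finset.Ico i j).powerset.filter (i ∈ ·),
        f (V.sort.map fun v => x v * ncSum c f (gap V j v) x) := by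
  classical
  have h1 : ∀ V ∈ (Finset.Ico i j).powerset.filter (i ∈ ·),
      f (V.sort.map fun v => x v * ncSum c f (gap V j v) x) =
        ∑ P ∈ ncFams (Finset.Ico i j),
          if V ∈ P then c (P.filter (i ∉ ·)) • val (fun _ => f) P x else 0 := by
    intro V hV
    obtain ⟨hV, hiV⟩ := Finset.mem_filter.1 hV
    have hV := Finset.mem_powerset.1 hV
    have := sum_gapFams hc hf ⟨i, hiV⟩ j V subset_rfl x
    rw [blockVal_congr (y := fun v => x v * ncSum c f (gap V j v) x) _
      (fun v hv => by simp [hv])] at this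
    rw [← Finset.sum_filter]
    refine Eq.trans this.symm ?_
    refine Finset.sum_bij' (fun R _ => insert V R) (fun P _ => P.erase V) ?_ ?_ ?_ ?_ ?_
    · intro R hR
      exact Finset.mem_filter.2 ⟨((mem_gapFams_self_iff hV hiV).1 hR).2,
        Finset.mem_insert_self _ _⟩
    · intro P hP
      obtain ⟨hP, hVP⟩ := Finset.mem_filter.1 hP
      rw [mem_gapFams_self_iff hV hiV, Finset.insert_erase hVP]
      exact ⟨Finset.notMem_erase _ _, hP⟩
    · intro R hR
      exact Finset.erase_insert ((mem_gapFams_self_iff hV hiV).1 hR).1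
    · intro P hP
      exact Finset.insert_erase (Finset.mem_filter.1 hP).2
    · intro R hR
      obtain ⟨hVR, hP⟩ := (mem_gapFams_self_iff hV hiV).1 hR
      have : (insert V R).filter (i ∉ ·) = R := by
        rw [Finset.filter_insert, if_neg (by simpa using hiV), Finset.filter_eq_self]
        intro W hW h
        exact hVR ((mem_ncFams.1 hP).1.eq_of_mem (Finset.mem_insert_of_mem hW)
          (Finset.mem_insert_self _ _) h hiV ▸ hW)
      rw [this]
  rw [Finset.sum_congr rfl h1, Finset.sum_comm]
  refine Finset.sum_congr rfl fun P hP => ?_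
  obtain ⟨hP, hs⟩ := mem_ncFams.1 hP
  obtain ⟨V, hV, hiV⟩ := mem_supp.1 (hs ▸ Finset.mem_Ico.2 ⟨le_rfl, hij⟩ : i ∈ supp P)
  rw [Finset.sum_eq_single V, if_pos hV]
  · intro W hW hWV
    rw [if_neg]
    exact fun h => hWV (hP.eq_of_mem h hV (Finset.mem_filter.1 hW).2 hiV)
  · intro h
    exact absurd (Finset.mem_filter.2 ⟨Finset.mem_powerset.2 (hs ▸ subset_supp hV), hiV⟩) h

/-- The sum over all irreducible non-crossing partitions `P` of `[i, k)`, where the coefficient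
is that of the family of the inner blocks of `P`. -/
noncomputable def outerSum (c : Finset (Finset ℕ) → ℂ) (f : List A → A) (i k : ℕ) (x : ℕ → A) :
    A :=
  ∑ P ∈ irrFams i k, c (P.filter (i ∉ ·)) • val (fun _ => f) P x

/-- The same splitting when the block of the first point is left out of the weight. -/
theorem sum_ncFams_erase_first_eq {B : Subalgebra ℂ A} {c : Finset (Finset ℕ) → ℂ}
    (hc : TreeWeight c) {f : List A → A} (hf : RightModular B f) {i j : ℕ} (hij : i < j)
    (x : ℕ → A) :
    ∑ P ∈ ncFams (Finset.Ico i j), c (P.filter (i ∉ ·)) • val (fun _ => f) P x =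
      ∑ k ∈ Finset.Ioc i j, outerSum c f i k x * ncSum c f (Finset.Ico k j) x := by
  rw [sum_ncFams_Ico hij]
  refine Finset.sum_congr rfl fun k hk => ?_
  obtain ⟨hik, hkj⟩ := Finset.mem_Ioc.1 hk
  rw [outerSum, ncSum, Finset.sum_mul_sum]
  refine Finset.sum_congr rfl fun Q hQ => Finset.sum_congr rfl fun R hR => ?_
  obtain ⟨hQ, hsQ⟩ := mem_ncFams.1 (mem_irrFams.1 hQ).1
  obtain ⟨hR, hsR⟩ := mem_ncFams.1 hR
  have hlt : ∀ s ∈ supp Q, ∀ t ∈ supp R, s < t := by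
    rw [hsQ, hsR]
    simp only [Finset.mem_Ico]
    omega
  have hQ' := hQ.mono (Finset.filter_subset (i ∉ ·) Q)
  have hR' : R.filter (i ∉ ·) = R := Finset.filter_true_of_mem fun W hW h => by
    have := Finset.mem_Ico.1 (hsR ▸ subset_supp hW h)
    omega
  rw [Finset.filter_union, hR', hc.union _ _ (separated_of_lt hQ' hR fun s hs =>
    hlt s (supp_mono (Finset.filter_subset _ _) hs)), val_union_eq_mul (B := B) (hQ.union hR ?_ ?_)
    (fun _ _ => hf) x hlt, smul_mul_smul_comm]
  · exact Finset.disjoint_left.2 fun i h h' => lt_irrefl _ (hlt i h i h')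
  · exact fun a _ b hb c hc _ h => lt_asymm h (hlt b hb c hc)

end Sums

/-! ### Functions of words and sums over non-crossing partitions of a word -/

section Words

variable {A : Type*}

/-- The word `x_i x_{i+1} ⋯ x_{j-1}`. -/
def word (x : ℕ → A) (i j : ℕ) : List A := (List.range' i (j - i)).map x

@[simp] theorem length_word (x : ℕ → A) (i j : ℕ) : (word x i j).length = j - i := by
  simp [word]

@[simp] theorem word_self (x : ℕ → A) (i : ℕ) : word x i i = [] := by simp [word]

theorem word_cons (x : ℕ → A) {i j : ℕ} (h : i < j) : word x i j = x i :: word x (i + 1) j := by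
  obtain ⟨d, rfl⟩ := Nat.exists_eq_add_of_lt h
  have h1 : i + d + 1 - i = d + 1 := by omega
  have h2 : i + d + 1 - (i + 1) = d := by omega
  simp [word, h1, h2, List.range'_succ]

theorem getElem_word (x : ℕ → A) {i j m : ℕ} (h : m < (word x i j).length) :
    (word x i j)[m] = x (i + m) := by
  simp [word]

theorem take_word (x : ℕ → A) {i j r : ℕ} (h : i + r ≤ j) :
    (word x i j).take r = word x i (i + r) := by
  refine List.ext_getElem (by simp; omega) fun m h1 h2 => ?_
  simp [getElem_word]

theorem drop_word (x : ℕ → A) {i j r : ℕ} : (word x i j).drop r = word x (i + r) j := by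
  refine List.ext_getElem (by simp; omega) fun m h1 h2 => ?_
  simp [getElem_word, add_assoc]

variable [Zero A]

/-- The letters of a word as a sequence indexed by `ℕ`, extended by `0`. -/
def letters (w : List A) (m : ℕ) : A := w.getD m 0

theorem letters_word (x : ℕ → A) {i j m : ℕ} (h : m < j - i) :
    letters (word x i j) m = x (m + i) := by
  rw [letters, List.getD_eq_getElem _ _ (by simpa using h), getElem_word, add_comm]

theorem word_letters (w : List A) : word (letters w) 0 w.length = w := by
  refine List.ext_getElem (by simp) fun m h1 h2 => ?_
  rw [getElem_word, letters, zero_add, List.getD_eq_getElem _ _ h2]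

end Words

section Shift

variable {α β : Type*} [LinearOrder α] [LinearOrder β]

theorem ncFams_map (e : α ↪o β) (S : Finset α) :
    ncFams (S.map e.toEmbedding) = (ncFams S).map ⟨mapFam e, mapFam_injective e⟩ := by
  ext P
  simp only [Finset.mem_map, mem_ncFams, Function.Embedding.coeFn_mk]
  constructor
  · rintro ⟨hP, hs⟩
    have hsub : P ⊆ S.powerset.map (Finset.mapEmbedding e.toEmbedding).toEmbedding := by
      intro V hV
      obtain ⟨U, hU, rfl⟩ := Finset.subset_map_iff.1 (hs ▸ subset_supp hV)
      exact Finset.mem_map.2 ⟨U, Finset.mem_powerset.2 hU, rfl⟩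
    obtain ⟨Q, -, rfl⟩ := Finset.subset_map_iff.1 hsub
    refine ⟨Q, ⟨ncFam_mapFam_iff.1 hP, ?_⟩, rfl⟩
    exact Finset.map_injective _ ((supp_mapFam e Q).symm.trans hs)
  · rintro ⟨Q, ⟨hQ, rfl⟩, rfl⟩
    exact ⟨ncFam_mapFam_iff.2 hQ, supp_mapFam _ _⟩

theorem sum_ncFams_map {M : Type*} [AddCommMonoid M] (e : α ↪o β) (S : Finset α)
    (Φ : Finset (Finset β) → M) :
    ∑ P ∈ ncFams (S.map e.toEmbedding), Φ P = ∑ P ∈ ncFams S, Φ (mapFam e P) := by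
  rw [ncFams_map, Finset.sum_map]
  rfl

/-- The shift `m ↦ m + i`. -/
def shift (i : ℕ) : ℕ ↪o ℕ := OrderEmbedding.ofStrictMono (· + i) fun _ _ h => by simpa using h

@[simp] theorem shift_apply (i m : ℕ) : shift i m = m + i := rfl

theorem map_shift_Ico (i j : ℕ) :
    (Finset.Ico 0 (j - i)).map (shift i).toEmbedding = Finset.Ico i j := by
  ext m
  simp only [Finset.mem_map, Finset.mem_Ico, RelEmbedding.coe_toEmbedding, shift_apply]
  constructor
  · rintro ⟨a, ha, rfl⟩
    omega
  · intro h
    exact ⟨m - i, by omega, by omega⟩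

theorem irrFams_eq_map {i j : ℕ} (h : i < j) :
    irrFams i j = (irrFams 0 (j - i)).map ⟨mapFam (shift i), mapFam_injective _⟩ := by
  ext P
  rw [mem_irrFams, ← map_shift_Ico, ncFams_map, Finset.mem_map, Finset.mem_map]
  simp only [Function.Embedding.coeFn_mk]
  constructor
  · rintro ⟨⟨Q, hQ, rfl⟩, V, hV, hiV, m, hm, hmj⟩
    obtain ⟨V, hV', rfl⟩ := mem_mapFam.1 hV
    obtain ⟨a, ha, ha'⟩ := Finset.mem_map.1 hiV
    obtain ⟨b, hb, rfl⟩ := Finset.mem_map.1 hm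
    simp only [RelEmbedding.coe_toEmbedding, shift_apply] at ha' hmj
    obtain rfl : a = 0 := by omega
    exact ⟨Q, mem_irrFams.2 ⟨hQ, V, hV', ha, b, hb, by omega⟩, rfl⟩
  · rintro ⟨Q, hQ, rfl⟩
    obtain ⟨hQ, V, hV, hiV, m, hm, hmj⟩ := mem_irrFams.1 hQ
    refine ⟨⟨Q, hQ, rfl⟩, _, map_mem_mapFam.2 hV, ?_, m + i, ?_, by omega⟩
    · exact Finset.mem_map.2 ⟨0, hiV, by simp⟩
    · exact Finset.mem_map.2 ⟨m, hm, rfl⟩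

end Shift

section WordSums

variable {A : Type*} [Ring A] [Algebra ℂ A]

/-- The function of words `∑ c(π) f_π`, summed over all non-crossing partitions. -/
noncomputable def ncWord (c : Finset (Finset ℕ) → ℂ) (f : List A → A) (w : List A) : A :=
  ncSum c f (Finset.Ico 0 w.length) (letters w)

/-- The function of words `∑ c(π) f_π`, summed over the irreducible non-crossing partitions. -/
noncomputable def irrWord (c : Finset (Finset ℕ) → ℂ) (f : List A → A) (w : List A) : A :=
  irrSum c f 0 w.length (letters w)

/-- The function of words `∑ c(π ∖ V) f_π`, summed over the irreducible non-crossing partitions,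
`V` being the outer block of `π`. -/
noncomputable def outerWord (c : Finset (Finset ℕ) → ℂ) (f : List A → A) (w : List A) : A :=
  outerSum c f 0 w.length (letters w)

theorem val_mapFam_const {A : Type*} [Ring A] {α β : Type*} [LinearOrder α] [LinearOrder β]
    (e : α ↪o β)
    (f : List A → A) {P : Finset (Finset α)} (hP : NCFam P) (x : β → A) :
    val (fun _ => f) (mapFam e P) x = val (fun _ => f) P (x ∘ e) :=
  val_mapFam e _ hP x

variable {c : Finset (Finset ℕ) → ℂ}

theorem ncSum_eq_ncWord (hc : TreeWeight c) (f : List A → A) (x : ℕ → A) (i j : ℕ) :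
    ncSum c f (Finset.Ico i j) x = ncWord c f (word x i j) := by
  rw [ncSum, ncWord, ncSum, ← map_shift_Ico, sum_ncFams_map, length_word]
  refine Finset.sum_congr rfl fun P hP => ?_
  obtain ⟨hP, hs⟩ := mem_ncFams.1 hP
  rw [hc.map, val_mapFam_const _ _ hP, hP.val_congr (fun _ _ _ => rfl)]
  intro m hm
  rw [hs, Finset.mem_Ico] at hm
  exact (letters_word x hm.2).symm

theorem irrSum_eq_irrWord (hc : TreeWeight c) (f : List A → A) (x : ℕ → A) {i j : ℕ}
    (hij : i < j) : irrSum c f i j x = irrWord c f (word x i j) := by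
  rw [irrSum, irrWord, irrSum, irrFams_eq_map hij, Finset.sum_map, length_word]
  refine Finset.sum_congr rfl fun P hP => ?_
  obtain ⟨hP, hs⟩ := mem_ncFams.1 (mem_irrFams.1 hP).1
  rw [Function.Embedding.coeFn_mk, hc.map, val_mapFam_const _ _ hP,
    hP.val_congr (fun _ _ _ => rfl)]
  intro m hm
  rw [hs, Finset.mem_Ico] at hm
  exact (letters_word x hm.2).symm

theorem outerSum_eq_outerWord (hc : TreeWeight c) (f : List A → A) (x : ℕ → A) {i j : ℕ}
    (hij : i < j) : outerSum c f i j x = outerWord c f (word x i j) := by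
  classical
  rw [outerSum, outerWord, outerSum, irrFams_eq_map hij, Finset.sum_map, length_word]
  refine Finset.sum_congr rfl fun P hP => ?_
  obtain ⟨hP, hs⟩ := mem_ncFams.1 (mem_irrFams.1 hP).1
  have hfil : (mapFam (shift i) P).filter (i ∉ ·) = mapFam (shift i) (P.filter (0 ∉ ·)) := by
    ext V
    simp only [Finset.mem_filter, mem_mapFam]
    constructor
    · rintro ⟨⟨W, hW, rfl⟩, h⟩
      exact ⟨W, ⟨hW, fun h0 => h (Finset.mem_map.2 ⟨0, h0, by simp⟩)⟩, rfl⟩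
    · rintro ⟨W, ⟨hW, h⟩, rfl⟩
      refine ⟨⟨W, hW, rfl⟩, fun h0 => h ?_⟩
      obtain ⟨a, ha, ha'⟩ := Finset.mem_map.1 h0
      simp only [RelEmbedding.coe_toEmbedding, shift_apply] at ha'
      obtain rfl : a = 0 := by omega
      exact ha
  rw [Function.Embedding.coeFn_mk, hfil, hc.map, val_mapFam_const _ _ hP,
    hP.val_congr (fun _ _ _ => rfl)]
  intro m hm
  rw [hs, Finset.mem_Ico] at hm
  exact (letters_word x hm.2).symm

@[simp] theorem ncWord_nil (hc : TreeWeight c) (f : List A → A) : ncWord c f [] = 1 := by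
  simp [ncWord, ncSum, hc.empty]

theorem irrFams_self (i : ℕ) : irrFams i i = ∅ := by
  ext P
  simp only [mem_irrFams, Finset.Ico_self, ncFams_empty, Finset.mem_singleton, Finset.notMem_empty,
    iff_false]
  rintro ⟨rfl, V, hV, -⟩
  simp at hV

@[simp] theorem irrWord_nil (c : Finset (Finset ℕ) → ℂ) (f : List A → A) : irrWord c f [] = 0 := by
  simp [irrWord, irrSum, irrFams_self]

@[simp] theorem outerWord_nil (c : Finset (Finset ℕ) → ℂ) (f : List A → A) :
    outerWord c f [] = 0 := by
  simp [outerWord, outerSum, irrFams_self]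

/-- The convolution product of functions of words for the concatenation of words. -/
def conv (F G : List A → A) (w : List A) : A :=
  ∑ r ∈ Finset.range (w.length + 1), F (w.take r) * G (w.drop r)

theorem sum_Ioc_word {A : Type*} [Ring A] {F G : List A → A} (hF : F [] = 0) (x : ℕ → A) {i j : ℕ}
    (hij : i ≤ j) :
    ∑ k ∈ Finset.Ioc i j, F (word x i k) * G (word x k j) = conv F G (word x i j) := by
  have hI : Finset.Ioc i j = Finset.Ico (i + 1) (j + 1) := by
    ext k
    simp only [Finset.mem_Ioc, Finset.mem_Ico]
    omega
  rw [conv, Finset.sum_range_succ', List.take_zero, hF, zero_mul, add_zero, length_word, hI,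
    Finset.sum_Ico_eq_sum_range, Nat.add_sub_add_right]
  refine Finset.sum_congr rfl fun r hr => ?_
  have := Finset.mem_range.1 hr
  rw [take_word x (by omega), drop_word, add_assoc, add_comm 1 r]

/-- `M = 1 + I * M`, for the sums `M` over all and `I` over the irreducible partitions. -/
theorem ncWord_eq {B : Subalgebra ℂ A} (hc : TreeWeight c) {f : List A → A}
    (hf : RightModular B f) (w : List A) :
    ncWord c f w = (if w = [] then 1 else 0) + conv (irrWord c f) (ncWord c f) w := by
  rcases eq_or_ne w [] with rfl | hw
  · simp [conv, ncWord_nil hc]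
  · have hlen : 0 < w.length := List.length_pos_iff.2 hw
    rw [if_neg hw, zero_add]
    have := ncSum_Ico hc hf (letters w) hlen
    rw [ncSum_eq_ncWord hc, word_letters] at this
    rw [this, Finset.sum_congr rfl fun k hk => by
      rw [irrSum_eq_irrWord hc f _ (Finset.mem_Ioc.1 hk).1, ncSum_eq_ncWord hc],
      sum_Ioc_word (irrWord_nil c f) _ hlen.le, word_letters]

/-- The sum over all ways to select a subword of `w` containing its first letter, of the value of
`f` on the word `p` followed by the selected letters, each of them multiplied by the value of `N`
on the gap that follows it. -/
def trail (f N : List A → A) : List A → List A → A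
  | p, [] => f p
  | p, a :: t => ∑ r ∈ Finset.range (t.length + 1), trail f N (p ++ [a * N (t.take r)]) (t.drop r)
termination_by _ w => w.length
decreasing_by simp

/-- Classification of the subsets of an interval by their minimum. -/
theorem sum_powerset_Ico {M : Type*} [AddCommMonoid M] (Ψ : Finset ℕ → M) (a j : ℕ) :
    ∑ V ∈ (Finset.Ico a j).powerset, Ψ V =
      Ψ ∅ + ∑ k ∈ Finset.Ico a j, ∑ V ∈ (Finset.Ico k j).powerset.filter (k ∈ ·), Ψ V := by
  induction hd : j - a generalizing a with
  | zero =>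
    rw [Finset.Ico_eq_empty (by omega)]
    simp
  | succ d ih =>
    have haj : a < j := by omega
    rw [← Finset.sum_filter_add_sum_filter_not _ (a ∈ ·),
      ← Finset.insert_Ico_add_one_left_eq_Ico haj]
    have h1 : ((insert a (Finset.Ico (a + 1) j)).powerset.filter fun V => ¬ a ∈ V) =
        (Finset.Ico (a + 1) j).powerset := by
      ext V
      simp only [Finset.mem_filter, Finset.mem_powerset]
      constructor
      · rintro ⟨h1, h2⟩
        exact (Finset.subset_insert_iff_of_notMem h2).1 h1
      · intro h
        exact ⟨h.trans (Finset.subset_insert _ _), fun h' => by simpa using h h'⟩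
    rw [h1, ih (a + 1) (by omega), Finset.sum_insert (by simp),
      Finset.insert_Ico_add_one_left_eq_Ico haj, add_left_comm]

theorem gap_singleton (i j : ℕ) : gap {i} j i = Finset.Ico (i + 1) j := by
  ext m
  rw [mem_gap, Finset.mem_Ico]
  simp

theorem gap_insert_self {V : Finset ℕ} {i j k : ℕ} (hV : V ⊆ Finset.Ico k j) (hk : k ∈ V)
    (hik : i < k) : gap (insert i V) j i = Finset.Ico (i + 1) k := by
  ext m
  rw [mem_gap, Finset.mem_Ico]
  constructor
  · rintro ⟨h1, -, h3⟩
    exact ⟨h1, h3 k (Finset.mem_insert_of_mem hk) hik⟩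
  · rintro ⟨h1, h2⟩
    have := (Finset.mem_Ico.1 (hV hk)).2
    refine ⟨h1, by omega, fun w hw hiw => ?_⟩
    rcases Finset.mem_insert.1 hw with rfl | hw
    · omega
    · have := (Finset.mem_Ico.1 (hV hw)).1
      omega

theorem gap_insert_of_lt {V : Finset ℕ} {i j v : ℕ} (h : i ≤ v) :
    gap (insert i V) j v = gap V j v := by
  ext m
  simp only [mem_gap, Finset.mem_insert, forall_eq_or_imp]
  constructor
  · rintro ⟨h1, h2, -, h3⟩
    exact ⟨h1, h2, h3⟩
  · rintro ⟨h1, h2, h3⟩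
    exact ⟨h1, h2, by omega, h3⟩

/-- The sum over the subsets containing the first point `i` is a subword sum, by recursion over the
gaps: the second point of the subset determines the gap that follows `i`. -/
theorem sum_powerset_eq_trail {A : Type*} [Ring A] (f N : List A → A) (x : ℕ → A) (M : Finset ℕ → A)
    (hM : ∀ a b, M (Finset.Ico a b) = N (word x a b)) {i j : ℕ} (hij : i < j) (p : List A) :
    ∑ V ∈ (Finset.Ico i j).powerset.filter (i ∈ ·),
        f (p ++ V.sort.map fun v => x v * M (gap V j v)) =
      trail f N p (word x i j) := by
  induction hd : j - i using Nat.strong_induction_on generalizing i p with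
  | _ d ih =>
  have h1 : ∑ V ∈ (Finset.Ico i j).powerset.filter (i ∈ ·),
        f (p ++ V.sort.map fun v => x v * M (gap V j v)) =
      ∑ V ∈ (Finset.Ico (i + 1) j).powerset,
        f (p ++ (insert i V).sort.map fun v => x v * M (gap (insert i V) j v)) := by
    symm
    refine Finset.sum_bij' (fun V _ => insert i V) (fun V _ => V.erase i) ?_ ?_ ?_ ?_ ?_
    · intro V hV
      refine Finset.mem_filter.2 ⟨Finset.mem_powerset.2 ?_, Finset.mem_insert_self _ _⟩
      rw [← Finset.insert_Ico_add_one_left_eq_Ico hij]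
      exact Finset.insert_subset_insert _ (Finset.mem_powerset.1 hV)
    · intro V hV
      have := Finset.mem_powerset.1 (Finset.mem_filter.1 hV).1
      refine Finset.mem_powerset.2 fun m hm => ?_
      obtain ⟨h1, h2⟩ := Finset.mem_erase.1 hm
      have := Finset.mem_Ico.1 (this h2)
      exact Finset.mem_Ico.2 (by omega)
    · intro V hV
      refine Finset.erase_insert fun h => ?_
      have := Finset.mem_Ico.1 (Finset.mem_powerset.1 hV h)
      omega
    · intro V hV
      exact Finset.insert_erase (Finset.mem_filter.1 hV).2
    · intros; rfl
  have hsort : ∀ V ⊆ Finset.Ico (i + 1) j, (insert i V).sort = i :: V.sort := fun V hV =>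
    Finset.sort_insert _ (fun b hb => by have := Finset.mem_Ico.1 (hV hb); omega) fun h => by
      have := Finset.mem_Ico.1 (hV h)
      omega
  have h2 : ∀ k ∈ Finset.Ico (i + 1) j, ∑ V ∈ (Finset.Ico k j).powerset.filter (k ∈ ·),
      f (p ++ (insert i V).sort.map fun v => x v * M (gap (insert i V) j v)) =
      trail f N (p ++ [x i * N (word x (i + 1) k)]) (word x k j) := by
    intro k hk
    obtain ⟨hik, hkj⟩ := Finset.mem_Ico.1 hk
    rw [← ih (j - k) (by omega) hkj _ rfl]
    refine Finset.sum_congr rfl fun V hV => ?_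
    obtain ⟨hV, hkV⟩ := Finset.mem_filter.1 hV
    have hV := Finset.mem_powerset.1 hV
    rw [hsort V (hV.trans (Finset.Ico_subset_Ico_left hik)), List.map_cons,
      gap_insert_self hV hkV hik, hM, List.append_assoc, List.singleton_append]
    congr 3
    refine List.map_congr_left fun v hv => ?_
    have := Finset.mem_Ico.1 (hV ((Finset.mem_sort _).1 hv))
    rw [gap_insert_of_lt (by omega)]
  rw [h1, sum_powerset_Ico, Finset.sum_congr rfl h2, word_cons x hij, trail,
    Finset.sum_range_succ, length_word, add_comm]
  congr 1
  · rw [Finset.sum_Ico_eq_sum_range]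
    refine Finset.sum_congr rfl fun r hr => ?_
    have := Finset.mem_range.1 hr
    rw [take_word x (by omega), drop_word]
  · have h3 : i + 1 + (j - (i + 1)) = j := by omega
    rw [take_word x (by omega), drop_word, h3, word_self, trail, insert_empty_eq,
      Finset.sort_singleton, List.map_singleton, gap_singleton, hM]

/-- Irreducible partitions, weighted by their inner blocks, in terms of their outer block. -/
theorem trail_eq_conv {B : Subalgebra ℂ A} (hc : TreeWeight c) {f : List A → A}
    (hf : RightModular B f) (hf0 : f [] = 0) (w : List A) :
    trail f (ncWord c f) [] w = conv (outerWord c f) (ncWord c f) w := by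
  rcases eq_or_ne w [] with rfl | hw
  · simp [conv, trail, hf0]
  · have hlen : 0 < w.length := List.length_pos_iff.2 hw
    have := sum_powerset_eq_trail f (ncWord c f) (letters w)
      (fun S => ncSum c f S (letters w)) (fun a b => ncSum_eq_ncWord hc f _ a b) hlen []
    rw [word_letters] at this
    rw [← this]
    simp only [List.nil_append]
    rw [← sum_ncFams_erase_first hc hf hlen, sum_ncFams_erase_first_eq hc hf hlen,
      Finset.sum_congr rfl fun k hk => by
        rw [outerSum_eq_outerWord hc f _ (Finset.mem_Ioc.1 hk).1, ncSum_eq_ncWord hc],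
      sum_Ioc_word (outerWord_nil c f) _ hlen.le, word_letters]

end WordSums

/-! ### Functions of words as functions of triangular matrices -/

section PathSums

variable {A : Type*} [Ring A]

/-- The sum of `F (Y i k₁, Y k₁ k₂, …, Y k_r j)` over all increasing paths from `i` to `j`. -/
def pathSum (F : List A → A) (Y : ℕ → ℕ → A) (i j : ℕ) : A :=
  if i < j then ∑ k ∈ (Finset.Ioc i j).attach, pathSum (fun t => F (Y i k.1 :: t)) Y k.1 j
  else if i = j then F [] else 0
termination_by j - i
decreasing_by
  have := Finset.mem_Ioc.1 k.2
  omega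

theorem pathSum_of_lt (F : List A → A) (Y : ℕ → ℕ → A) {i j : ℕ} (h : i < j) :
    pathSum F Y i j = ∑ k ∈ Finset.Ioc i j, pathSum (fun t => F (Y i k :: t)) Y k j := by
  rw [pathSum, if_pos h]
  exact Finset.sum_attach _ fun k => pathSum (fun t => F (Y i k :: t)) Y k j

@[simp] theorem pathSum_self (F : List A → A) (Y : ℕ → ℕ → A) (i : ℕ) :
    pathSum F Y i i = F [] := by
  rw [pathSum, if_neg (lt_irrefl _), if_pos rfl]

theorem pathSum_of_gt (F : List A → A) (Y : ℕ → ℕ → A) {i j : ℕ} (h : ¬ i ≤ j) :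
    pathSum F Y i j = 0 := by
  rw [pathSum, if_neg (by omega), if_neg (by omega)]

/-- Path sums commute with additive maps. -/
theorem pathSum_map (L : A →+ A) (F : List A → A) (Y : ℕ → ℕ → A) (i j : ℕ) :
    pathSum (fun t => L (F t)) Y i j = L (pathSum F Y i j) := by
  induction hd : j - i using Nat.strong_induction_on generalizing i F with
  | _ d ih =>
  rcases lt_trichotomy i j with h | rfl | h
  · rw [pathSum_of_lt _ _ h, pathSum_of_lt _ _ h, map_sum]
    refine Finset.sum_congr rfl fun k hk => ?_
    have := Finset.mem_Ioc.1 hk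
    exact ih (j - k) (by omega) _ k rfl
  · simp
  · rw [pathSum_of_gt _ _ (by omega), pathSum_of_gt _ _ (by omega), map_zero]

theorem pathSum_add (F G : List A → A) (Y : ℕ → ℕ → A) (i j : ℕ) :
    pathSum (fun t => F t + G t) Y i j = pathSum F Y i j + pathSum G Y i j := by
  induction hd : j - i using Nat.strong_induction_on generalizing i F G with
  | _ d ih =>
  rcases lt_trichotomy i j with h | rfl | h
  · simp only [pathSum_of_lt _ _ h, ← Finset.sum_add_distrib]
    refine Finset.sum_congr rfl fun k hk => ?_
    have := Finset.mem_Ioc.1 hk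
    exact ih (j - k) (by omega) _ _ k rfl
  · simp
  · simp only [pathSum_of_gt _ _ (show ¬ i ≤ j by omega), add_zero]

theorem pathSum_zero (Y : ℕ → ℕ → A) (i j : ℕ) : pathSum (fun _ => 0) Y i j = 0 := by
  have := pathSum_map (0 : A →+ A) (fun _ => 0) Y i j
  simpa using this

theorem pathSum_mul_right (F : List A → A) (b : A) (Y : ℕ → ℕ → A) (i j : ℕ) :
    pathSum (fun t => F t * b) Y i j = pathSum F Y i j * b :=
  pathSum_map (AddMonoidHom.mulRight b) F Y i j

theorem pathSum_mul_left (F : List A → A) (b : A) (Y : ℕ → ℕ → A) (i j : ℕ) :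
    pathSum (fun t => b * F t) Y i j = b * pathSum F Y i j :=
  pathSum_map (AddMonoidHom.mulLeft b) F Y i j

theorem pathSum_congr {F : List A → A} {Y Z : ℕ → ℕ → A} {i j : ℕ}
    (h : ∀ a b, i ≤ a → a < b → b ≤ j → Y a b = Z a b) : pathSum F Y i j = pathSum F Z i j := by
  induction hd : j - i using Nat.strong_induction_on generalizing i F with
  | _ d ih =>
  rcases lt_trichotomy i j with hij | rfl | hij
  · rw [pathSum_of_lt _ _ hij, pathSum_of_lt _ _ hij]
    refine Finset.sum_congr rfl fun k hk => ?_
    have hk := Finset.mem_Ioc.1 hk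
    rw [h i k le_rfl hk.1 hk.2]
    exact ih (j - k) (by omega) (fun a b ha hab hb => h a b (by omega) hab hb) rfl
  · simp
  · rw [pathSum_of_gt _ _ (by omega), pathSum_of_gt _ _ (by omega)]

/-- A path of which the letters are cut into two words consists of two consecutive paths. -/
theorem pathSum_split (H : List A → List A → A) (Y : ℕ → ℕ → A) {i j : ℕ} (hij : i ≤ j) :
    pathSum (fun t => ∑ r ∈ Finset.range (t.length + 1), H (t.take r) (t.drop r)) Y i j =
      ∑ m ∈ Finset.Icc i j, pathSum (fun u => pathSum (H u) Y m j) Y i m := by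
  induction hd : j - i using Nat.strong_induction_on generalizing i H with
  | _ d ih =>
  rcases hij.lt_or_eq with h | rfl
  · have h1 : ∀ k ∈ Finset.Ioc i j, pathSum (fun t => ∑ r ∈ Finset.range ((Y i k :: t).length + 1),
        H ((Y i k :: t).take r) ((Y i k :: t).drop r)) Y k j =
        pathSum (fun t => H [] (Y i k :: t)) Y k j + ∑ m ∈ Finset.Icc k j,
          pathSum (fun u => pathSum (H (Y i k :: u)) Y m j) Y k m := by
      intro k hk
      have hk := Finset.mem_Ioc.1 hk
      rw [← ih (j - k) (by omega) (fun u => H (Y i k :: u)) hk.2 rfl, ← pathSum_add]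
      congr 1
      funext t
      rw [List.length_cons, Finset.sum_range_succ', add_comm]
      simp
    rw [pathSum_of_lt _ _ h, Finset.sum_congr rfl h1, Finset.sum_add_distrib,
      ← pathSum_of_lt _ _ h, ← Finset.Ioc_insert_left hij, Finset.sum_insert (by simp),
      pathSum_self]
    congr 1
    rw [Finset.sum_comm' (t' := Finset.Ioc i j) (s' := fun m => Finset.Ioc i m)]
    · refine Finset.sum_congr rfl fun m hm => ?_
      rw [pathSum_of_lt _ _ (Finset.mem_Ioc.1 hm).1]
    · intro k m
      simp only [Finset.mem_Ioc, Finset.mem_Icc]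
      omega
  · simp

/-- A function of words that vanishes as soon as one of the letters is zero. -/
def ZeroLetter (F : List A → A) : Prop := ∀ u v, F (u ++ 0 :: v) = 0

theorem pathSum_of_zero_letter {F : List A → A} (hF : ∀ t, F t = 0) (Y : ℕ → ℕ → A) (i j : ℕ) :
    pathSum F Y i j = 0 := by
  rw [show F = fun _ => 0 from funext hF, pathSum_zero]

end PathSums

section Hat

variable {A : Type*} [Ring A]

/-- The upper triangular matrix of path sums of a function of words over an upper triangular
matrix. -/
def hat (F : List A → A) (Y : IncidenceAlgebra A ℕ) : IncidenceAlgebra A ℕ where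
  toFun := pathSum F Y
  eq_zero_of_not_le' _ _ h := pathSum_of_gt F Y h

theorem hat_apply (F : List A → A) (Y : IncidenceAlgebra A ℕ) (i j : ℕ) :
    hat F Y i j = pathSum F Y i j := rfl

/-- The matrix with the letters `x_i` on the first superdiagonal. -/
def superdiag (x : ℕ → A) : IncidenceAlgebra A ℕ where
  toFun i j := if j = i + 1 then x i else 0
  eq_zero_of_not_le' i j h := if_neg (by omega)

/-- The vanishing of all diagonal entries. -/
def Strict (Y : IncidenceAlgebra A ℕ) : Prop := ∀ i, Y i i = 0

theorem strict_superdiag (x : ℕ → A) : Strict (superdiag x) := fun i => by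
  change (if i = i + 1 then x i else 0) = 0
  simp

theorem Strict.mul {Y : IncidenceAlgebra A ℕ} (hY : Strict Y) (Z : IncidenceAlgebra A ℕ) :
    Strict (Y * Z) := fun i => by simp [hY i]

theorem strict_hat {F : List A → A} (hF : F [] = 0) (Y : IncidenceAlgebra A ℕ) :
    Strict (hat F Y) := fun i => by rw [hat_apply, pathSum_self, hF]

theorem hat_superdiag {F : List A → A} (hF : ZeroLetter F) (x : ℕ → A) {i j : ℕ} (hij : i ≤ j) :
    hat F (superdiag x) i j = F (word x i j) := by
  -- only the path with unit steps avoids the zero entries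
  rw [hat_apply]
  induction hd : j - i using Nat.strong_induction_on generalizing i F with
  | _ d ih =>
  rcases hij.lt_or_eq with h | rfl
  · rw [pathSum_of_lt _ _ h, Finset.sum_eq_single (i + 1)]
    · have h1 : superdiag x i (i + 1) = x i := if_pos rfl
      rw [h1, word_cons x h]
      exact ih (j - (i + 1)) (by omega) (F := fun t => F (x i :: t))
        (fun u v => hF (x i :: u) v) h rfl
    · intro k _ hk
      have h1 : superdiag x i k = 0 := if_neg hk
      rw [h1]
      exact pathSum_of_zero_letter (fun t => hF [] t) _ _ _
    · intro h'
      exact absurd (Finset.mem_Ioc.2 ⟨by omega, h⟩) h'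
  · simp

theorem hat_add (F G : List A → A) (Y : IncidenceAlgebra A ℕ) :
    hat (fun w => F w + G w) Y = hat F Y + hat G Y := by
  ext i j _
  exact pathSum_add F G Y i j

theorem hat_neg (F : List A → A) (Y : IncidenceAlgebra A ℕ) :
    hat (fun w => - F w) Y = - hat F Y := by
  ext i j _
  exact pathSum_map (-AddMonoidHom.id A) F Y i j

theorem hat_sub (F G : List A → A) (Y : IncidenceAlgebra A ℕ) :
    hat (fun w => F w - G w) Y = hat F Y - hat G Y := by
  simp only [sub_eq_add_neg, hat_add, hat_neg]

theorem hat_conv (F G : List A → A) (Y : IncidenceAlgebra A ℕ) :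
    hat (conv F G) Y = hat F Y * hat G Y := by
  ext i j hij
  rw [hat_apply, IncidenceAlgebra.mul_apply]
  refine (pathSum_split (fun u v => F u * G v) Y hij).trans ?_
  refine Finset.sum_congr rfl fun m _ => ?_
  simp only [pathSum_mul_left, pathSum_mul_right]
  rfl

theorem hat_unit (Y : IncidenceAlgebra A ℕ) :
    hat (fun w => if w = [] then (1 : A) else 0) Y = 1 := by
  ext i j hij
  rw [hat_apply, IncidenceAlgebra.one_apply]
  rcases hij.lt_or_eq with h | rfl
  · rw [pathSum_of_lt _ _ h, if_neg h.ne]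
    exact Finset.sum_eq_zero fun k _ => by simp [pathSum_zero]
  · simp

/-- An upper triangular matrix with zero diagonal is topologically nilpotent. -/
theorem isUnit_one_sub {U : IncidenceAlgebra A ℕ} (hU : Strict U) : IsUnit (1 - U) := by
  -- `1 + ∑ hat` over the words `U ⋯ U`: the path sums of the product of all letters
  have hconv : ∀ w : List A, w.prod = (if w = [] then 1 else 0) +
      conv (fun u => if u.length = 1 then u.prod else 0) List.prod w := by
    intro w
    rcases w with _ | ⟨a, t⟩
    · simp [conv]
    · rw [conv, List.length_cons, Finset.sum_range_succ', Finset.sum_range_succ',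
        Finset.sum_eq_zero]
      · simp
      · intro r hr
        have := Finset.mem_range.1 hr
        rw [if_neg, zero_mul]
        rw [List.length_take, List.length_cons]
        omega
  have hconv' : ∀ w : List A, w.prod = (if w = [] then 1 else 0) +
      conv List.prod (fun u => if u.length = 1 then u.prod else 0) w := by
    intro w
    rcases List.eq_nil_or_concat w with rfl | ⟨t, a, rfl⟩
    · simp [conv]
    · rw [conv, Finset.sum_eq_single t.length]
      · simp
      · intro r hr hne
        have := Finset.mem_range.1 hr
        simp only [List.concat_eq_append, List.length_append, List.length_singleton] at this
        rw [if_neg, mul_zero]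
        simp
        omega
      · intro h
        simp at h
  have hU1 : hat (fun u : List A => if u.length = 1 then u.prod else 0) U = U := by
    ext i j hij
    rw [hat_apply]
    rcases hij.lt_or_eq with h | rfl
    · rw [pathSum_of_lt _ _ h, Finset.sum_eq_single j]
      · simp
      · intro k hk hkj
        have := Finset.mem_Ioc.1 hk
        rw [pathSum_of_lt _ _ (by omega)]
        exact Finset.sum_eq_zero fun l _ => by simp [pathSum_zero]
      · intro h'
        exact absurd (Finset.mem_Ioc.2 ⟨h, le_rfl⟩) h'
    · simp [hU i]
  have h1 : hat List.prod U = 1 + U * hat List.prod U := by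
    conv_lhs => rw [funext hconv, hat_add, hat_unit, hat_conv, hU1]
  have h2 : hat List.prod U = 1 + hat List.prod U * U := by
    conv_lhs => rw [funext hconv', hat_add, hat_unit, hat_conv, hU1]
  refine ⟨⟨1 - U, hat List.prod U, ?_, ?_⟩, rfl⟩
  · rw [sub_mul, one_mul, sub_eq_iff_eq_add]
    exact h1
  · rw [mul_sub, mul_one, sub_eq_iff_eq_add]
    exact h2

end Hat

section HatSums

variable {A : Type*} [Ring A] [Algebra ℂ A] {B : Subalgebra ℂ A}

theorem RightModular.zeroLetter {f : List A → A} (hf : RightModular B f) : ZeroLetter f := by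
  intro u v
  have := hf.smul u v 0 0
  simpa using this

theorem NCFam.val_eq_zero {α : Type*} [LinearOrder α] {P : Finset (Finset α)} (hP : NCFam P)
    {F : Finset α → List A → A} (hF : ∀ V ∈ P, RightModular B (F V)) {x : α → A} {i : α}
    (hi : i ∈ supp P) (hx : x i = 0) : val F P x = 0 := by
  have := hP.val_update_smul hF x hi 0 (x i)
  rw [zero_smul, zero_smul] at this
  rw [← this, ← hx, Function.update_eq_self]

theorem letters_zero {A : Type*} [Ring A] (u v : List A) : letters (u ++ 0 :: v) u.length = 0 := by
  simp [letters]

theorem zeroLetter_ncWord (c : Finset (Finset ℕ) → ℂ) {f : List A → A} (hf : RightModular B f) :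
    ZeroLetter (ncWord c f) := by
  intro u v
  rw [ncWord, ncSum]
  refine Finset.sum_eq_zero fun P hP => ?_
  obtain ⟨hP, hs⟩ := mem_ncFams.1 hP
  rw [hP.val_eq_zero (B := B) (fun _ _ => hf) (i := u.length) (by simp [hs]) (letters_zero u v),
    smul_zero]

theorem zeroLetter_irrWord (c : Finset (Finset ℕ) → ℂ) {f : List A → A} (hf : RightModular B f) :
    ZeroLetter (irrWord c f) := by
  intro u v
  rw [irrWord, irrSum]
  refine Finset.sum_eq_zero fun P hP => ?_
  obtain ⟨hP, hs⟩ := mem_ncFams.1 (mem_irrFams.1 hP).1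
  rw [hP.val_eq_zero (B := B) (fun _ _ => hf) (i := u.length) (by simp [hs]) (letters_zero u v),
    smul_zero]

/-- Functions of words vanishing on zero letters are determined by their path sums. -/
theorem eq_of_hat_superdiag_eq {A : Type*} [Ring A] {F G : List A → A} (hF : ZeroLetter F)
    (hG : ZeroLetter G)
    (h : ∀ x, hat F (superdiag x) = hat G (superdiag x)) (w : List A) : F w = G w := by
  have h1 := hat_superdiag hF (letters w) (Nat.zero_le w.length)
  have h2 := hat_superdiag hG (letters w) (Nat.zero_le w.length)
  rw [word_letters] at h1 h2
  rw [← h1, ← h2, h]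

/-- The path sums of a subword sum amount to a substitution of matrices. -/
theorem pathSum_trail {f : List A → A} (hf : RightModular B f) (N : List A → A)
    {Y : IncidenceAlgebra A ℕ} (hY : Strict Y) (p : List A) (i j : ℕ) :
    hat (trail f N p) Y i j = hat (fun t => f (p ++ t)) (Y * hat N Y) i j := by
  set Z := Y * hat N Y with hZ
  rw [hat_apply, hat_apply]
  induction hd : j - i using Nat.strong_induction_on generalizing i p with
  | _ d ih =>
  rcases lt_trichotomy i j with h | rfl | h
  · -- the sum as a function of the letter following `p`
    let L : ℕ → A →+ A := fun m =>
      { toFun := fun a => pathSum (fun t => f (p ++ a :: t)) Z m j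
        map_zero' := pathSum_of_zero_letter (fun t => hf.zeroLetter p t) _ _ _
        map_add' := fun a b => by simp only [hf.add, pathSum_add] }
    have hL : ∀ m a, pathSum (fun t => f (p ++ [a] ++ t)) Z m j = L m a := by
      intro m a
      simp [L]
    have h1 : ∀ k ∈ Finset.Ioc i j, pathSum (fun t => trail f N p (Y i k :: t)) Y k j =
        ∑ m ∈ Finset.Icc k j, L m (Y i k * hat N Y k m) := by
      intro k hk
      have hk := Finset.mem_Ioc.1 hk
      simp only [trail]
      rw [pathSum_split (fun u => trail f N (p ++ [Y i k * N u])) Y hk.2]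
      refine Finset.sum_congr rfl fun m hm => ?_
      have hm := Finset.mem_Icc.1 hm
      rw [hat_apply, ← pathSum_mul_left, ← pathSum_map (L m)]
      congr 1
      funext u
      rw [ih (j - m) (by omega) _ m rfl, hL]
    rw [pathSum_of_lt _ _ h, Finset.sum_congr rfl h1, pathSum_of_lt _ _ h,
      Finset.sum_comm' (t' := Finset.Ioc i j) (s' := fun m => Finset.Ioc i m)]
    · refine Finset.sum_congr rfl fun m hm => ?_
      have hm := Finset.mem_Ioc.1 hm
      have hZm : Z i m = ∑ k ∈ Finset.Ioc i m, Y i k * hat N Y k m := by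
        rw [hZ, IncidenceAlgebra.mul_apply, ← Finset.Ioc_insert_left hm.1.le,
          Finset.sum_insert (by simp), hY i, zero_mul, zero_add]
      rw [← map_sum, ← hZm]
      rfl
    · intro k m
      simp only [Finset.mem_Ioc, Finset.mem_Icc]
      omega
  · simp [trail]
  · rw [pathSum_of_gt _ _ (by omega), pathSum_of_gt _ _ (by omega)]

variable {c : Finset (Finset ℕ) → ℂ} {f : List A → A}

/-- The matrix form of the splitting of a partition at its first irreducible component. -/
theorem hat_ncWord (hc : TreeWeight c) (hf : RightModular B f) (Y : IncidenceAlgebra A ℕ) :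
    hat (ncWord c f) Y = 1 + hat (irrWord c f) Y * hat (ncWord c f) Y := by
  conv_lhs => rw [funext (ncWord_eq hc hf), hat_add, hat_unit, hat_conv]

/-- The matrix form of the decomposition of an irreducible partition along its outer block. -/
theorem hat_mul_hat_ncWord (hc : TreeWeight c) (hf : RightModular B f) (hf0 : f [] = 0)
    {Y : IncidenceAlgebra A ℕ} (hY : Strict Y) :
    hat f (Y * hat (ncWord c f) Y) = hat (outerWord c f) Y * hat (ncWord c f) Y := by
  rw [← hat_conv, ← funext (trail_eq_conv hc hf hf0)]
  ext i j _
  exact (pathSum_trail hf _ hY [] i j).symm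

end HatSums

/-! ### Weights of non-crossing partitions -/

section Weights

variable {α β : Type*} [LinearOrder α] [LinearOrder β]

theorem nested_map_iff (e : α ↪o β) {V W : Finset α} :
    Nested (V.map e.toEmbedding) (W.map e.toEmbedding) ↔ Nested V W := by
  simp [Nested]

theorem map_inj_iff (e : α ↪o β) {V W : Finset α} :
    V.map e.toEmbedding = W.map e.toEmbedding ↔ V = W :=
  (Finset.map_injective _).eq_iff

theorem sum_mapFam {M : Type*} [AddCommMonoid M] (e : α ↪o β) (P : Finset (Finset α))
    (g : Finset β → M) : ∑ W ∈ mapFam e P, g W = ∑ V ∈ P, g (V.map e.toEmbedding) :=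
  Finset.sum_map _ _ _

theorem prod_mapFam {M : Type*} [CommMonoid M] (e : α ↪o β) (P : Finset (Finset α))
    (g : Finset β → M) : ∏ W ∈ mapFam e P, g W = ∏ V ∈ P, g (V.map e.toEmbedding) :=
  Finset.prod_map _ _ _

theorem card_mapFam (e : α ↪o β) (P : Finset (Finset α)) : (mapFam e P).card = P.card :=
  Finset.card_map _

open Classical in
/-- The tree factorial of a family of blocks. -/
noncomputable def famTree (P : Finset (Finset α)) : ℕ :=
  ∏ V ∈ P, (P.filter fun W => Nested W V).card

theorem famTree_mapFam (e : α ↪o β) (P : Finset (Finset α)) :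
    famTree (mapFam e P) = famTree P := by
  classical
  rw [famTree, famTree, prod_mapFam]
  refine Finset.prod_congr rfl fun V _ => ?_
  have h1 : ((mapFam e P).filter fun W => Nested W (V.map e.toEmbedding)) =
      mapFam e (P.filter fun W => Nested W V) := by
    ext W
    simp only [Finset.mem_filter, mem_mapFam]
    constructor
    · rintro ⟨⟨U, hU, rfl⟩, h⟩
      exact ⟨U, ⟨hU, (nested_map_iff e).1 h⟩, rfl⟩
    · rintro ⟨U, ⟨hU, h⟩, rfl⟩
      exact ⟨⟨U, hU, rfl⟩, (nested_map_iff e).2 h⟩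
  rw [← card_mapFam e, ← h1]

theorem famTree_union {Q R : Finset (Finset α)} (h : Separated Q R) :
    famTree (Q ∪ R) = famTree Q * famTree R := by
  classical
  rw [famTree, Finset.prod_union h.disjoint]
  congr 1 <;> refine Finset.prod_congr rfl fun V hV => ?_ <;> rw [Finset.filter_union]
  · rw [Finset.filter_false_of_mem (s := R) fun W hW => (h V hV W hW).2, Finset.union_empty]
  · rw [Finset.filter_false_of_mem (s := Q) fun W hW => (h W hW V hV).1, Finset.empty_union]

/-- The block `V` of `P` contains all the others in its span. -/
def IsOuter (P : Finset (Finset α)) (V : Finset α) : Prop :=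
  V ∈ P ∧ ∀ W ∈ P, Nested W V ∧ (W ≠ V → ¬ Nested V W)

theorem IsOuter.famTree_eq {P : Finset (Finset α)} {V : Finset α} (h : IsOuter P V) :
    famTree P = P.card * famTree (P.erase V) := by
  classical
  rw [famTree, ← Finset.mul_prod_erase _ _ h.1, Finset.filter_true_of_mem fun W hW => (h.2 W hW).1]
  congr 1
  refine Finset.prod_congr rfl fun W hW => ?_
  congr 1
  ext U
  simp only [Finset.mem_filter, Finset.mem_erase]
  constructor
  · rintro ⟨h1, h2⟩
    refine ⟨⟨?_, h1⟩, h2⟩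
    rintro rfl
    exact (h.2 W (Finset.mem_of_mem_erase hW)).2 (Finset.ne_of_mem_erase hW) h2
  · rintro ⟨⟨_, h1⟩, h2⟩
    exact ⟨h1, h2⟩

/-- Maps from the blocks of `P` to `{0, …, k-1}`, extended by `0`, that are strictly increasing
for nesting. -/
def colorings (k : ℕ) (P : Finset (Finset α)) : Set (Finset α → ℕ) :=
  {f | (∀ V ∈ P, f V < k) ∧ (∀ V, V ∉ P → f V = 0) ∧
    ∀ V ∈ P, ∀ W ∈ P, V ≠ W → Nested V W → f V < f W}

theorem finite_colorings (k : ℕ) (P : Finset (Finset α)) : (colorings k P).Finite := by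
  classical
  refine Set.Finite.of_finite_image (f := fun f (V : P) => f V.1) ?_ ?_
  · refine (Set.Finite.pi fun _ : P => Set.finite_lt_nat k).subset ?_
    rintro _ ⟨f, hf, rfl⟩ V -
    exact hf.1 V.1 V.2
  · intro f hf g hg hfg
    funext V
    by_cases hV : V ∈ P
    · exact congrFun hfg ⟨V, hV⟩
    · rw [hf.2.1 V hV, hg.2.1 V hV]

theorem ncard_colorings_empty (k : ℕ) : (colorings k (∅ : Finset (Finset α))).ncard = 1 := by
  rw [Set.ncard_eq_one]
  refine ⟨0, ?_⟩
  ext f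
  simp [colorings, funext_iff]

theorem ncard_colorings_zero {P : Finset (Finset α)} (hP : P.Nonempty) :
    (colorings 0 P).ncard = 0 := by
  obtain ⟨V, hV⟩ := hP
  rw [Set.ncard_eq_zero (finite_colorings 0 P)]
  ext f
  simp only [Set.mem_empty_iff_false, iff_false]
  exact fun hf => absurd (hf.1 V hV) (by omega)

theorem ncard_colorings_union (k : ℕ) {Q R : Finset (Finset α)} (h : Separated Q R) :
    (colorings k (Q ∪ R)).ncard = (colorings k Q).ncard * (colorings k R).ncard := by
  classical
  rw [← Set.ncard_prod]
  have hd := h.disjoint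
  refine Set.ncard_congr (fun f _ => (fun V => if V ∈ Q then f V else 0,
    fun V => if V ∈ R then f V else 0)) ?_ ?_ ?_
  · rintro f ⟨h1, h2, h3⟩
    refine ⟨⟨fun V hV => ?_, fun V hV => if_neg hV, fun V hV W hW hne hn => ?_⟩,
      ⟨fun V hV => ?_, fun V hV => if_neg hV, fun V hV W hW hne hn => ?_⟩⟩
    · simpa [hV] using h1 V (Finset.mem_union_left _ hV)
    · simpa [hV, hW] using
        h3 V (Finset.mem_union_left _ hV) W (Finset.mem_union_left _ hW) hne hn
    · simpa [hV] using h1 V (Finset.mem_union_right _ hV)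
    · simpa [hV, hW] using
        h3 V (Finset.mem_union_right _ hV) W (Finset.mem_union_right _ hW) hne hn
  · intro f g hf hg hfg
    obtain ⟨h1, h2⟩ := Prod.ext_iff.1 hfg
    funext V
    by_cases hQ : V ∈ Q
    · simpa [hQ] using congrFun h1 V
    · by_cases hR : V ∈ R
      · simpa [hR] using congrFun h2 V
      · have : V ∉ Q ∪ R := by simp [hQ, hR]
        rw [hf.2.1 V this, hg.2.1 V this]
  · rintro ⟨f, g⟩ ⟨⟨f1, f2, f3⟩, g1, g2, g3⟩
    simp only at f1 f2 f3 g1 g2 g3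
    have hfR : ∀ V ∈ R, f V = 0 := fun V hV => f2 V (Finset.disjoint_right.1 hd hV)
    have hgQ : ∀ V ∈ Q, g V = 0 := fun V hV => g2 V (Finset.disjoint_left.1 hd hV)
    refine ⟨fun V => f V + g V, ⟨fun V hV => ?_, fun V hV => ?_, fun V hV W hW hne hn => ?_⟩, ?_⟩
    · rcases Finset.mem_union.1 hV with h | h
      · simpa [hgQ V h] using f1 V h
      · simpa [hfR V h] using g1 V h
    · simp only [Finset.mem_union, not_or] at hV
      simp [f2 V hV.1, g2 V hV.2]
    · rcases Finset.mem_union.1 hV with hV | hV <;> rcases Finset.mem_union.1 hW with hW | hW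
      · simpa [hgQ V hV, hgQ W hW] using f3 V hV W hW hne hn
      · exact absurd hn (h V hV W hW).1
      · exact absurd hn (h W hW V hV).2
      · simpa [hfR V hV, hfR W hW] using g3 V hV W hW hne hn
    · refine Prod.ext (funext fun V => ?_) (funext fun V => ?_)
      · by_cases hV : V ∈ Q
        · simp [hV, hgQ V hV]
        · simp [hV, f2 V hV]
      · by_cases hV : V ∈ R
        · simp [hV, hfR V hV]
        · simp [hV, g2 V hV]

theorem IsOuter.ncard_colorings_succ {P : Finset (Finset α)} {U : Finset α} (h : IsOuter P U)
    (k : ℕ) : (colorings (k + 1) P).ncard =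
      (colorings k P).ncard + (colorings k (P.erase U)).ncard := by
  classical
  have hlt : ∀ {m} {f : Finset α → ℕ}, f ∈ colorings m P → ∀ V ∈ P, V ≠ U → f V < f U :=
    fun hf V hV hne => hf.2.2 V hV U h.1 hne (h.2 V hV).1
  -- the colour of the outer block is the largest one, so it decides whether the top colour occurs
  have hunion : colorings (k + 1) P = colorings k P ∪ {f | f ∈ colorings (k + 1) P ∧ f U = k} := by
    ext f
    constructor
    · intro hf
      rcases (Nat.lt_succ_iff.1 (hf.1 U h.1)).lt_or_eq with hk | hk
      · refine Or.inl ⟨fun V hV => ?_, hf.2⟩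
        by_cases hVU : V = U
        · exact hVU ▸ hk
        · exact (hlt hf V hV hVU).trans hk
      · exact Or.inr ⟨hf, hk⟩
    · rintro (hf | hf)
      · exact ⟨fun V hV => (hf.1 V hV).trans (Nat.lt_succ_self k), hf.2⟩
      · exact hf.1
  have hdis : Disjoint (colorings k P) {f | f ∈ colorings (k + 1) P ∧ f U = k} :=
    Set.disjoint_left.2 fun f hf hf' => (hf.1 U h.1).ne hf'.2
  rw [hunion, Set.ncard_union_eq hdis (finite_colorings k P)
    ((finite_colorings (k + 1) P).subset fun f hf => hf.1)]
  congr 1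
  refine Set.ncard_congr (fun f _ => Function.update f U 0) ?_ ?_ ?_
  · rintro f ⟨hf, hfU⟩
    refine ⟨fun V hV => ?_, fun V hV => ?_, fun V hV W hW hne hn => ?_⟩
    · obtain ⟨hVU, hV⟩ := Finset.mem_erase.1 hV
      rw [Function.update_of_ne hVU, ← hfU]
      exact hlt hf V hV hVU
    · by_cases hVU : V = U
      · rw [hVU, Function.update_self]
      · rw [Function.update_of_ne hVU]
        exact hf.2.1 V fun h => hV (Finset.mem_erase.2 ⟨hVU, h⟩)
    · obtain ⟨hVU, hV⟩ := Finset.mem_erase.1 hV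
      obtain ⟨hWU, hW⟩ := Finset.mem_erase.1 hW
      rw [Function.update_of_ne hVU, Function.update_of_ne hWU]
      exact hf.2.2 V hV W hW hne hn
  · rintro f g ⟨-, hf⟩ ⟨-, hg⟩ hfg
    funext V
    by_cases hVU : V = U
    · rw [hVU, hf, hg]
    · simpa [Function.update_of_ne hVU] using congrFun hfg V
  · intro g hg
    refine ⟨Function.update g U k, ⟨⟨fun V hV => ?_, fun V hV => ?_, fun V hV W hW hne hn => ?_⟩,
      Function.update_self _ _ _⟩, ?_⟩
    · by_cases hVU : V = U
      · rw [hVU, Function.update_self]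
        exact Nat.lt_succ_self k
      · rw [Function.update_of_ne hVU]
        exact (hg.1 V (Finset.mem_erase.2 ⟨hVU, hV⟩)).trans (Nat.lt_succ_self k)
    · have hVU : V ≠ U := fun h' => hV (h' ▸ h.1)
      rw [Function.update_of_ne hVU]
      exact hg.2.1 V fun h' => hV (Finset.mem_of_mem_erase h')
    · by_cases hVU : V = U
      · subst hVU
        exact absurd hn ((h.2 W hW).2 (Ne.symm hne))
      · rw [Function.update_of_ne hVU]
        by_cases hWU : W = U
        · rw [hWU, Function.update_self]
          exact hg.1 V (Finset.mem_erase.2 ⟨hVU, hV⟩)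
        · rw [Function.update_of_ne hWU]
          exact hg.2.2 V (Finset.mem_erase.2 ⟨hVU, hV⟩) W (Finset.mem_erase.2 ⟨hWU, hW⟩) hne hn
    · rw [Function.update_idem, ← hg.2.1 U (Finset.notMem_erase _ _), Function.update_eq_self]

theorem ncard_colorings_mapFam (e : α ↪o β) (k : ℕ) (P : Finset (Finset α)) :
    (colorings k (mapFam e P)).ncard = (colorings k P).ncard := by
  have hinj : Function.Injective (Finset.map e.toEmbedding) := Finset.map_injective _
  refine Set.ncard_congr (fun f _ V => f (V.map e.toEmbedding)) ?_ ?_ ?_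
  · rintro f ⟨h1, h2, h3⟩
    exact ⟨fun V hV => h1 _ (map_mem_mapFam.2 hV), fun V hV => h2 _ (mt map_mem_mapFam.1 hV),
      fun V hV W hW hne hn => h3 _ (map_mem_mapFam.2 hV) _ (map_mem_mapFam.2 hW)
        (fun h => hne (hinj h)) ((nested_map_iff e).2 hn)⟩
  · intro f g hf hg hfg
    funext W
    by_cases hW : W ∈ mapFam e P
    · obtain ⟨V, hV, rfl⟩ := mem_mapFam.1 hW
      exact congrFun hfg V
    · rw [hf.2.1 W hW, hg.2.1 W hW]
  · rintro f ⟨h1, h2, h3⟩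
    refine ⟨Function.extend (Finset.map e.toEmbedding) f 0, ⟨fun W hW => ?_, fun W hW => ?_,
      fun W hW W' hW' hne hn => ?_⟩, funext fun V => hinj.extend_apply _ _ _⟩
    · obtain ⟨V, hV, rfl⟩ := mem_mapFam.1 hW
      rw [hinj.extend_apply]
      exact h1 V hV
    · by_cases h : ∃ V, Finset.map e.toEmbedding V = W
      · obtain ⟨V, rfl⟩ := h
        rw [hinj.extend_apply]
        exact h2 V (mt map_mem_mapFam.2 hW)
      · rw [Function.extend_apply' _ _ _ h]
        rfl
    · obtain ⟨V, hV, rfl⟩ := mem_mapFam.1 hW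
      obtain ⟨V', hV', rfl⟩ := mem_mapFam.1 hW'
      rw [hinj.extend_apply, hinj.extend_apply]
      exact h3 V hV V' hV' (fun h => hne (congrArg _ h)) ((nested_map_iff e).1 hn)

/-- The number of surjective strictly increasing maps from the blocks of `P` to `Fin m`. -/
noncomputable def surjCount (m : ℕ) (P : Finset (Finset α)) : ℕ :=
  Nat.card {f : {V // V ∈ P} → Fin m //
    Function.Surjective f ∧ ∀ V W, V ≠ W → Nested V.1 W.1 → f V < f W}

theorem surjCount_eq_zero {m : ℕ} {P : Finset (Finset α)} (h : P.card < m) : surjCount m P = 0 := by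
  rw [surjCount, Nat.card_eq_zero]
  left
  refine ⟨fun f => ?_⟩
  have := Fintype.card_le_of_surjective f.1 f.2.1
  simp at this
  omega

theorem surjCount_zero {P : Finset (Finset α)} (hP : P.Nonempty) : surjCount 0 P = 0 := by
  rw [surjCount, Nat.card_eq_zero]
  obtain ⟨V, hV⟩ := hP
  exact Or.inl ⟨fun f => (f.1 ⟨V, hV⟩).elim0⟩

/-- The colourings with a given set `T` of colours. -/
theorem ncard_colorings_image_eq {k : ℕ} {P : Finset (Finset α)} {T : Finset ℕ}
    (hT : T ⊆ Finset.range k) :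
    {f | f ∈ colorings k P ∧ P.image f = T}.ncard = surjCount T.card P := by
  classical
  rw [surjCount, ← Nat.card_coe_set_eq]
  symm
  refine Nat.card_congr (Equiv.ofBijective (fun f => ⟨fun V => if h : V ∈ P then
    T.orderEmbOfFin rfl (f.1 ⟨V, h⟩) else 0, ⟨?_, ?_, ?_⟩, ?_⟩) ⟨?_, ?_⟩)
  · intro V hV
    simp only [dif_pos hV]
    exact Finset.mem_range.1 (hT (Finset.orderEmbOfFin_mem _ _ _))
  · intro V hV
    exact dif_neg hV
  · intro V hV W hW hne hn
    simp only [dif_pos hV, dif_pos hW]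
    exact (T.orderEmbOfFin rfl).strictMono
      (f.2.2 ⟨V, hV⟩ ⟨W, hW⟩ (fun h => hne (congrArg Subtype.val h)) hn)
  · ext t
    rw [Finset.mem_image]
    constructor
    · rintro ⟨V, hV, rfl⟩
      rw [dif_pos hV]
      exact Finset.orderEmbOfFin_mem _ _ _
    · intro ht
      have : t ∈ Set.range (T.orderEmbOfFin rfl) := by
        rw [Finset.range_orderEmbOfFin]
        exact ht
      obtain ⟨a, rfl⟩ := this
      obtain ⟨⟨V, hV⟩, rfl⟩ := f.2.1 a
      exact ⟨V, hV, dif_pos hV⟩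
  · intro f g hfg
    refine Subtype.ext (funext fun V => ?_)
    have := congrFun (Subtype.ext_iff.1 hfg) V.1
    simp only [dif_pos V.2] at this
    exact (T.orderEmbOfFin rfl).injective this
  · rintro ⟨g, ⟨h1, h2, h3⟩, h4⟩
    have hmem : ∀ V : {V // V ∈ P}, g V.1 ∈ T := fun V => h4 ▸ Finset.mem_image_of_mem _ V.2
    have hcoe : ∀ a : T, T.orderEmbOfFin rfl ((T.orderIsoOfFin rfl).symm a) = a := fun a => by
      rw [← Finset.coe_orderIsoOfFin_apply, OrderIso.apply_symm_apply]
    refine ⟨⟨fun V => (T.orderIsoOfFin rfl).symm ⟨g V.1, hmem V⟩, ?_, ?_⟩, ?_⟩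
    · intro a
      have ha : T.orderEmbOfFin rfl a ∈ P.image g := h4 ▸ Finset.orderEmbOfFin_mem _ _ _
      obtain ⟨V, hV, hVa⟩ := Finset.mem_image.1 ha
      refine ⟨⟨V, hV⟩, (T.orderEmbOfFin rfl).injective ?_⟩
      rw [hcoe]
      exact hVa
    · intro V W hne hn
      refine (T.orderIsoOfFin rfl).symm.strictMono ?_
      exact h3 V.1 V.2 W.1 W.2 (fun h => hne (Subtype.ext h)) hn
    · refine Subtype.ext (funext fun V => ?_)
      by_cases hV : V ∈ P
      · simp only [dif_pos hV]
        rw [hcoe]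
      · simp only [dif_neg hV]
        exact (h2 V hV).symm

theorem ncard_colorings_eq_sum (k : ℕ) (P : Finset (Finset α)) :
    (colorings k P).ncard = ∑ m ∈ Finset.range (P.card + 1), k.choose m * surjCount m P := by
  classical
  have hfin := finite_colorings k P
  rw [Set.ncard_eq_toFinset_card _ hfin, Finset.card_eq_sum_card_fiberwise
    (f := fun f => P.image f) (t := (Finset.range k).powerset)]
  · have h1 : ∀ T ∈ (Finset.range k).powerset,
        (hfin.toFinset.filter fun f => P.image f = T).card = surjCount T.card P := by
      intro T hT
      rw [← ncard_colorings_image_eq (Finset.mem_powerset.1 hT), ← Set.ncard_coe_finset]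
      congr 1
      ext f
      simp
    rw [Finset.sum_congr rfl h1,
      Finset.sum_powerset_apply_card (fun m => surjCount m P), Finset.card_range]
    simp only [smul_eq_mul]
    rcases le_total k P.card with h | h
    · refine Finset.sum_subset (Finset.range_mono (by omega)) fun m _ hm => ?_
      rw [Nat.choose_eq_zero_of_lt (by simpa using hm), zero_mul]
    · symm
      refine Finset.sum_subset (Finset.range_mono (by omega)) fun m _ hm => ?_
      rw [surjCount_eq_zero (by simpa using hm), mul_zero]
  · intro f hf
    have hf := (Set.Finite.mem_toFinset hfin).1 hf
    refine Finset.mem_coe.2 (Finset.mem_powerset.2 fun t ht => ?_)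
    obtain ⟨V, hV, rfl⟩ := Finset.mem_image.1 ht
    exact Finset.mem_range.2 (hf.1 V hV)

end Weights

section OmegaPoly

open Polynomial

variable {α β : Type*} [LinearOrder α] [LinearOrder β]

/-- The polynomial `X (X - 1) ⋯ (X - m + 1) / m!`. -/
noncomputable def choosePoly (m : ℕ) : ℂ[X] := C ((m.factorial : ℂ)⁻¹) * descPochhammer ℂ m

theorem eval_choosePoly (m k : ℕ) : (choosePoly m).eval (k : ℂ) = (k.choose m : ℂ) := by
  rw [choosePoly, eval_C_mul, descPochhammer_eval_eq_descFactorial,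
    Nat.descFactorial_eq_factorial_mul_choose, Nat.cast_mul, inv_mul_cancel_left₀]
  exact_mod_cast m.factorial_ne_zero

theorem eval_neg_one_descPochhammer (m : ℕ) :
    (descPochhammer ℂ m).eval (-1) = (-1) ^ m * (m.factorial : ℂ) := by
  induction m with
  | zero => simp
  | succ m ih =>
    rw [descPochhammer_succ_right, eval_mul, ih, Nat.factorial_succ]
    simp only [eval_sub, eval_X, eval_natCast]
    push_cast
    ring

theorem eval_derivative_choosePoly (m : ℕ) :
    (derivative (choosePoly (m + 1))).eval 0 = (-1) ^ m / ((m : ℂ) + 1) := by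
  rw [choosePoly, derivative_C_mul, eval_C_mul, descPochhammer_succ_left, derivative_mul,
    derivative_X, one_mul, eval_add, eval_comp, eval_mul, eval_X, zero_mul, add_zero, eval_sub,
    eval_X, eval_one, zero_sub, eval_neg_one_descPochhammer, Nat.factorial_succ]
  have h1 : (m.factorial : ℂ) ≠ 0 := by exact_mod_cast m.factorial_ne_zero
  have h2 : (m : ℂ) + 1 ≠ 0 := by exact_mod_cast m.succ_ne_zero
  push_cast
  field_simp

/-- The polynomial of which the value at `k` is the number of strictly increasing colourings of
the blocks of `P` by `k` colours. -/
noncomputable def omegaPoly (P : Finset (Finset α)) : ℂ[X] :=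
  ∑ m ∈ Finset.range (P.card + 1), C (surjCount m P : ℂ) * choosePoly m

theorem eval_omegaPoly (P : Finset (Finset α)) (k : ℕ) :
    (omegaPoly P).eval (k : ℂ) = ((colorings k P).ncard : ℂ) := by
  rw [omegaPoly, eval_finsetSum, ncard_colorings_eq_sum, Nat.cast_sum]
  refine Finset.sum_congr rfl fun m _ => ?_
  rw [eval_C_mul, eval_choosePoly, Nat.cast_mul, mul_comm]

theorem poly_eq_of_eval_nat {p q : ℂ[X]} (h : ∀ k : ℕ, p.eval (k : ℂ) = q.eval (k : ℂ)) : p = q :=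
  eq_of_infinite_eval_eq p q ((Set.infinite_range_of_injective Nat.cast_injective).mono
    (by rintro _ ⟨k, rfl⟩; exact h k))

theorem omegaPoly_empty : omegaPoly (∅ : Finset (Finset α)) = 1 :=
  poly_eq_of_eval_nat fun k => by rw [eval_omegaPoly, ncard_colorings_empty]; simp

theorem omegaPoly_union {Q R : Finset (Finset α)} (h : Separated Q R) :
    omegaPoly (Q ∪ R) = omegaPoly Q * omegaPoly R :=
  poly_eq_of_eval_nat fun k => by
    rw [eval_mul, eval_omegaPoly, eval_omegaPoly, eval_omegaPoly, ncard_colorings_union k h,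
      Nat.cast_mul]

theorem omegaPoly_mapFam (e : α ↪o β) (P : Finset (Finset α)) :
    omegaPoly (mapFam e P) = omegaPoly P :=
  poly_eq_of_eval_nat fun k => by
    rw [eval_omegaPoly, eval_omegaPoly, ncard_colorings_mapFam]

/-- The polynomials `omegaPoly` satisfy a difference equation, as the outer block alone can have the
largest colour. -/
theorem IsOuter.eval_omegaPoly {P : Finset (Finset α)} {U : Finset α} (h : IsOuter P U) (t : ℂ) :
    (omegaPoly (P.erase U)).eval t = (omegaPoly P).eval (t + 1) - (omegaPoly P).eval t := by
  have : omegaPoly (P.erase U) = (omegaPoly P).comp (X + 1) - omegaPoly P :=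
    poly_eq_of_eval_nat fun k => by
      have h1 : (k : ℂ) + 1 = ((k + 1 : ℕ) : ℂ) := by push_cast; rfl
      rw [eval_sub, eval_comp, eval_add, eval_X, eval_one, h1, OVI.eval_omegaPoly,
        OVI.eval_omegaPoly, OVI.eval_omegaPoly, h.ncard_colorings_succ]
      push_cast
      ring
  rw [this]
  simp [eval_comp]

theorem eval_omegaPoly_zero {P : Finset (Finset α)} (hP : P.Nonempty) :
    (omegaPoly P).eval 0 = 0 := by
  have := eval_omegaPoly P 0
  rwa [Nat.cast_zero, ncard_colorings_zero hP, Nat.cast_zero] at this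

/-- The linear coefficient of `omegaPoly π` is the number `ω(π)`. -/
theorem eval_derivative_omegaPoly {P : Finset (Finset α)} (hP : P.Nonempty) {n : ℕ}
    (hn : P.card ≤ n) : (derivative (omegaPoly P)).eval 0 =
      ∑ k ∈ Finset.Icc 1 n, (-1 : ℂ) ^ (k + 1) / (k : ℂ) * (surjCount k P : ℂ) := by
  have h1 : omegaPoly P = ∑ m ∈ Finset.range (n + 1), C (surjCount m P : ℂ) * choosePoly m := by
    refine Finset.sum_subset (Finset.range_mono (by omega)) fun m _ hm => ?_
    rw [surjCount_eq_zero (by simpa using hm), Nat.cast_zero, C_0, zero_mul]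
  have h2 : Finset.Icc 1 n = Finset.Ico 1 (n + 1) := by
    ext
    simp
  rw [h1, derivative_sum, eval_finsetSum, Finset.sum_range_succ', surjCount_zero hP,
    Nat.cast_zero, C_0, zero_mul, derivative_zero, eval_zero, add_zero, h2,
    Finset.sum_Ico_eq_sum_range, Nat.add_sub_cancel]
  refine Finset.sum_congr rfl fun m _ => ?_
  rw [derivative_C_mul, eval_C_mul, eval_derivative_choosePoly, add_comm 1 m, mul_comm, pow_add,
    pow_add]
  push_cast
  ring

end OmegaPoly

section TreeWeights

theorem treeWeight_one : TreeWeight fun _ => 1 := ⟨rfl, fun _ _ _ => by simp, fun _ _ => rfl⟩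

theorem treeWeight_sign : TreeWeight fun P => (-1 : ℂ) ^ P.card :=
  ⟨by simp, fun Q R h => by rw [Finset.card_union_of_disjoint h.disjoint, pow_add],
    fun e P => by rw [card_mapFam]⟩

theorem treeWeight_tree (t : ℂ) : TreeWeight fun P => t ^ P.card / (famTree P : ℂ) :=
  ⟨by simp [famTree], fun Q R h => by
    rw [Finset.card_union_of_disjoint h.disjoint, pow_add, famTree_union h, Nat.cast_mul,
      mul_div_mul_comm], fun e P => by rw [card_mapFam, famTree_mapFam]⟩

theorem treeWeight_omega (t : ℂ) : TreeWeight fun P => (omegaPoly P).eval t :=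
  ⟨by simp [omegaPoly_empty], fun Q R h => by rw [omegaPoly_union h, Polynomial.eval_mul],
    fun e P => by rw [omegaPoly_mapFam]⟩

open Classical in
/-- The weight `z^|P|` restricted to families without nesting; among the non-crossing partitions of
an interval these are the interval partitions. -/
noncomputable def antichainWeight (z : ℂ) (P : Finset (Finset ℕ)) : ℂ :=
  if ∀ V ∈ P, ∀ W ∈ P, Nested V W → V = W then z ^ P.card else 0

theorem treeWeight_antichain (z : ℂ) : TreeWeight (antichainWeight z) := by
  classical
  refine ⟨by simp [antichainWeight], fun Q R h => ?_, fun e P => ?_⟩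
  · have : (∀ V ∈ Q ∪ R, ∀ W ∈ Q ∪ R, Nested V W → V = W) ↔
        (∀ V ∈ Q, ∀ W ∈ Q, Nested V W → V = W) ∧ (∀ V ∈ R, ∀ W ∈ R, Nested V W → V = W) := by
      constructor
      · exact fun h' => ⟨fun V hV W hW => h' V (Finset.mem_union_left _ hV) W
          (Finset.mem_union_left _ hW), fun V hV W hW => h' V (Finset.mem_union_right _ hV) W
          (Finset.mem_union_right _ hW)⟩
      · rintro ⟨h1, h2⟩ V hV W hW hn
        rcases Finset.mem_union.1 hV with hV | hV <;> rcases Finset.mem_union.1 hW with hW | hW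
        · exact h1 V hV W hW hn
        · exact absurd hn (h V hV W hW).1
        · exact absurd hn (h W hW V hV).2
        · exact h2 V hV W hW hn
    rw [antichainWeight, antichainWeight, antichainWeight,
      Finset.card_union_of_disjoint h.disjoint, pow_add, ite_zero_mul_ite_zero]
    exact if_congr this rfl rfl
  · have : (∀ V ∈ mapFam e P, ∀ W ∈ mapFam e P, Nested V W → V = W) ↔
        (∀ V ∈ P, ∀ W ∈ P, Nested V W → V = W) := by
      constructor
      · intro h V hV W hW hn
        exact (map_inj_iff e).1
          (h _ (map_mem_mapFam.2 hV) _ (map_mem_mapFam.2 hW) ((nested_map_iff e).2 hn))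
      · intro h V hV W hW hn
        obtain ⟨V, hV', rfl⟩ := mem_mapFam.1 hV
        obtain ⟨W, hW', rfl⟩ := mem_mapFam.1 hW
        exact (map_inj_iff e).2 (h V hV' W hW' ((nested_map_iff e).1 hn))
    simp only [antichainWeight, this, card_mapFam]

theorem isOuter_of_mem_irrFams {i k : ℕ} {P : Finset (Finset ℕ)} (hP : P ∈ irrFams i k) :
    ∃ V, IsOuter P V ∧ P.filter (i ∉ ·) = P.erase V := by
  obtain ⟨hP', V, hV, hi, m, hm, rfl⟩ := mem_irrFams.1 hP
  obtain ⟨hnc, hs⟩ := mem_ncFams.1 hP'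
  have hb : ∀ W ∈ P, ∀ w ∈ W, i ≤ w ∧ w ≤ m := fun W hW w hw => by
    have := Finset.mem_Ico.1 (hs ▸ subset_supp hW hw)
    omega
  refine ⟨V, ⟨hV, fun W hW => ⟨fun w hw => ⟨⟨i, hi, (hb W hW w hw).1⟩, m, hm, (hb W hW w hw).2⟩,
    fun hne hn => ?_⟩⟩, ?_⟩
  · obtain ⟨w, hw, hwi⟩ := (hn i hi).1
    obtain rfl : w = i := le_antisymm hwi (hb W hW w hw).1
    exact hne (hnc.eq_of_mem hW hV hw hi)
  · ext W
    rw [Finset.mem_filter, Finset.mem_erase]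
    constructor
    · rintro ⟨h1, h2⟩
      exact ⟨fun h => h2 (h ▸ hi), h1⟩
    · rintro ⟨h1, h2⟩
      exact ⟨h2, fun h => h1 (hnc.eq_of_mem h2 hV h hi)⟩

variable {A : Type*} [Ring A] [Algebra ℂ A]

theorem irrWord_congr {c d : Finset (Finset ℕ) → ℂ} (f : List A → A) (w : List A)
    (h : ∀ P V, IsOuter P V → c P = d P) : irrWord c f w = irrWord d f w := by
  rw [irrWord, irrSum, irrWord, irrSum]
  refine Finset.sum_congr rfl fun P hP => ?_
  obtain ⟨V, hV, -⟩ := isOuter_of_mem_irrFams hP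
  rw [h P V hV]

/-- Weights by inner blocks are weights of the whole irreducible partition. -/
theorem outerWord_eq {c d : Finset (Finset ℕ) → ℂ} (f : List A → A) (w : List A)
    (h : ∀ P V, IsOuter P V → c (P.erase V) = d P) : outerWord c f w = irrWord d f w := by
  rw [outerWord, outerSum, irrWord, irrSum]
  refine Finset.sum_congr rfl fun P hP => ?_
  obtain ⟨V, hV, hV'⟩ := isOuter_of_mem_irrFams hP
  rw [hV', h P V hV]

/-- Only the partition with one block is both irreducible and an interval partition. -/
theorem irrWord_antichain {f : List A → A} (hf0 : f [] = 0) (z : ℂ) (w : List A) :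
    irrWord (antichainWeight z) f w = z • f w := by
  classical
  rcases eq_or_ne w [] with rfl | hw
  · simp [hf0]
  have hlen : 0 < w.length := List.length_pos_iff.2 hw
  have hmem : ({Finset.Ico 0 w.length} : Finset (Finset ℕ)) ∈ irrFams 0 w.length := by
    refine mem_irrFams.2 ⟨mem_ncFams.2 ⟨⟨?_, ?_, ?_⟩, by simp⟩, _, Finset.mem_singleton_self _,
      by simpa using hlen, w.length - 1, by simp; omega, by omega⟩
    · simpa using hw
    · intro V hV W hW hne
      exact absurd ((Finset.mem_singleton.1 hV).trans (Finset.mem_singleton.1 hW).symm) hne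
    · intro V hV W hW hne
      exact absurd ((Finset.mem_singleton.1 hV).trans (Finset.mem_singleton.1 hW).symm) hne
  rw [irrWord, irrSum, Finset.sum_eq_single {Finset.Ico 0 w.length}]
  · have h1 : antichainWeight z {Finset.Ico 0 w.length} = z := by simp [antichainWeight]
    have h2 : (Finset.Ico 0 w.length).sort.map (letters w) = w := by
      rw [← Finset.range_eq_Ico, Finset.sort_range]
      refine List.ext_getElem (by simp) fun m h1 h2 => ?_
      simp [letters, h2]
    rw [h1, val_singleton, blockVal, h2]
  · intro P hP hne
    obtain ⟨V, hV, -⟩ := isOuter_of_mem_irrFams hP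
    rw [antichainWeight, if_neg, zero_smul]
    intro h
    have hPV : P = {V} := Finset.eq_singleton_iff_unique_mem.2
      ⟨hV.1, fun W hW => h W hW V hV.1 (hV.2 W hW).1⟩
    have hs := (mem_ncFams.1 (mem_irrFams.1 hP).1).2
    rw [hPV, supp_singleton] at hs
    exact hne (hs ▸ hPV)
  · exact fun h => absurd hmem h

theorem outerWord_one (f : List A → A) (w : List A) :
    outerWord (fun _ => 1) f w = irrWord (fun _ => 1) f w :=
  outerWord_eq f w fun _ _ _ => rfl

theorem outerWord_sign (f : List A → A) (w : List A) :
    outerWord (fun P => (-1 : ℂ) ^ P.card) f w = - irrWord (fun P => (-1 : ℂ) ^ P.card) f w := by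
  rw [outerWord_eq (d := fun P => -(-1 : ℂ) ^ P.card)]
  · simp [irrWord, irrSum]
  · intro P V hV
    rw [Finset.card_erase_of_mem hV.1]
    obtain ⟨m, hm⟩ := Nat.exists_eq_succ_of_ne_zero (Finset.card_ne_zero_of_mem hV.1)
    rw [hm, Nat.succ_sub_one, pow_succ]
    ring

/-- Leaving out the outer block is taking the difference in `t`. -/
theorem outerWord_omega (f : List A → A) (t : ℂ) (w : List A) :
    outerWord (fun P => (omegaPoly P).eval t) f w =
      irrWord (fun P => (omegaPoly P).eval (t + 1)) f w -
        irrWord (fun P => (omegaPoly P).eval t) f w := by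
  rw [outerWord_eq (d := fun P => (omegaPoly P).eval (t + 1) - (omegaPoly P).eval t)]
  · simp only [irrWord, irrSum, ← Finset.sum_sub_distrib, sub_smul]
  · exact fun P V hV => hV.eval_omegaPoly t

/-- Leaving out the outer block is differentiation with respect to `t`. -/
theorem outerWord_tree (f : List A → A) (t : ℂ) (w : List A) :
    outerWord (fun P => t ^ P.card / (famTree P : ℂ)) f w =
      irrWord (fun P => (P.card : ℂ) * t ^ (P.card - 1) / (famTree P : ℂ)) f w := by
  refine outerWord_eq f w fun P V hV => ?_
  have h1 : (P.card : ℂ) ≠ 0 := by exact_mod_cast Finset.card_ne_zero_of_mem hV.1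
  rw [Finset.card_erase_of_mem hV.1, hV.famTree_eq, Nat.cast_mul, mul_div_mul_left _ _ h1]

end TreeWeights

/-! ### Derivatives of polynomial functions with values in a vector space -/

section PolyDeriv

open Polynomial

variable {M M' : Type*} [AddCommGroup M] [Module ℂ M] [AddCommGroup M'] [Module ℂ M']

/-- `F : ℂ → M` is a polynomial function with derivative `F'`, i.e. `(F, F')` is a linear
combination of pairs `(p • a, p' • a)` with `p ∈ ℂ[X]` and `a ∈ M`. -/
def PolyDeriv (F F' : ℂ → M) : Prop :=
  (F, F') ∈ Submodule.span ℂ {q : (ℂ → M) × (ℂ → M) | ∃ (p : ℂ[X]) (a : M),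
    q = (fun s => p.eval s • a, fun s => (derivative p).eval s • a)}

theorem polyDeriv_eval (p : ℂ[X]) (a : M) :
    PolyDeriv (fun s => p.eval s • a) (fun s => (derivative p).eval s • a) :=
  Submodule.subset_span ⟨p, a, rfl⟩

theorem polyDeriv_const (a : M) : PolyDeriv (fun _ => a) (fun _ => 0) := by
  simpa using polyDeriv_eval 1 a

variable {F F' G G' : ℂ → M}

theorem PolyDeriv.add (hF : PolyDeriv F F') (hG : PolyDeriv G G') :
    PolyDeriv (fun s => F s + G s) (fun s => F' s + G' s) :=
  Submodule.add_mem _ hF hG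

theorem PolyDeriv.const_smul (c : ℂ) (hF : PolyDeriv F F') :
    PolyDeriv (fun s => c • F s) (fun s => c • F' s) :=
  Submodule.smul_mem _ c hF

theorem PolyDeriv.sub (hF : PolyDeriv F F') (hG : PolyDeriv G G') :
    PolyDeriv (fun s => F s - G s) (fun s => F' s - G' s) :=
  Submodule.sub_mem _ hF hG

theorem PolyDeriv.sum {ι : Type*} (t : Finset ι) {F F' : ι → ℂ → M}
    (h : ∀ i ∈ t, PolyDeriv (F i) (F' i)) :
    PolyDeriv (fun s => ∑ i ∈ t, F i s) (fun s => ∑ i ∈ t, F' i s) := by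
  classical
  induction t using Finset.induction_on with
  | empty => simpa using polyDeriv_const (0 : M)
  | insert a t ha ih =>
    simp only [Finset.sum_insert ha]
    exact (h a (Finset.mem_insert_self _ _)).add
      (ih fun i hi => h i (Finset.mem_insert_of_mem hi))

/-- Induction over polynomial functions. -/
theorem PolyDeriv.induction {C : (ℂ → M) → (ℂ → M) → Prop}
    (hp : ∀ p a, C (fun s => p.eval s • a) (fun s => (derivative p).eval s • a))
    (hadd : ∀ F F' G G', C F F' → C G G' → C (fun s => F s + G s) (fun s => F' s + G' s))
    (h : PolyDeriv F F') : C F F' := by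
  have key : ∀ q ∈ Submodule.span ℂ {q : (ℂ → M) × (ℂ → M) | ∃ (p : ℂ[X]) (a : M),
      q = (fun s => p.eval s • a, fun s => (derivative p).eval s • a)},
      ∀ c : ℂ, C (c • q.1) (c • q.2) := by
    intro q hq
    induction hq using Submodule.span_induction with
    | mem q hq =>
      obtain ⟨p, a, rfl⟩ := hq
      intro c
      convert hp p (c • a) using 1 <;> (funext s; simp [smul_comm c])
    | zero =>
      intro c
      convert hp 0 0 using 1 <;> (funext s; simp)
    | add q q' _ _ ih ih' =>
      intro c
      convert hadd _ _ _ _ (ih c) (ih' c) using 1 <;> (funext s; simp)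
    | smul d q _ ih =>
      intro c
      simpa [smul_smul] using ih (c * d)
  simpa using key _ h 1

theorem PolyDeriv.map (L : M →ₗ[ℂ] M') (h : PolyDeriv F F') :
    PolyDeriv (fun s => L (F s)) (fun s => L (F' s)) := by
  refine h.induction (C := fun F F' => PolyDeriv (fun s => L (F s)) (fun s => L (F' s))) ?_ ?_
  · intro p a
    simp only [map_smul]
    exact polyDeriv_eval p (L a)
  · intro F F' G G' hF hG
    simp only [map_add]
    exact hF.add hG

theorem PolyDeriv.eval_smul (p : ℂ[X]) (h : PolyDeriv F F') :
    PolyDeriv (fun s => p.eval s • F s)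
      (fun s => (derivative p).eval s • F s + p.eval s • F' s) := by
  refine h.induction (C := fun F F' => PolyDeriv (fun s => p.eval s • F s)
      (fun s => (derivative p).eval s • F s + p.eval s • F' s)) ?_ ?_
  · intro q a
    convert polyDeriv_eval (p * q) a using 1 <;> funext s
    · rw [eval_mul, mul_smul]
    · rw [derivative_mul, eval_add, eval_mul, eval_mul, add_smul, mul_smul, mul_smul]
  · intro F F' G G' hF hG
    convert hF.add hG using 1 <;> funext s
    · rw [smul_add]
    · rw [smul_add, smul_add]
      abel

theorem PolyDeriv.comp (q : ℂ[X]) (h : PolyDeriv F F') :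
    PolyDeriv (fun s => F (q.eval s)) (fun s => (derivative q).eval s • F' (q.eval s)) := by
  refine h.induction (C := fun F F' => PolyDeriv (fun s => F (q.eval s))
      (fun s => (derivative q).eval s • F' (q.eval s))) ?_ ?_
  · intro p a
    convert polyDeriv_eval (p.comp q) a using 1 <;> funext s
    · rw [eval_comp]
    · rw [derivative_comp, eval_mul, eval_comp, mul_smul]
  · intro F F' G G' hF hG
    convert hF.add hG using 1
    funext s
    rw [smul_add]

/-- The product rule. -/
theorem PolyDeriv.apply {L L' : ℂ → M →ₗ[ℂ] M'}
    (hL : ∀ a, PolyDeriv (fun s => L s a) (fun s => L' s a)) (h : PolyDeriv F F') :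
    PolyDeriv (fun s => L s (F s)) (fun s => L' s (F s) + L s (F' s)) := by
  refine h.induction (C := fun F F' => PolyDeriv (fun s => L s (F s))
    (fun s => L' s (F s) + L s (F' s))) ?_ ?_
  · intro p a
    convert (hL a).eval_smul p using 1 <;> funext s
    · rw [map_smul]
    · rw [map_smul, map_smul, add_comm]
  · intro F F' G G' hF hG
    convert hF.add hG using 1 <;> funext s
    · rw [map_add]
    · rw [map_add, map_add]
      abel

theorem PolyDeriv.exists_poly (h : PolyDeriv F F') (φ : Module.Dual ℂ M) :
    ∃ p : ℂ[X], ∀ s, φ (F s) = p.eval s ∧ φ (F' s) = (derivative p).eval s := by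
  refine h.induction (C := fun F F' =>
    ∃ p : ℂ[X], ∀ s, φ (F s) = p.eval s ∧ φ (F' s) = (derivative p).eval s) ?_ ?_
  · intro p a
    refine ⟨p * C (φ a), fun s => ?_⟩
    simp
  · rintro F F' G G' ⟨p, hp⟩ ⟨q, hq⟩
    refine ⟨p + q, fun s => ?_⟩
    simp [hp, hq]

theorem PolyDeriv.eq_zero_of_nat (h : PolyDeriv F F') (h0 : ∀ k : ℕ, F k = 0) (s : ℂ) :
    F s = 0 ∧ F' s = 0 := by
  rw [← Module.forall_dual_apply_eq_zero_iff ℂ, ← Module.forall_dual_apply_eq_zero_iff ℂ (F' s),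
    ← forall_and]
  intro φ
  obtain ⟨p, hp⟩ := h.exists_poly φ
  have : p = 0 := poly_eq_of_eval_nat fun k => by rw [← (hp k).1, h0, map_zero, eval_zero]
  rw [(hp s).1, (hp s).2, this]
  simp

/-- Polynomial functions that agree on `ℕ` are equal, and so are their derivatives. -/
theorem PolyDeriv.eq_of_nat (hF : PolyDeriv F F') (hG : PolyDeriv G G')
    (h : ∀ k : ℕ, F k = G k) (s : ℂ) : F s = G s ∧ F' s = G' s := by
  have := (hF.sub hG).eq_zero_of_nat (fun k => sub_eq_zero.2 (h k)) s
  exact ⟨sub_eq_zero.1 this.1, sub_eq_zero.1 this.2⟩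

/-- A polynomial function is determined by its derivative and its value at `0`. -/
theorem PolyDeriv.eq_of_deriv (hF : PolyDeriv F F') (hG : PolyDeriv G G')
    (h : ∀ s, F' s = G' s) (h0 : F 0 = G 0) (s : ℂ) : F s = G s := by
  rw [← sub_eq_zero, ← Module.forall_dual_apply_eq_zero_iff ℂ]
  intro φ
  obtain ⟨p, hp⟩ := (hF.sub hG).exists_poly φ
  have hd : derivative p = 0 := poly_eq_of_eval_nat fun k => by
    rw [← (hp k).2, h, sub_self, map_zero, eval_zero]
  rw [(hp s).1, eq_C_of_derivative_eq_zero hd, eval_C, coeff_zero_eq_eval_zero, ← (hp 0).1, h0,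
    sub_self, map_zero]

end PolyDeriv

section PolyHat

variable {A : Type*} [Ring A] [Algebra ℂ A]

theorem polyDeriv_hat {F F' : ℂ → List A → A}
    (h : ∀ w, PolyDeriv (fun s => F s w) (fun s => F' s w)) (Y : IncidenceAlgebra A ℕ) (i j : ℕ) :
    PolyDeriv (fun s => hat (F s) Y i j) (fun s => hat (F' s) Y i j) := by
  simp only [hat_apply]
  induction hd : j - i using Nat.strong_induction_on generalizing i F F' with
  | _ d ih =>
  rcases lt_trichotomy i j with hij | rfl | hij
  · simp only [pathSum_of_lt _ _ hij]
    refine PolyDeriv.sum _ fun k hk => ?_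
    have := Finset.mem_Ioc.1 hk
    exact ih (j - k) (by omega) (fun w => h _) k rfl
  · simpa using h []
  · simpa only [pathSum_of_gt _ _ (show ¬ i ≤ j by omega)] using polyDeriv_const (0 : A)

theorem PolyDeriv.mul_hat {F F' : ℂ → IncidenceAlgebra A ℕ}
    (h : ∀ i j, PolyDeriv (fun s => F s i j) (fun s => F' s i j)) (Z : IncidenceAlgebra A ℕ)
    (i j : ℕ) : PolyDeriv (fun s => (F s * Z) i j) (fun s => (F' s * Z) i j) := by
  simp only [IncidenceAlgebra.mul_apply]
  exact PolyDeriv.sum _ fun k _ => (h i k).map (LinearMap.mulRight ℂ (Z k j))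

theorem polyDeriv_irrWord {c c' : ℂ → Finset (Finset ℕ) → ℂ}
    (p : Finset (Finset ℕ) → Polynomial ℂ) (hc : ∀ s P V, IsOuter P V → c s P = (p P).eval s)
    (hc' : ∀ s P V, IsOuter P V → c' s P = (Polynomial.derivative (p P)).eval s) (f : List A → A)
    (w : List A) : PolyDeriv (fun s => irrWord (c s) f w) (fun s => irrWord (c' s) f w) := by
  simp only [irrWord, irrSum]
  refine PolyDeriv.sum _ fun P hP => ?_
  obtain ⟨V, hV, -⟩ := isOuter_of_mem_irrFams hP
  simp only [hc _ P V hV, hc' _ P V hV]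
  exact polyDeriv_eval (p P) _

/-- The weight `t^|P| / P!`. -/
noncomputable def treeWeight (t : ℂ) (P : Finset (Finset ℕ)) : ℂ := t ^ P.card / (famTree P : ℂ)

theorem polyDeriv_irrWord_tree (f : List A → A) (w : List A) :
    PolyDeriv (fun s => irrWord (treeWeight s) f w) (fun s => outerWord (treeWeight s) f w) := by
  have : (fun s => outerWord (treeWeight s) f w) = fun s =>
      irrWord (fun P => (P.card : ℂ) * s ^ (P.card - 1) / (famTree P : ℂ)) f w :=
    funext fun s => outerWord_tree f s w
  rw [this]
  refine polyDeriv_irrWord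
    (fun P => Polynomial.C ((famTree P : ℂ)⁻¹) * Polynomial.X ^ P.card) ?_ ?_ f w
  · intro s P V _
    rw [treeWeight, Polynomial.eval_C_mul, Polynomial.eval_pow, Polynomial.eval_X, div_eq_inv_mul]
  · intro s P V _
    rw [Polynomial.derivative_C_mul, Polynomial.derivative_X_pow]
    simp
    ring

end PolyHat

/-! ### Compositional flows of triangular matrices -/

section Low

variable {A : Type*} [Ring A]

/-- The entries of `Z` vanish on the first `d` diagonals. -/
def Low (d : ℕ) (Z : IncidenceAlgebra A ℕ) : Prop := ∀ i j, j < i + d → Z i j = 0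

theorem Low.zero (Z : IncidenceAlgebra A ℕ) : Low 0 Z := fun i j h =>
  Z.apply_eq_zero_of_not_le (by omega)

theorem Low.add {d : ℕ} {Y Z : IncidenceAlgebra A ℕ} (hY : Low d Y) (hZ : Low d Z) :
    Low d (Y + Z) := fun i j h => by
  rw [IncidenceAlgebra.add_apply, hY i j h, hZ i j h, add_zero]

theorem Low.neg {d : ℕ} {Z : IncidenceAlgebra A ℕ} (hZ : Low d Z) : Low d (-Z) := fun i j h => by
  rw [IncidenceAlgebra.neg_apply, hZ i j h, neg_zero]

theorem Low.mul {d e : ℕ} {Y Z : IncidenceAlgebra A ℕ} (hY : Low d Y) (hZ : Low e Z) :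
    Low (d + e) (Y * Z) := fun i j h => by
  rw [IncidenceAlgebra.mul_apply]
  refine Finset.sum_eq_zero fun k _ => ?_
  by_cases hk : k < i + d
  · rw [hY i k hk, zero_mul]
  · rw [hZ k j (by omega), mul_zero]

theorem Low.mul_left {d : ℕ} {Z : IncidenceAlgebra A ℕ} (hZ : Low d Z)
    (Y : IncidenceAlgebra A ℕ) : Low d (Y * Z) := by
  simpa using (Low.zero Y).mul hZ

theorem Low.mul_right {d : ℕ} {Z : IncidenceAlgebra A ℕ} (hZ : Low d Z)
    (Y : IncidenceAlgebra A ℕ) : Low d (Z * Y) := by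
  simpa using hZ.mul (Low.zero Y)

theorem Strict.low {Y : IncidenceAlgebra A ℕ} (hY : Strict Y) : Low 1 Y := fun i j h => by
  rcases (show j ≤ i by omega).lt_or_eq with hj | rfl
  · exact Y.apply_eq_zero_of_not_le (by omega)
  · exact hY j

theorem eq_of_low_sub {Y Z : IncidenceAlgebra A ℕ} (h : ∀ d, Low d (Y - Z)) : Y = Z := by
  ext i j _
  have := h (j + 1) i j (by omega)
  rwa [IncidenceAlgebra.sub_apply, sub_eq_zero] at this

theorem Low.hat_sub_hat {d : ℕ} {Y Z : IncidenceAlgebra A ℕ} (h : Low d (Y - Z))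
    (f : List A → A) : Low d (hat f Y - hat f Z) := fun i j hij => by
  rw [IncidenceAlgebra.sub_apply, sub_eq_zero, hat_apply, hat_apply]
  refine pathSum_congr fun a b ha _ hb => ?_
  have := h a b (by omega)
  rwa [IncidenceAlgebra.sub_apply, sub_eq_zero] at this

theorem incidenceAlgebra_neg_mul (Y Z : IncidenceAlgebra A ℕ) : -(Y * Z) = -Y * Z := by
  ext i j _
  simp only [IncidenceAlgebra.neg_apply, IncidenceAlgebra.mul_apply, neg_mul,
    Finset.sum_neg_distrib]

theorem mul_one_sub_eq_one {U M : IncidenceAlgebra A ℕ} (hU : Strict U) (h : M = 1 + U * M) :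
    (1 - U) * M = 1 ∧ M * (1 - U) = 1 := by
  have h1 : (1 - U) * M = 1 := by
    rw [sub_mul, one_mul, sub_eq_iff_eq_add]
    exact h
  obtain ⟨u, hu⟩ := isUnit_one_sub hU
  have h2 : M = ↑u⁻¹ := by
    rw [← hu] at h1
    exact (Units.inv_eq_of_mul_eq_one_right h1).symm
  exact ⟨h1, by rw [h2, ← hu, Units.inv_mul]⟩

end Low

section Flow

variable {A : Type*} [Ring A] [Algebra ℂ A] {B : Subalgebra ℂ A}

/-- Uniqueness of the solution of the differential equation `D' = -f(Y D⁻¹) D`, by induction on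
the number of diagonals on which two solutions agree. -/
theorem flow_unique {f : List A → A} (hf0 : f [] = 0) {Y : IncidenceAlgebra A ℕ} (hY : Strict Y)
    {D N D' N' : ℂ → IncidenceAlgebra A ℕ}
    (hND : ∀ s, N s * D s = 1) (hDN' : ∀ s, D' s * N' s = 1)
    (hD : ∀ i j, PolyDeriv (fun s => D s i j) (fun s => (-(hat f (Y * N s) * D s)) i j))
    (hD' : ∀ i j, PolyDeriv (fun s => D' s i j) (fun s => (-(hat f (Y * N' s) * D' s)) i j))
    (h0 : D 0 = D' 0) (s : ℂ) : D s = D' s := by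
  suffices H : ∀ d s, Low d (D s - D' s) from eq_of_low_sub fun d => H d s
  intro d
  induction d with
  | zero => exact fun s => Low.zero _
  | succ d ih =>
    have hN : ∀ s, Low d (N s - N' s) := fun s => by
      have : N s - N' s = -(N s * (D s - D' s) * N' s) := by
        rw [mul_sub, sub_mul, hND, one_mul, mul_assoc, hDN', mul_one, neg_sub]
      rw [this]
      exact (((ih s).mul_left _).mul_right _).neg
    have hR : ∀ s, Low (d + 1) (hat f (Y * N s) * D s - hat f (Y * N' s) * D' s) := fun s => by
      have h1 : Low (1 + d) (Y * N s - Y * N' s) := by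
        rw [← mul_sub]
        exact hY.low.mul (hN s)
      have h2 : hat f (Y * N s) * D s - hat f (Y * N' s) * D' s =
          (hat f (Y * N s) - hat f (Y * N' s)) * D s + hat f (Y * N' s) * (D s - D' s) := by
        rw [sub_mul, mul_sub]
        abel
      rw [h2, add_comm d 1]
      exact ((h1.hat_sub_hat f).mul_right _).add ((strict_hat hf0 _).low.mul (ih s))
    intro s i j hij
    rw [IncidenceAlgebra.sub_apply, sub_eq_zero]
    refine (hD i j).eq_of_deriv (hD' i j) (fun s => ?_) (by rw [h0]) s
    have := hR s i j hij
    rw [IncidenceAlgebra.sub_apply, sub_eq_zero] at this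
    rw [IncidenceAlgebra.neg_apply, IncidenceAlgebra.neg_apply, this]

variable {c d : Finset (Finset ℕ) → ℂ} {f g : List A → A}

theorem hat_ncWord_inv (hc : TreeWeight c) (hf : RightModular B f) (Y : IncidenceAlgebra A ℕ) :
    (1 - hat (irrWord c f) Y) * hat (ncWord c f) Y = 1 ∧
      hat (ncWord c f) Y * (1 - hat (irrWord c f) Y) = 1 :=
  mul_one_sub_eq_one (strict_hat (irrWord_nil c f) Y) (hat_ncWord hc hf Y)

/-- The sums over irreducible partitions are determined by the sums over all partitions. -/
theorem irrWord_eq_of_ncWord_eq (hc : TreeWeight c) (hd : TreeWeight d) (hf : RightModular B f)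
    (hg : RightModular B g) (h : ncWord c f = ncWord d g) : irrWord c f = irrWord d g := by
  funext w
  refine eq_of_hat_superdiag_eq (zeroLetter_irrWord c hf) (zeroLetter_irrWord d hg) (fun x => ?_) w
  have h1 := (hat_ncWord_inv hc hf (superdiag x)).1
  have h2 := (hat_ncWord_inv hd hg (superdiag x)).2
  rw [← h] at h2
  exact sub_right_injective (left_inv_eq_right_inv h1 h2)

theorem treeWeight_treeWeight (t : ℂ) : TreeWeight (treeWeight t) := treeWeight_tree t

theorem irrWord_treeWeight_zero (f : List A → A) (w : List A) : irrWord (treeWeight 0) f w = 0 := by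
  rw [irrWord_congr (d := fun _ => 0)]
  · simp [irrWord, irrSum]
  · intro P V hV
    rw [treeWeight, zero_pow (Finset.card_ne_zero_of_mem hV.1), zero_div]

theorem irrWord_omega_zero (f : List A → A) (w : List A) :
    irrWord (fun P => (omegaPoly P).eval 0) f w = 0 := by
  rw [irrWord_congr (d := fun _ => 0)]
  · simp [irrWord, irrSum]
  · intro P V hV
    exact eval_omegaPoly_zero ⟨V, hV.1⟩

theorem outerWord_treeWeight_zero {f : List A → A} (hf0 : f [] = 0) (w : List A) :
    outerWord (treeWeight 0) f w = f w := by
  rw [outerWord_eq (d := antichainWeight 1), irrWord_antichain hf0, one_smul]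
  intro P V hV
  have hiff : (∀ U ∈ P, ∀ W ∈ P, Nested U W → U = W) ↔ P.erase V = ∅ := by
    rw [Finset.erase_eq_empty_iff]
    constructor
    · exact fun h => Or.inr (Finset.eq_singleton_iff_unique_mem.2
        ⟨hV.1, fun W hW => h W hW V hV.1 (hV.2 W hW).1⟩)
    · rintro (h | h)
      · exact absurd hV.1 (by simp [h])
      · intro U hU W hW _
        rw [h, Finset.mem_singleton] at hU hW
        rw [hU, hW]
  rw [antichainWeight, one_pow]
  by_cases h : P.erase V = ∅
  · rw [if_pos (hiff.2 h), h]
    exact (treeWeight_treeWeight 0).empty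
  · rw [if_neg (mt hiff.1 h), treeWeight, zero_pow (mt Finset.card_eq_zero.1 h), zero_div]

/-- The matrices `1 - I_s`, for the sums `I_s = ∑ s^|π| / τ(π)! h_π` over the irreducible
partitions, form a one-parameter semigroup of compositions. -/
theorem hat_irrWord_tree_comp {h : List A → A} (hh : RightModular B h) (h0 : h [] = 0)
    {Y : IncidenceAlgebra A ℕ} (hY : Strict Y) (s t : ℂ) :
    1 - hat (irrWord (treeWeight s) h) (Y * hat (ncWord (treeWeight t) h) Y) =
      (1 - hat (irrWord (treeWeight (s + t)) h) Y) * hat (ncWord (treeWeight t) h) Y := by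
  set Z := Y * hat (ncWord (treeWeight t) h) Y with hZ
  have hZs : Strict Z := hY.mul _
  have inv := fun s (Y : IncidenceAlgebra A ℕ) => hat_ncWord_inv (treeWeight_treeWeight s) hh Y
  have ode : ∀ s {Y : IncidenceAlgebra A ℕ}, Strict Y →
      hat h (Y * hat (ncWord (treeWeight s) h) Y) * (1 - hat (irrWord (treeWeight s) h) Y) =
        hat (outerWord (treeWeight s) h) Y := fun s Y hY => by
    rw [hat_mul_hat_ncWord (treeWeight_treeWeight s) hh h0 hY, mul_assoc, (inv s Y).2, mul_one]
  have hpoly : ∀ (Y : IncidenceAlgebra A ℕ) i j,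
      PolyDeriv (fun s => (1 - hat (irrWord (treeWeight s) h) Y) i j)
        (fun s => (-hat (outerWord (treeWeight s) h) Y) i j) := fun Y i j => by
    simpa [sub_eq_add_neg] using
      (polyDeriv_const ((1 : IncidenceAlgebra A ℕ) i j)).sub
        (polyDeriv_hat (polyDeriv_irrWord_tree h) Y i j)
  have hZN : ∀ s, Z * ((1 - hat (irrWord (treeWeight t) h) Y) *
      hat (ncWord (treeWeight (s + t)) h) Y) = Y * hat (ncWord (treeWeight (s + t)) h) Y :=
    fun s => by rw [hZ, mul_assoc, ← mul_assoc _ (1 - _), (inv t Y).2, one_mul]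
  refine flow_unique (f := h) h0 hZs
    (D := fun s => 1 - hat (irrWord (treeWeight s) h) Z)
    (N := fun s => hat (ncWord (treeWeight s) h) Z)
    (D' := fun s => (1 - hat (irrWord (treeWeight (s + t)) h) Y) * hat (ncWord (treeWeight t) h) Y)
    (N' := fun s => (1 - hat (irrWord (treeWeight t) h) Y) *
      hat (ncWord (treeWeight (s + t)) h) Y)
    (fun s => (inv s Z).2) (fun s => ?_) (fun i j => ?_) (fun i j => ?_) ?_ s
  · rw [mul_assoc, ← mul_assoc _ (1 - _), (inv t Y).2, one_mul, (inv (s + t) Y).1]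
  · simp only [ode _ hZs]
    exact hpoly Z i j
  · simp only [hZN, ← mul_assoc, ode _ hY]
    simp only [incidenceAlgebra_neg_mul]
    refine PolyDeriv.mul_hat (F := fun s => 1 - hat (irrWord (treeWeight (s + t)) h) Y)
      (F' := fun s => -hat (outerWord (treeWeight (s + t)) h) Y) (fun i j => ?_) _ i j
    have := (hpoly Y i j).comp (Polynomial.X + Polynomial.C t)
    simp only [Polynomial.eval_add, Polynomial.eval_X, Polynomial.eval_C, Polynomial.derivative_add,
      Polynomial.derivative_X, Polynomial.derivative_C, add_zero, Polynomial.eval_one,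
      one_smul] at this
    exact this
  · simp only [zero_add]
    rw [(inv t Y).1, sub_eq_self]
    ext i j _
    rw [funext (irrWord_treeWeight_zero h), hat_apply, pathSum_zero]
    rfl

/-- If `g = ∑ z^|π| / τ(π)! h_π`, then interpolation of the compositional powers of `g` in the
number of factors recovers the one-parameter semigroup of `h`. -/
theorem irrWord_omega_eq {h : List A → A} (hh : RightModular B h) (h0 : h [] = 0)
    (hg : RightModular B g) (z : ℂ) (hgh : irrWord (treeWeight z) h = g) (w : List A) :
    (∀ t : ℂ, irrWord (fun P => (omegaPoly P).eval t) g w = irrWord (treeWeight (z * t)) h w) ∧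
      z • h w = irrWord (fun P => (Polynomial.derivative (omegaPoly P)).eval 0) g w := by
  have g0 : g [] = 0 := by rw [← hgh, irrWord_nil]
  have key : ∀ (k : ℕ) {Y : IncidenceAlgebra A ℕ}, Strict Y →
      hat (irrWord (fun P => (omegaPoly P).eval (k : ℂ)) g) Y =
        hat (irrWord (treeWeight (z * k)) h) Y := by
    intro k
    induction k with
    | zero =>
      intro Y _
      simp only [Nat.cast_zero, mul_zero, funext (irrWord_omega_zero g),
        funext (irrWord_treeWeight_zero h)]
    | succ k ih =>
      intro Y hY
      have hX := hat_ncWord_inv (treeWeight_omega k) hg Y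
      have hI := hat_ncWord_inv (treeWeight_treeWeight (z * k)) hh Y
      rw [ih hY] at hX
      have hM : hat (ncWord (fun P => (omegaPoly P).eval (k : ℂ)) g) Y =
          hat (ncWord (treeWeight (z * k)) h) Y := left_inv_eq_right_inv hX.2 hI.1
      have h1 := hat_mul_hat_ncWord (treeWeight_omega k) hg g0 hY
      have h2 := hat_irrWord_tree_comp hh h0 hY z (z * k)
      rw [funext (outerWord_omega g k), hat_sub, hM, ih hY] at h1
      rw [hgh, h1, sub_eq_iff_eq_add, ← add_mul] at h2
      have h3 := congrArg (· * (1 - hat (irrWord (treeWeight (z * k)) h) Y)) h2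
      simp only [one_mul, mul_assoc, hI.2, mul_one] at h3
      have h4 : z + z * k = z * ((k + 1 : ℕ) : ℂ) := by push_cast; ring
      rw [h4] at h3
      have h5 : ((k : ℂ) + 1) = ((k + 1 : ℕ) : ℂ) := by push_cast; rfl
      rw [h5] at h3
      calc _ = 1 - hat (irrWord (treeWeight (z * ((k + 1 : ℕ) : ℂ))) h) Y +
            (hat (irrWord (fun P => (omegaPoly P).eval ((k + 1 : ℕ) : ℂ)) g) Y -
              hat (irrWord (treeWeight (z * k)) h) Y) -
            (1 - hat (irrWord (treeWeight (z * k)) h) Y) +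
            hat (irrWord (treeWeight (z * ((k + 1 : ℕ) : ℂ))) h) Y := by abel
        _ = _ := by rw [← h3, sub_self, zero_add]
  have hnat : ∀ k : ℕ, irrWord (fun P => (omegaPoly P).eval (k : ℂ)) g w =
      irrWord (treeWeight (z * k)) h w := fun k =>
    eq_of_hat_superdiag_eq (zeroLetter_irrWord _ hg) (zeroLetter_irrWord _ hh)
      (fun x => key k (strict_superdiag x)) w
  have hp1 : PolyDeriv (fun t : ℂ => irrWord (fun P => (omegaPoly P).eval t) g w)
      (fun t => irrWord (fun P => (Polynomial.derivative (omegaPoly P)).eval t) g w) :=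
    polyDeriv_irrWord omegaPoly (fun _ _ _ _ => rfl) (fun _ _ _ _ => rfl) g w
  have hp2 : PolyDeriv (fun t : ℂ => irrWord (treeWeight (z * t)) h w)
      (fun t => z • outerWord (treeWeight (z * t)) h w) := by
    have := (polyDeriv_irrWord_tree h w).comp (Polynomial.C z * Polynomial.X)
    simp only [Polynomial.eval_mul, Polynomial.eval_C, Polynomial.eval_X,
      Polynomial.derivative_C_mul, Polynomial.derivative_X, mul_one] at this
    exact this
  refine ⟨fun t => (hp1.eq_of_nat hp2 hnat t).1, ?_⟩
  have := (hp1.eq_of_nat hp2 hnat 0).2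
  rw [mul_zero, outerWord_treeWeight_zero h0] at this
  exact this.symm

/-- Inversion of `β = ∑ r_π`: any weight that changes sign with the outer block will do. -/
theorem eq_neg_irrWord {r β : List A → A} (hr : RightModular B r) (hr0 : r [] = 0)
    (hβ : RightModular B β) (hβr : irrWord (fun _ => 1) r = β) (hc : TreeWeight c)
    (hcβ : outerWord c β = fun w => - irrWord c β w) (w : List A) : r w = - irrWord c β w := by
  have hβ0 : β [] = 0 := by rw [← hβr, irrWord_nil]
  refine eq_of_hat_superdiag_eq (G := fun w => - irrWord c β w) hr.zeroLetter
    (fun u v => neg_eq_zero.2 (zeroLetter_irrWord c hβ u v)) (fun x => ?_) w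
  set X := superdiag x
  have hX : Strict X := strict_superdiag x
  obtain ⟨i1, i2⟩ := hat_ncWord_inv hc hβ X
  have h1 := hat_mul_hat_ncWord hc hβ hβ0 hX
  set M := hat (ncWord c β) X
  set Y := X * M with hYdef
  have hY : Strict Y := hX.mul _
  rw [hcβ, hat_neg] at h1
  obtain ⟨j1, j2⟩ := hat_ncWord_inv treeWeight_one hr Y
  have h2 := hat_mul_hat_ncWord treeWeight_one hr hr0 hY
  rw [funext (outerWord_one r)] at h2
  rw [hβr, h1] at j1 j2 h2
  -- the substitutions `X ↦ X M` and `Y ↦ Y (1 - β(Y))⁻¹` are inverse to each other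
  have hM : 1 - -hat (irrWord c β) X * M = M := by
    have : M - hat (irrWord c β) X * M = 1 := by rw [← i1, sub_mul, one_mul]
    rw [← incidenceAlgebra_neg_mul, sub_neg_eq_add, ← this]
    abel
  rw [hM] at j1 j2
  rw [hYdef, mul_assoc, j1, mul_one, mul_assoc, j1, mul_one] at h2
  rw [hat_neg]
  exact h2

end Flow

/-! ### Relations between cumulants as functions of words -/

section Relations

variable {A : Type*} [Ring A] [Algebra ℂ A] {B : Subalgebra ℂ A}

theorem RightModular.neg {f : List A → A} (hf : RightModular B f) :
    RightModular B fun w => -f w :=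
  ⟨fun w => B.neg_mem (hf.mem w), fun u v a a' => by rw [hf.add, neg_add],
    fun u v c a => by rw [hf.smul, smul_neg], fun u a b hb => by rw [hf.right u a b hb, neg_mul]⟩

theorem NCFam.val_neg {α : Type*} [LinearOrder α] {P : Finset (Finset α)} (hP : NCFam P)
    {f : List A → A} (hf : RightModular B f) (x : α → A) :
    val (fun _ w => -f w) P x = (-1 : ℂ) ^ P.card • val (fun _ => f) P x := by
  revert x
  induction P, hP using NCFam.induction with
  | empty => intro x; simp
  | single V hV => intro x; simp [blockVal]
  | peel P V l hP hl ih =>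
    intro x
    rw [hl.val_eq, hl.val_eq, ih]
    have h1 : x l * blockVal (fun _ w => -f w) V x =
        (-1 : ℂ) • (x l * blockVal (fun _ => f) V x) := by simp [blockVal]
    rw [h1, (hP.mono (Finset.erase_subset _ _)).val_update_smul (B := B) (fun _ _ => hf) x
      hl.mem_supp_erase, smul_smul, ← pow_succ, Finset.card_erase_add_one hl.1]

/-- The relations between the free, Boolean and monotone cumulants of the same moments. -/
theorem cumulant_relations {r β h : List A → A} (hr : RightModular B r) (hβ : RightModular B β)
    (hh : RightModular B h) (hr0 : r [] = 0) (hβ0 : β [] = 0) (hh0 : h [] = 0)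
    (hrβ : ncWord (fun _ => 1) r = ncWord (antichainWeight 1) β)
    (hhβ : ncWord (treeWeight 1) h = ncWord (antichainWeight 1) β) (w : List A) :
    β w = irrWord (fun _ => 1) r w ∧
    r w = - irrWord (fun P => (-1) ^ P.card) β w ∧
    β w = irrWord (treeWeight 1) h w ∧
    r w = - irrWord (treeWeight (-1)) h w ∧
    h w = irrWord (fun P => (Polynomial.derivative (omegaPoly P)).eval 0) β w ∧
    h w = - irrWord (fun P => (-1) ^ P.card * (Polynomial.derivative (omegaPoly P)).eval 0)
      r w := by
  have e1 : irrWord (fun _ => 1) r = β := by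
    rw [irrWord_eq_of_ncWord_eq treeWeight_one (treeWeight_antichain 1) hr hβ hrβ]
    exact funext fun w => by rw [irrWord_antichain hβ0, one_smul]
  have e3 : irrWord (treeWeight 1) h = β := by
    rw [irrWord_eq_of_ncWord_eq (treeWeight_treeWeight 1) (treeWeight_antichain 1) hh hβ hhβ]
    exact funext fun w => by rw [irrWord_antichain hβ0, one_smul]
  have e5 := irrWord_omega_eq hh hh0 hβ 1 e3
  have e4 : ∀ w, r w = - irrWord (treeWeight (-1)) h w := fun w => by
    rw [eq_neg_irrWord hr hr0 hβ e1 (treeWeight_omega (-1)), (e5 w).1, one_mul]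
    funext w
    rw [outerWord_omega, neg_add_cancel, irrWord_omega_zero, zero_sub]
  have e6 := (irrWord_omega_eq hh hh0 hr.neg (-1) (funext fun w => by rw [e4, neg_neg]) w).2
  refine ⟨by rw [e1], eq_neg_irrWord hr hr0 hβ e1 treeWeight_sign
    (funext (outerWord_sign β)) w, by rw [e3], e4 w, by rw [← (e5 w).2, one_smul], ?_⟩
  rw [neg_one_smul, neg_eq_iff_eq_neg] at e6
  rw [e6, neg_inj, irrWord, irrSum, irrWord, irrSum]
  refine Finset.sum_congr rfl fun P hP => ?_
  rw [(mem_ncFams.1 (mem_irrFams.1 hP).1).1.val_neg hr, smul_smul, mul_comm]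

/-- Boolean cumulants are alternating sums over the interval partitions. -/
theorem boolean_eq_neg_ncWord {m β : List A → A} (hm : RightModular B m) (hβ : RightModular B β)
    (hm0 : m [] = 0) (hβ0 : β [] = 0)
    (h : ∀ w ≠ [], ncWord (antichainWeight 1) β w = m w) {w : List A} (hw : w ≠ []) :
    β w = - ncWord (antichainWeight (-1)) m w := by
  have h1 : ncWord (antichainWeight 1) β = fun w => (if w = [] then (1 : A) else 0) + m w := by
    funext w
    by_cases hw : w = []
    · simp [hw, hm0, ncWord_nil (treeWeight_antichain 1)]
    · rw [h w hw, if_neg hw, zero_add]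
  have h2 : (fun w => (if w = [] then (1 : A) else 0) + - ncWord (antichainWeight (-1)) m w) w =
      β w := by
    refine eq_of_hat_superdiag_eq
      (F := fun w => (if w = [] then (1 : A) else 0) + - ncWord (antichainWeight (-1)) m w)
      ?_ hβ.zeroLetter (fun x => ?_) w
    · intro u v
      simp [zeroLetter_ncWord _ hm u v]
    · have h3 := (hat_ncWord_inv (treeWeight_antichain 1) hβ (superdiag x)).1
      have h4 := (hat_ncWord_inv (treeWeight_antichain (-1)) hm (superdiag x)).1
      have h5 : irrWord (antichainWeight 1) β = β :=
        funext fun w => by rw [irrWord_antichain hβ0, one_smul]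
      have h6 : irrWord (antichainWeight (-1)) m = fun w => - m w :=
        funext fun w => by rw [irrWord_antichain hm0, neg_one_smul]
      rw [h1, h5, hat_add, hat_unit] at h3
      rw [h6, hat_neg, sub_neg_eq_add] at h4
      rw [hat_add, hat_unit, hat_neg, ← left_inv_eq_right_inv h3 h4]
      abel
  rw [← h2]
  simp [hw]

end Relations

section RecursiveModular

variable {A : Type*} [Ring A] [Algebra ℂ A] {B : Subalgebra ℂ A}

theorem letters_append {A : Type*} [Ring A] (u v : List A) (a : A) :
    letters (u ++ a :: v) = Function.update (letters (u ++ 0 :: v)) u.length a := by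
  funext m
  by_cases hm : m = u.length
  · subst hm
    simp [letters]
  · rw [Function.update_of_ne hm]
    simp only [letters, List.getD_eq_getElem?_getD]
    rcases lt_or_gt_of_ne hm with h | h
    · rw [List.getElem?_append_left h, List.getElem?_append_left h]
    · obtain ⟨d, rfl⟩ := Nat.exists_eq_add_of_lt h
      rw [List.getElem?_append_right (by omega), List.getElem?_append_right (by omega)]
      simp [show u.length + d + 1 - u.length = d + 1 by omega]

/-- Linear combinations of the maps `f_π` over partitions of the letters of a word. -/
theorem rightModular_sum_val {f : List A → A} (hf : RightModular B f)
    (S : ℕ → Finset (Finset (Finset ℕ))) (hS : ∀ n, S n ⊆ ncFams (Finset.Ico 0 n))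
    (c : Finset (Finset ℕ) → ℂ) :
    RightModular B fun w => ∑ P ∈ S w.length, c P • val (fun _ => f) P (letters w) := by
  have hP : ∀ {n P}, P ∈ S n → NCFam P ∧ supp P = Finset.Ico 0 n := fun h => mem_ncFams.1 (hS _ h)
  have hlen : ∀ (u v : List A) a, (u ++ a :: v).length = u.length + v.length + 1 := fun u v a => by
    simp; omega
  have hmem : ∀ {u v : List A} {P}, P ∈ S (u.length + v.length + 1) → u.length ∈ supp P :=
    fun h => by rw [(hP h).2]; simp
  refine ⟨fun w => B.sum_mem fun P h => B.smul_mem ((hP h).1.val_mem (fun _ _ => hf) _) _,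
    fun u v a a' => ?_, fun u v d a => ?_, fun u a b hb => ?_⟩
  · simp only [hlen, ← Finset.sum_add_distrib]
    refine Finset.sum_congr rfl fun P h => ?_
    rw [letters_append u v (a + a'), (hP h).1.val_update_add (fun _ _ => hf) _ (hmem h),
      ← letters_append, ← letters_append, smul_add]
  · simp only [hlen, Finset.smul_sum]
    refine Finset.sum_congr rfl fun P h => ?_
    rw [letters_append u v (d • a), (hP h).1.val_update_smul (fun _ _ => hf) _ (hmem h),
      ← letters_append, smul_comm]
  · simp only [hlen, Finset.sum_mul]
    refine Finset.sum_congr rfl fun P h => ?_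
    have hl : letters (u ++ [a]) u.length = a := by simp [letters]
    have := (hP h).1.val_update_mul_max (fun _ _ => hf) (letters (u ++ [a])) (hmem h)
      (fun i hi => by
        rw [(hP h).2, Finset.mem_Ico] at hi
        simp at hi
        omega) hb
    rw [hl, letters_append u [] a, Function.update_idem, ← letters_append, ← letters_append] at this
    rw [this, smul_mul_assoc]

theorem RightModular.sub {f g : List A → A} (hf : RightModular B f) (hg : RightModular B g) :
    RightModular B fun w => f w - g w :=
  ⟨fun w => B.sub_mem (hf.mem w) (hg.mem w),
    fun u v a a' => by rw [hf.add, hg.add]; abel,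
    fun u v c a => by rw [hf.smul, hg.smul, smul_sub],
    fun u a b hb => by rw [hf.right u a b hb, hg.right u a b hb, sub_mul]⟩

open Classical in
theorem RightModular.ite {f : List A → A} (hf : RightModular B f) (p : ℕ → Prop) :
    RightModular B fun w => if p w.length then f w else 0 := by
  refine ⟨fun w => ?_, fun u v a a' => ?_, fun u v c a => ?_, fun u a b hb => ?_⟩
  · split_ifs
    exacts [hf.mem w, B.zero_mem]
  · simp only [List.length_append, List.length_cons]
    split_ifs
    exacts [hf.add u v a a', (add_zero 0).symm]
  · simp only [List.length_append, List.length_cons]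
    split_ifs
    exacts [hf.smul u v c a, (smul_zero c).symm]
  · simp only [List.length_append, List.length_cons]
    split_ifs
    exacts [hf.right u a b hb, (zero_mul b).symm]

/-- A block of a partition of `n` points with at least two blocks has fewer than `n` points. -/
theorem card_lt_of_mem_ncFams {n : ℕ} {P : Finset (Finset ℕ)}
    (hP : P ∈ ncFams (Finset.Ico 0 n)) (hne : P ≠ {Finset.Ico 0 n}) {V : Finset ℕ} (hV : V ∈ P) :
    V.card < n := by
  obtain ⟨hP, hs⟩ := mem_ncFams.1 hP
  have hsub : V ⊆ Finset.Ico 0 n := hs ▸ subset_supp hV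
  have hle := Finset.card_le_card hsub
  rw [Nat.card_Ico, Nat.sub_zero] at hle
  refine lt_of_le_of_ne hle fun h => hne ?_
  have hV' : V = Finset.Ico 0 n := Finset.eq_of_subset_of_card_le hsub (by simp [h])
  subst hV'
  refine Finset.eq_singleton_iff_unique_mem.2 ⟨hV, fun W hW => ?_⟩
  obtain ⟨i, hi⟩ := hP.nonempty W hW
  exact hP.eq_of_mem hW hV hi (hs ▸ subset_supp hW hi)

theorem singleton_mem_ncFams {n : ℕ} (hn : 0 < n) :
    ({Finset.Ico 0 n} : Finset (Finset ℕ)) ∈ ncFams (Finset.Ico 0 n) := by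
  refine mem_ncFams.2 ⟨⟨by simpa using hn.ne', ?_, ?_⟩, by simp⟩
  all_goals
    intro V hV W hW hne
    exact absurd ((Finset.mem_singleton.1 hV).trans (Finset.mem_singleton.1 hW).symm) hne

theorem val_singleton_letters {A : Type*} [Ring A] (F : Finset ℕ → List A → A) (w : List A) :
    val F {Finset.Ico 0 w.length} (letters w) = F (Finset.Ico 0 w.length) w := by
  rw [val_singleton, blockVal]
  congr 1
  rw [← Finset.range_eq_Ico, Finset.sort_range]
  refine List.ext_getElem (by simp) fun m h1 h2 => ?_
  simp [letters, h2]

theorem ncWord_eq_add {f : List A → A} {c : Finset (Finset ℕ) → ℂ} {w : List A} (hw : w ≠ []) :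
    ncWord c f w = c {Finset.Ico 0 w.length} • f w +
      ∑ P ∈ (ncFams (Finset.Ico 0 w.length)).erase {Finset.Ico 0 w.length},
        c P • val (fun _ => f) P (letters w) := by
  rw [ncWord, ncSum, ← Finset.add_sum_erase _ _
    (singleton_mem_ncFams (List.length_pos_iff.2 hw)), val_singleton_letters]

/-- Functions of words defined recursively from their moments inherit multilinearity and right
`B`-linearity. -/
theorem rightModular_of_ncWord {m f : List A → A} (hm : RightModular B m) (hf0 : f [] = 0)
    {c : Finset (Finset ℕ) → ℂ} (hc : ∀ n, c {Finset.Ico 0 n} = 1)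
    (h : ∀ w ≠ [], ncWord c f w = m w) : RightModular B f := by
  classical
  have key : ∀ n, RightModular B fun w => if w.length < n then f w else 0 := by
    intro n
    induction n with
    | zero =>
      simp only [Nat.not_lt_zero, if_false]
      exact ⟨fun _ => B.zero_mem, fun _ _ _ _ => (add_zero 0).symm,
        fun _ _ _ _ => (smul_zero _).symm, fun _ _ _ _ => (zero_mul _).symm⟩
    | succ n ih =>
      have h1 := ((hm.sub (rightModular_sum_val ih
        (fun k => (ncFams (Finset.Ico 0 k)).erase {Finset.Ico 0 k})
        (fun k => Finset.erase_subset _ _) c)).ite (fun k => k < n + 1)).ite (fun k => k ≠ 0)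
      convert h1 using 2 with w
      by_cases hw : w = []
      · simp [hw, hf0]
      rw [if_pos (mt List.length_eq_zero_iff.1 hw)]
      split_ifs with hlen
      · rw [← h w hw, ncWord_eq_add hw, hc, one_smul, eq_sub_iff_add_eq, add_right_inj]
        refine Finset.sum_congr rfl fun P hP => ?_
        obtain ⟨hne, hP⟩ := Finset.mem_erase.1 hP
        congr 1
        refine (mem_ncFams.1 hP).1.val_congr (fun V hV z => ?_) fun _ _ => rfl
        have := card_lt_of_mem_ncFams hP hne hV
        rw [blockVal, blockVal, if_pos]
        rw [List.length_map, Finset.length_sort]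
        omega
      · rfl
  refine ⟨fun w => ?_, fun u v a a' => ?_, fun u v d a => ?_, fun u a b hb => ?_⟩
  · simpa using (key (w.length + 1)).mem w
  · have := (key ((u ++ a :: v).length + 1)).add u v a a'
    simpa using this
  · have := (key ((u ++ a :: v).length + 1)).smul u v d a
    simpa using this
  · have := (key ((u ++ [a]).length + 1)).right u a b hb
    simpa using this

end RecursiveModular

/-! ### Derivatives of nested evaluations -/

section Derivative

variable {α : Type*} [LinearOrder α] {A : Type*} [Ring A] [Algebra ℂ A] {B : Subalgebra ℂ A}

/-- The sum over the blocks `V` of `P` of the nested evaluations by `f`, with `g` in place of `f`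
on `V`. -/
noncomputable def dval (f g : List A → A) (P : Finset (Finset α)) (x : α → A) : A :=
  ∑ V ∈ P, val (fun W => if W = V then g else f) P x

theorem dval_singleton {A : Type*} [Ring A] (f g : List A → A) (V : Finset α) (x : α → A) :
    dval f g {V} x = g (V.sort.map x) := by
  simp [dval, blockVal]

theorem NCFam.dval_congr {A : Type*} [Ring A] {P : Finset (Finset α)} (hP : NCFam P)
    {f g g' : List A → A} (x : α → A)
    (h : ∀ V ∈ P, ∀ w : List A, w.length = V.card → g w = g' w) : dval f g P x = dval f g' P x := by
  refine Finset.sum_congr rfl fun V _ => hP.val_congr (fun W hW z => ?_) fun _ _ => rfl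
  rw [blockVal, blockVal]
  split_ifs
  · exact h W hW _ (by simp)
  · rfl

theorem IsLast.dval_eq {A : Type*} [Ring A] {P : Finset (Finset α)} (hP : NCFam P) {V : Finset α}
    {l : α}
    (hl : IsLast P V l) (f g : List A → A) (x : α → A) :
    dval f g P x =
      dval f g (P.erase V) (Function.update x l (x l * blockVal (fun _ => f) V x)) +
      val (fun _ => f) (P.erase V) (Function.update x l (x l * blockVal (fun _ => g) V x)) := by
  rw [dval, ← Finset.sum_erase_add _ _ hl.1, dval]
  congr 1
  · refine Finset.sum_congr rfl fun U hU => ?_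
    rw [hl.val_eq]
    simp only [blockVal, if_neg (Finset.ne_of_mem_erase hU).symm]
  · rw [hl.val_eq]
    simp only [blockVal, if_true]
    refine (hP.mono (Finset.erase_subset _ _)).val_congr (fun W hW z => ?_) fun _ _ => rfl
    simp only [blockVal, if_neg (Finset.ne_of_mem_erase hW)]

/-- The Leibniz rule for nested evaluations. -/
theorem NCFam.polyDeriv_val {P : Finset (Finset α)} (hP : NCFam P) {f f' : ℂ → List A → A}
    (hf : ∀ s, RightModular B (f s)) (hf' : ∀ s, RightModular B (f' s))
    (h : ∀ w, PolyDeriv (fun s => f s w) (fun s => f' s w)) (x : α → A) :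
    PolyDeriv (fun s => val (fun _ => f s) P x) (fun s => dval (f s) (f' s) P x) := by
  revert x
  induction P, hP using NCFam.induction with
  | empty => intro x; simpa [dval] using polyDeriv_const (1 : A)
  | single V hV =>
    intro x
    simp only [val_singleton, dval_singleton]
    exact h _
  | peel P V l hP hl ih =>
    intro x
    have hP' := hP.mono (Finset.erase_subset V P)
    have hls := hl.mem_supp_erase
    simp only [hl.dval_eq hP, hl.val_eq]
    have hm : ∀ s (U : Finset α), ∀ W ∈ P.erase V,
        RightModular B ((fun W => if W = U then f' s else f s) W) := fun s U W _ => by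
      dsimp only
      split_ifs
      exacts [hf' s, hf s]
    have hslot := PolyDeriv.apply (L := fun s => hP'.slot (fun _ _ => hf s) x hls)
      (L' := fun s => ∑ U ∈ P.erase V, hP'.slot (hm s U) x hls)
      (fun a => by simpa [NCFam.slot, dval] using ih (Function.update x l a))
      ((h (V.sort.map x)).map (LinearMap.mulLeft ℂ (x l)))
    simpa [NCFam.slot, dval, blockVal] using hslot

/-- Derivatives of functions of words inherit multilinearity and right `B`-linearity. -/
theorem rightModular_of_polyDeriv {f f' : ℂ → List A → A} (hf : ∀ s, RightModular B (f s))
    (h : ∀ w, PolyDeriv (fun s => f s w) (fun s => f' s w)) (s : ℂ) : RightModular B (f' s) := by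
  refine ⟨fun w => ?_, fun u v a a' => ?_, fun u v c a => ?_, fun u a b hb => ?_⟩
  · have h1 := ((h w).map (Submodule.mkQ (Subalgebra.toSubmodule B))).eq_zero_of_nat fun k => by
      rw [Submodule.mkQ_apply, Submodule.Quotient.mk_eq_zero]
      exact (hf k).mem w
    have h2 := (h1 s).2
    rwa [Submodule.mkQ_apply, Submodule.Quotient.mk_eq_zero] at h2
  · exact ((h _).eq_of_nat ((h _).add (h _)) (fun k => (hf k).add u v a a') s).2
  · exact ((h _).eq_of_nat ((h _).const_smul c) (fun k => (hf k).smul u v c a) s).2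
  · exact ((h _).eq_of_nat ((h _).map (LinearMap.mulRight ℂ b))
      (fun k => (hf k).right u a b hb) s).2

theorem dval_singleton_letters {A : Type*} [Ring A] (f g : List A → A) (w : List A) :
    dval f g {Finset.Ico 0 w.length} (letters w) = g w := by
  rw [dval, Finset.sum_singleton, val_singleton_letters, if_pos rfl]

/-- A sequence of maps is determined by the sums of its derivations over all partitions. -/
theorem eq_of_sum_dval_eq {f g g' : List A → A} (h0 : g [] = g' []) {c : Finset (Finset ℕ) → ℂ}
    (hc : ∀ n, c {Finset.Ico 0 n} = 1)
    (h : ∀ w ≠ [], ∑ P ∈ ncFams (Finset.Ico 0 w.length), c P • dval f g P (letters w) =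
      ∑ P ∈ ncFams (Finset.Ico 0 w.length), c P • dval f g' P (letters w)) (w : List A) :
    g w = g' w := by
  induction hn : w.length using Nat.strong_induction_on generalizing w with
  | _ n ih =>
  rcases eq_or_ne w [] with rfl | hw
  · exact h0
  have h1 := h w hw
  have hs := singleton_mem_ncFams (List.length_pos_iff.2 hw)
  rw [← Finset.add_sum_erase _ _ hs, ← Finset.add_sum_erase _ _ hs, hc, one_smul, one_smul,
    dval_singleton_letters, dval_singleton_letters] at h1
  have h2 : ∑ P ∈ (ncFams (Finset.Ico 0 w.length)).erase {Finset.Ico 0 w.length},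
      c P • dval f g P (letters w) =
      ∑ P ∈ (ncFams (Finset.Ico 0 w.length)).erase {Finset.Ico 0 w.length},
      c P • dval f g' P (letters w) := by
    refine Finset.sum_congr rfl fun P hP => ?_
    obtain ⟨hne, hP⟩ := Finset.mem_erase.1 hP
    rw [(mem_ncFams.1 hP).1.dval_congr _ fun V hV v hv => ih v.length ?_ v rfl]
    rw [hv, ← hn]
    exact card_lt_of_mem_ncFams hP hne hV
  rw [h2] at h1
  exact add_right_cancel h1

end Derivative

/-! ### Summation over refinements -/

section Refinement

variable {α : Type*} [LinearOrder α] {A : Type*} [Ring A] [Algebra ℂ A] {B : Subalgebra ℂ A}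

theorem map_valOrderEmb_univ (n : ℕ) :
    (Finset.univ : Finset (Fin n)).map (Fin.valOrderEmb n).toEmbedding = Finset.Ico 0 n := by
  ext m
  simp only [Finset.mem_map, Finset.mem_univ, true_and, RelEmbedding.coe_toEmbedding,
    Fin.valOrderEmb_apply, Finset.mem_Ico, Nat.zero_le]
  constructor
  · rintro ⟨a, rfl⟩
    exact a.2
  · exact fun h => ⟨⟨m, h⟩, rfl⟩

/-- Sums over the partitions of a set of points are sums over the partitions of the positions in
the word read off along this set. -/
theorem sum_ncFams_eq_ncWord (f : List A → A) (S : Finset α) (x : α → A) :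
    ∑ P ∈ ncFams S, val (fun _ => f) P x = ncWord (fun _ => 1) f (S.sort.map x) := by
  have h1 : (Finset.univ : Finset (Fin S.card)).map (S.orderEmbOfFin rfl).toEmbedding = S := by
    ext i
    rw [← Finset.mem_coe, Finset.coe_map]
    simp
  have hlen : (S.sort.map x).length = S.card := by simp
  conv_lhs => rw [← h1]
  rw [ncWord, ncSum, hlen, sum_ncFams_map, ← map_valOrderEmb_univ, sum_ncFams_map]
  refine Finset.sum_congr rfl fun P hP => ?_
  have hP := (mem_ncFams.1 hP).1
  rw [one_smul, val_mapFam_const _ _ hP, val_mapFam_const _ _ hP]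
  congr 1
  funext i
  have hi : i.1 < (S.sort.map x).length := hlen.symm ▸ i.2
  simp only [Function.comp_apply, Fin.valOrderEmb_apply, letters]
  rw [List.getD_eq_getElem _ _ hi, List.getElem_map]
  rfl

open Classical in
/-- Multiplicative extensions of the moments are sums over refinements. -/
theorem NCFam.val_eq_sum_refinements {P : Finset (Finset α)} (hP : NCFam P) {m r : List A → A}
    (hr : RightModular B r) (h : ∀ w ≠ [], ncWord (fun _ => 1) r w = m w) (x : α → A) :
    val (fun _ => m) P x =
      ∑ Q ∈ (ncFams (supp P)).filter (fun Q => ∀ U ∈ Q, ∃ V ∈ P, U ⊆ V),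
        val (fun _ => r) Q x := by
  have hblock : ∀ V : Finset α, V.Nonempty → ∀ x : α → A,
      blockVal (fun _ => m) V x = ∑ Q ∈ ncFams V, val (fun _ => r) Q x := fun V hV x => by
    rw [sum_ncFams_eq_ncWord, h, blockVal]
    rw [ne_eq, ← List.length_eq_zero_iff, List.length_map, Finset.length_sort,
      Finset.card_eq_zero]
    exact hV.ne_empty
  revert x
  induction P, hP using NCFam.induction with
  | empty =>
    intro x
    rw [supp_empty, ncFams_empty, Finset.filter_true_of_mem (by simp), Finset.sum_singleton]
    simp
  | single V hV =>
    intro x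
    rw [val_singleton, hblock V (hV.nonempty V (by simp)), supp_singleton,
      Finset.filter_true_of_mem]
    exact fun Q hQ U hU => ⟨V, Finset.mem_singleton_self V, (mem_ncFams.1 hQ).2 ▸ subset_supp hU⟩
  | peel P V l hP hl ih =>
    intro x
    have hP' := hP.mono (Finset.erase_subset V P)
    have hls := hl.mem_supp_erase
    set R := supp (P.erase V) with hR
    have hsupp : supp P = V ∪ R := by
      rw [hR, ← supp_singleton (V := V), ← supp_union, supp_singleton, ← Finset.insert_eq,
        Finset.insert_erase hl.1]
    have hd : Disjoint V R :=
      Finset.disjoint_left.2 fun i hi => hP.notMem_supp_erase hl.1 hi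
    have hsplit := sum_ncFams_union hd
      (fun a ha b hb c hc hac hcb => hl.convex hP ha hb hc hac hcb)
      (fun Q => if ∀ U ∈ Q, U ⊆ R → ∃ W ∈ P.erase V, U ⊆ W then val (fun _ => r) Q x else 0)
    have hlhs : ∑ Q ∈ (ncFams (supp P)).filter (fun Q => ∀ U ∈ Q, ∃ V ∈ P, U ⊆ V),
        val (fun _ => r) Q x = ∑ Q ∈ (ncFams (V ∪ R)).filter (fun Q => ∀ U ∈ Q, U ⊆ V ∨ U ⊆ R),
          if ∀ U ∈ Q, U ⊆ R → ∃ W ∈ P.erase V, U ⊆ W then val (fun _ => r) Q x else 0 := by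
      rw [← Finset.sum_filter, Finset.filter_filter, hsupp]
      refine Finset.sum_congr (Finset.filter_congr fun Q hQ => ?_) fun _ _ => rfl
      constructor
      · refine fun hQP => ⟨fun U hU => ?_, fun U hU hUR => ?_⟩
        · obtain ⟨W, hW, hUW⟩ := hQP U hU
          by_cases hWV : W = V
          · exact Or.inl (hWV ▸ hUW)
          · exact Or.inr (hUW.trans (subset_supp (Finset.mem_erase.2 ⟨hWV, hW⟩)))
        · obtain ⟨W, hW, hUW⟩ := hQP U hU
          refine ⟨W, Finset.mem_erase.2 ⟨?_, hW⟩, hUW⟩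
          rintro rfl
          obtain ⟨i, hi⟩ := (mem_ncFams.1 hQ).1.nonempty U hU
          exact Finset.disjoint_left.1 hd (hUW hi) (hUR hi)
      · rintro ⟨h1, h2⟩ U hU
        rcases h1 U hU with h3 | h3
        · exact ⟨V, hl.1, h3⟩
        · obtain ⟨W, hW, hUW⟩ := h2 U hU h3
          exact ⟨W, Finset.mem_of_mem_erase hW, hUW⟩
    rw [hlhs, hsplit, Finset.sum_comm, hl.val_eq, ih, Finset.sum_filter]
    refine Finset.sum_congr rfl fun Q₂ hQ₂ => ?_
    obtain ⟨hn₂, hs₂⟩ := mem_ncFams.1 hQ₂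
    -- the refinement condition only concerns the part `Q₂` outside `V`
    have hcond : ∀ Q₁ ∈ ncFams V,
        ((∀ U ∈ Q₁ ∪ Q₂, U ⊆ R → ∃ W ∈ P.erase V, U ⊆ W) ↔
          ∀ U ∈ Q₂, ∃ W ∈ P.erase V, U ⊆ W) := by
      intro Q₁ hQ₁
      obtain ⟨hn₁, hs₁⟩ := mem_ncFams.1 hQ₁
      constructor
      · exact fun h U hU => h U (Finset.mem_union_right _ hU) (hs₂ ▸ subset_supp hU)
      · intro h U hU hUR
        rcases Finset.mem_union.1 hU with hU | hU
        · obtain ⟨i, hi⟩ := hn₁.nonempty U hU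
          exact absurd (hUR hi) (Finset.disjoint_left.1 hd (hs₁ ▸ subset_supp hU hi))
        · exact h U hU
    rw [Finset.sum_congr rfl fun Q₁ hQ₁ => if_congr (hcond Q₁ hQ₁) rfl rfl]
    split_ifs
    · have hl₂ : l ∈ supp Q₂ := hs₂ ▸ hls
      have hslot : ∀ a, val (fun _ => r) Q₂ (Function.update x l a) =
        hn₂.slot (B := B) (fun _ _ => hr) x hl₂ a := fun a => rfl
      rw [hblock V (hP.nonempty V hl.1), hslot, Finset.mul_sum, map_sum]
      refine Finset.sum_congr rfl fun Q₁ hQ₁ => ?_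
      obtain ⟨hn₁, hs₁⟩ := mem_ncFams.1 hQ₁
      rw [← hslot, Finset.union_comm, val_union_eq (B := B) ?_ ?_ (fun _ _ => hr) x hl₂]
      · rw [hs₁]
        exact fun q hq => hl.lt hq
      · rw [hs₁, hs₂]
        intro s hs
        by_contra! hcon
        obtain ⟨hls', q, hq, hsq⟩ := hcon
        have hsV : ∃ v ∈ V, ¬ s < v := by
          by_contra! hall
          exact absurd (hl.le hs hall) (not_le.2 hls')
        obtain ⟨v, hv, hvs⟩ := hsV
        have hne : ∀ u ∈ V, s ≠ u := fun u hu h => Finset.disjoint_left.1 hd hu (h ▸ hs)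
        exact hl.convex hP hv hq hs (lt_of_le_of_ne (not_lt.1 hvs) (hne v hv).symm)
          (lt_of_le_of_ne hsq (hne q hq))
      · rw [Finset.union_comm]
        refine hn₁.union hn₂ (hs₁.symm ▸ hs₂.symm ▸ hd) ?_
        rw [hs₁, hs₂]
        exact fun a ha b hb c hc hac hcb => hl.convex hP ha hb hc hac hcb
      · refine Finset.disjoint_left.2 fun U hU hU' => ?_
        obtain ⟨i, hi⟩ := hn₁.nonempty U hU'
        exact Finset.disjoint_left.1 hd (hs₁ ▸ subset_supp hU' hi) (hs₂ ▸ subset_supp hU hi)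
    · simp

end Refinement

/-! ### Non-crossing partitions of a chain as families of blocks -/

section Translation

variable {n : ℕ}

theorem ncFam_blocks (π : NC n) : NCFam (blocks π) :=
  ⟨fun _ hV => π.1.nonempty_of_mem_parts hV,
    fun _ hV _ hW hne => π.1.disjoint hV hW hne, π.2⟩

theorem supp_blocks (π : NC n) : supp (blocks π) = Finset.univ := by
  rw [supp, ← Finset.sup_eq_biUnion]
  exact π.1.sup_parts

theorem blocks_injective : Function.Injective (blocks : NC n → Finset (Finset (Fin n))) :=
  fun _ _ h => Subtype.ext (Finpartition.ext h)

theorem exists_blocks_eq {P : Finset (Finset (Fin n))} (hP : NCFam P)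
    (hs : supp P = Finset.univ) : ∃ π : NC n, blocks π = P :=
  ⟨⟨⟨P, Finset.supIndep_iff_pairwiseDisjoint.2 fun V hV W hW hne => hP.disjoint V hV W hW hne,
    by rw [Finset.sup_eq_biUnion]; exact hs, fun h => (hP.nonempty _ h).ne_empty rfl⟩,
    hP.noncrossing⟩, rfl⟩

/-- The blocks of a non-crossing partition of `Fin n` as subsets of `ℕ`. -/
def natFam (π : NC n) : Finset (Finset ℕ) := mapFam (Fin.valOrderEmb n) (blocks π)

theorem natFam_mem_ncFams (π : NC n) : natFam π ∈ ncFams (Finset.Ico 0 n) :=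
  mem_ncFams.2 ⟨ncFam_mapFam_iff.2 (ncFam_blocks π), by
    rw [natFam, supp_mapFam, supp_blocks, map_valOrderEmb_univ]⟩

theorem natFam_injective : Function.Injective (natFam : NC n → Finset (Finset ℕ)) :=
  (mapFam_injective _).comp blocks_injective

theorem exists_natFam_eq {P : Finset (Finset ℕ)} (hP : P ∈ ncFams (Finset.Ico 0 n)) :
    ∃ π : NC n, natFam π = P := by
  rw [← map_valOrderEmb_univ, ncFams_map, Finset.mem_map] at hP
  obtain ⟨Q, hQ, rfl⟩ := hP
  obtain ⟨hQ, hs⟩ := mem_ncFams.1 hQ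
  obtain ⟨π, rfl⟩ := exists_blocks_eq hQ hs
  exact ⟨π, rfl⟩

theorem sum_filter_NC {M : Type*} [AddCommMonoid M] {p : NC n → Prop} [DecidablePred p]
    {q : Finset (Finset ℕ) → Prop} [DecidablePred q] (h : ∀ π, p π ↔ q (natFam π))
    (g : Finset (Finset ℕ) → M) :
    ∑ π ∈ (Finset.univ : Finset (NC n)).filter p, g (natFam π) =
      ∑ P ∈ (ncFams (Finset.Ico 0 n)).filter q, g P := by
  refine Finset.sum_bij (fun π _ => natFam π) ?_ (fun π _ σ _ h => natFam_injective h) ?_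
    fun _ _ => rfl
  · intro π hπ
    exact Finset.mem_filter.2 ⟨natFam_mem_ncFams π, (h π).1 (Finset.mem_filter.1 hπ).2⟩
  · intro P hP
    obtain ⟨hP, hq⟩ := Finset.mem_filter.1 hP
    obtain ⟨π, rfl⟩ := exists_natFam_eq hP
    exact ⟨π, Finset.mem_filter.2 ⟨Finset.mem_univ π, (h π).2 hq⟩, rfl⟩

theorem sum_NC {M : Type*} [AddCommMonoid M] (g : Finset (Finset ℕ) → M) :
    ∑ π : NC n, g (natFam π) = ∑ P ∈ ncFams (Finset.Ico 0 n), g P := by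
  have := sum_filter_NC (n := n) (p := fun _ => True) (q := fun _ => True) (fun _ => Iff.rfl) g
  simpa using this

theorem mem_natFam {π : NC n} {W : Finset ℕ} :
    W ∈ natFam π ↔ ∃ V ∈ blocks π, V.map (Fin.valOrderEmb n).toEmbedding = W := mem_mapFam

theorem isIrreducible_iff (hn : 1 ≤ n) (π : NC n) :
    IsIrreducible π ↔ ∃ V ∈ natFam π, 0 ∈ V ∧ ∃ m ∈ V, m + 1 = n := by
  constructor
  · rintro ⟨V, hV, h⟩
    refine ⟨_, mem_natFam.2 ⟨V, hV, rfl⟩, Finset.mem_map.2 ⟨⟨0, hn⟩, h _ (Or.inl rfl), rfl⟩,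
      n - 1, Finset.mem_map.2 ⟨⟨n - 1, by omega⟩, h _ (Or.inr ?_), rfl⟩, by omega⟩
    simp only
    omega
  · rintro ⟨W, hW, h0, m, hm, hmn⟩
    obtain ⟨V, hV, rfl⟩ := mem_natFam.1 hW
    obtain ⟨i, hi, hi0⟩ := Finset.mem_map.1 h0
    obtain ⟨k, hk, hkm⟩ := Finset.mem_map.1 hm
    simp only [RelEmbedding.coe_toEmbedding, Fin.valOrderEmb_apply] at hi0 hkm
    refine ⟨V, hV, ?_⟩
    rintro j (hj | hj)
    · rwa [show j = i from Fin.ext (by omega)]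
    · rwa [show j = k from Fin.ext (by omega)]

theorem sum_irrNC {M : Type*} [AddCommMonoid M] (hn : 1 ≤ n) (g : Finset (Finset ℕ) → M) :
    ∑ π ∈ irrNC n, g (natFam π) = ∑ P ∈ irrFams 0 n, g P := by
  classical
  rw [irrNC, irrFams]
  exact sum_filter_NC (isIrreducible_iff hn) g

/-- Interval partitions are the non-crossing partitions without nesting. -/
theorem isInterval_iff (π : NC n) :
    IsInterval π ↔ ∀ V ∈ natFam π, ∀ W ∈ natFam π, Nested V W → V = W := by
  have hP := ncFam_blocks π
  have h1 : (∀ V ∈ natFam π, ∀ W ∈ natFam π, Nested V W → V = W) ↔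
      ∀ V ∈ blocks π, ∀ W ∈ blocks π, Nested V W → V = W := by
    constructor
    · intro h V hV W hW hn
      exact (map_inj_iff _).1 (h _ (mem_natFam.2 ⟨V, hV, rfl⟩) _ (mem_natFam.2 ⟨W, hW, rfl⟩)
        ((nested_map_iff _).2 hn))
    · intro h V hV W hW hn
      obtain ⟨V, hV', rfl⟩ := mem_natFam.1 hV
      obtain ⟨W, hW', rfl⟩ := mem_natFam.1 hW
      rw [h V hV' W hW' ((nested_map_iff _).1 hn)]
  rw [h1]
  constructor
  · intro h V hV W hW hn
    obtain ⟨v, hv⟩ := hP.nonempty V hV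
    obtain ⟨⟨i, hi, hiv⟩, k, hk, hvk⟩ := hn v hv
    exact hP.eq_of_mem hV hW hv (h W hW i hi k hk v hiv hvk)
  · intro h V hV i hi k hk j hij hjk
    obtain ⟨W, hW, hj⟩ := mem_supp.1 (supp_blocks π ▸ Finset.mem_univ j)
    by_cases hWV : W = V
    · exact hWV ▸ hj
    refine absurd (h W hW V hV fun w hw => ⟨?_, ?_⟩) hWV
    all_goals
      have hne : ∀ u ∈ V, ∀ v ∈ W, u ≠ v := fun u hu v hv huv =>
        hWV (hP.eq_of_mem hW hV (huv ▸ hv) hu)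
      have h1 := lt_of_le_of_ne hij (hne i hi j hj)
      have h2 := lt_of_le_of_ne hjk (hne k hk j hj).symm
      by_contra! hcon
    · exact hP.noncrossing W hW V hV hWV ⟨w, i, j, k, hcon i hi, h1, h2, hw, hj, hi, hk⟩
    · exact hP.noncrossing V hV W hW (Ne.symm hWV) ⟨i, j, k, w, h1, h2, hcon k hk, hi, hk, hj, hw⟩

theorem sum_intervalNC {M : Type*} [AddCommGroup M] [Module ℂ M] (z : ℂ)
    (g : Finset (Finset ℕ) → M) :
    ∑ π ∈ intervalNC n, z ^ size π • g (natFam π) =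
      ∑ P ∈ ncFams (Finset.Ico 0 n), antichainWeight z P • g P := by
  classical
  have : ∀ π : NC n, size π = (natFam π).card := fun π => (card_mapFam _ _).symm
  simp only [this]
  rw [intervalNC, sum_filter_NC (q := fun P => ∀ V ∈ P, ∀ W ∈ P, Nested V W → V = W) isInterval_iff
    (fun P => z ^ P.card • g P), Finset.sum_filter]
  refine Finset.sum_congr rfl fun P _ => ?_
  rw [antichainWeight, ite_smul, zero_smul]

theorem size_eq (π : NC n) : size π = (natFam π).card := (card_mapFam _ _).symm

theorem treeFactorial_eq (π : NC n) : treeFactorial π = famTree (natFam π) := by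
  rw [natFam, famTree_mapFam]
  rfl

theorem one_le_size (hn : 1 ≤ n) (π : NC n) : 1 ≤ size π := by
  have h : (⟨0, hn⟩ : Fin n) ∈ supp (blocks π) := supp_blocks π ▸ Finset.mem_univ _
  obtain ⟨V, hV, -⟩ := mem_supp.1 h
  exact Finset.card_pos.2 ⟨V, hV⟩

theorem omega_eq (hn : 1 ≤ n) (π : NC n) :
    (omega π : ℂ) = (Polynomial.derivative (omegaPoly (natFam π))).eval 0 := by
  have hcard : (blocks π).card ≤ n := by
    have := π.1.card_parts_le_card
    rwa [Finset.card_univ, Fintype.card_fin] at this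
  rw [natFam, omegaPoly_mapFam,
    eval_derivative_omegaPoly (Finset.card_pos.1 (one_le_size hn π)) hcard, omega]
  push_cast
  rfl

theorem le_iff_natFam {π σ : NC n} :
    π ≤ σ ↔ ∀ U ∈ natFam π, ∃ V ∈ natFam σ, U ⊆ V := by
  constructor
  · intro h W hW
    obtain ⟨U, hU', rfl⟩ := mem_natFam.1 hW
    obtain ⟨V, hV, hUV⟩ := h hU'
    exact ⟨_, mem_natFam.2 ⟨V, hV, rfl⟩, Finset.map_subset_map.2 hUV⟩
  · intro h U hU
    obtain ⟨W, hW, hUW⟩ := h _ (mem_natFam.2 ⟨U, hU, rfl⟩)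
    obtain ⟨V, hV, rfl⟩ := mem_natFam.1 hW
    exact ⟨V, hV, Finset.map_subset_map.1 hUW⟩

theorem le_oneNC (π : NC n) : π ≤ oneNC n := by
  change π.1 ≤ ⊤
  exact le_top

open Classical in
/-- Möbius inversion at the top of the lattice of non-crossing partitions. -/
theorem sum_mu_smul_sum_le {M : Type*} [AddCommGroup M] [Module ℂ M] (g : NC n → M) :
    ∑ σ : NC n, IncidenceAlgebra.mu ℂ σ (oneNC n) •
      ∑ π ∈ (Finset.univ : Finset (NC n)).filter (· ≤ σ), g π = g (oneNC n) := by
  simp only [Finset.smul_sum, Finset.sum_filter]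
  rw [Finset.sum_comm]
  have h : ∀ π : NC n, ∑ σ : NC n,
      (if π ≤ σ then IncidenceAlgebra.mu ℂ σ (oneNC n) • g π else 0) =
      if π = oneNC n then g π else 0 := fun π => by
    rw [← Finset.sum_filter, ← Finset.sum_smul]
    have hf : (Finset.univ : Finset (NC n)).filter (π ≤ ·) = Finset.Icc π (oneNC n) := by
      ext σ
      simp [le_oneNC]
    rw [hf, IncidenceAlgebra.sum_Icc_mu_left, ite_smul, one_smul, zero_smul]
  simp only [smul_ite, smul_zero, h]
  simp

end Translation

/-! ### Sequences of maps as functions of words -/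

section Sequences

variable {A : Type*} [Ring A] [Algebra ℂ A] {B : Subalgebra ℂ A}

/-- A sequence of maps `Aⁿ → B`, `n ≥ 1`, as a function of words, with value `0` at the empty
word. -/
def toWord (f : ∀ k : ℕ, (Fin k → A) → B) (w : List A) : A :=
  if w.length = 0 then 0 else (f w.length w.get : A)

theorem toWord_nil (f : ∀ k : ℕ, (Fin k → A) → B) : toWord f [] = 0 := if_pos rfl

theorem toWord_of_ne {f : ∀ k : ℕ, (Fin k → A) → B} {w : List A} (hw : w ≠ []) :
    toWord f w = (f w.length w.get : A) := if_neg (mt List.length_eq_zero_iff.1 hw)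

theorem toWord_of_length (f : ∀ k : ℕ, (Fin k → A) → B) {w : List A} {n : ℕ} (hn : 1 ≤ n)
    (h : w.length = n) : toWord f w = (f n (fun i => w[i.1]'(h ▸ i.2)) : A) := by
  subst h
  rw [toWord, if_neg (by omega)]
  rfl

theorem blockVal_toWord {n : ℕ} (F : Finset (Fin n) → ∀ k : ℕ, (Fin k → A) → B)
    {V : Finset (Fin n)} (hV : V.Nonempty) (x : Fin n → A) :
    blockVal (fun W => toWord (F W)) V x = (blockValue F V x : A) := by
  rw [blockVal, toWord_of_length _ (Finset.card_pos.2 hV) (by simp), blockValue]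
  congr 2
  funext i
  rw [List.getElem_map]
  rfl

theorem coe_nestedValue {n : ℕ} (F : Finset (Fin n) → ∀ k : ℕ, (Fin k → A) → B)
    {P : Finset (Finset (Fin n))} (hP : NCFam P) (hne : P.Nonempty) (x : Fin n → A) :
    (nestedValue F P x : A) = val (fun W => toWord (F W)) P x := by
  revert x
  induction P, hP using NCFam.induction with
  | empty => simp at hne
  | single V hV =>
    intro x
    rw [nestedValue, dif_neg, Finset.sum_singleton, val_singleton,
      blockVal_toWord F (hV.nonempty V (by simp))]
    rintro ⟨⟨V', l⟩, hV', -, ⟨⟨W, hW, hne, -⟩, -⟩, -⟩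
    simp only [Finset.mem_singleton] at hV' hW
    exact hne (hW.trans hV'.symm)
  | peel P V l hP hl ih =>
    intro x
    have hp : ∃ p : Finset (Fin n) × Fin n, IsLastBlock P p.1 p.2 := ⟨(V, l), hl⟩
    obtain ⟨h1, h2⟩ := IsLast.unique (P := P) hp.choose_spec hl
    obtain ⟨W, hW, -⟩ := mem_supp.1 hl.mem_supp_erase
    rw [nestedValue, dif_pos hp, hl.val_eq, h1, h2, blockVal_toWord F (hP.nonempty V hl.1)]
    convert ih ⟨W, hW⟩ _

theorem letters_comp_val {A : Type*} [Ring A] (w : List A) :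
    letters w ∘ Fin.valOrderEmb w.length = w.get := by
  funext i
  simp [letters]

theorem coe_multMap (f : ∀ k : ℕ, (Fin k → A) → B) {w : List A} (hw : w ≠ [])
    (π : NC w.length) :
    (multMap f π w.get : A) = val (fun _ => toWord f) (natFam π) (letters w) := by
  rw [natFam, val_mapFam_const _ _ (ncFam_blocks π), letters_comp_val, multMap,
    coe_nestedValue _ (ncFam_blocks π)
      (Finset.card_pos.1 (one_le_size (List.length_pos_iff.2 hw) π))]

theorem coe_partialMap (f df : ∀ k : ℕ, (Fin k → A) → B) {w : List A} (hw : w ≠ [])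
    (π : NC w.length) :
    (partialMap f df π w.get : A) = dval (toWord f) (toWord df) (natFam π) (letters w) := by
  rw [partialMap, dval, natFam, sum_mapFam, AddSubmonoidClass.coe_finsetSum]
  refine Finset.sum_congr rfl fun V _ => ?_
  rw [val_mapFam _ _ (ncFam_blocks π), letters_comp_val, partialMapAt,
    coe_nestedValue _ (ncFam_blocks π)
      (Finset.card_pos.1 (one_le_size (List.length_pos_iff.2 hw) π))]
  congr 1
  funext W
  simp only [map_inj_iff]
  split_ifs <;> rfl

theorem toWord_moment (φ : A →ₗ[ℂ] B) {w : List A} (hw : w ≠ []) :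
    toWord (moment φ) w = (φ w.prod : A) := by
  rw [toWord_of_ne hw, moment]
  congr 3
  exact List.ofFn_get w

theorem rightModular_moment {φ : A →ₗ[ℂ] B} (hφ : ∀ a (b : B), φ (a * b) = φ a * b) :
    RightModular B (toWord (moment φ)) := by
  have hne : ∀ (u v : List A) a, u ++ a :: v ≠ [] := fun u v a => by simp
  refine ⟨fun w => ?_, fun u v a a' => ?_, fun u v c a => ?_, fun u a b hb => ?_⟩
  · rw [toWord]
    split_ifs
    exacts [B.zero_mem, Subtype.property _]
  · rw [toWord_moment _ (hne _ _ _), toWord_moment _ (hne _ _ _), toWord_moment _ (hne _ _ _)]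
    simp only [List.prod_append, List.prod_cons, add_mul, mul_add, map_add]
    rfl
  · rw [toWord_moment _ (hne _ _ _), toWord_moment _ (hne _ _ _)]
    simp only [List.prod_append, List.prod_cons, smul_mul_assoc, mul_smul_comm, map_smul]
    rfl
  · rw [toWord_moment _ (hne _ _ _), toWord_moment _ (hne _ _ _)]
    have := hφ ((u ++ [a]).prod) ⟨b, hb⟩
    simp only [List.prod_append, List.prod_cons, List.prod_nil, mul_one, ← mul_assoc] at this ⊢
    rw [this]
    rfl

end Sequences

/-! ### The cumulants of a right-linear map as functions of words -/

section CumulantWords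

variable {A : Type*} [Ring A] [Algebra ℂ A] {B : Subalgebra ℂ A} {φ : A →ₗ[ℂ] B}

theorem ncWord_freeCumulant {w : List A} (hw : w ≠ []) :
    ncWord (fun _ => 1) (toWord (freeCumulant φ)) w = toWord (moment φ) w := by
  rw [toWord_of_ne hw, moment, moment_eq_sum_free φ (List.length_pos_iff.2 hw),
    AddSubmonoidClass.coe_finsetSum, ncWord, ncSum, ← sum_NC]
  exact Finset.sum_congr rfl fun π _ => by rw [coe_multMap _ hw, one_smul]

theorem ncWord_booleanCumulant {w : List A} (hw : w ≠ []) :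
    ncWord (antichainWeight 1) (toWord (booleanCumulant φ)) w = toWord (moment φ) w := by
  rw [toWord_of_ne hw, moment, moment_eq_sum_boolean φ (List.length_pos_iff.2 hw),
    AddSubmonoidClass.coe_finsetSum, ncWord, ncSum, ← sum_intervalNC]
  exact Finset.sum_congr rfl fun π _ => by rw [coe_multMap _ hw, one_pow, one_smul]

theorem ncWord_monotoneCumulant {w : List A} (hw : w ≠ []) :
    ncWord (treeWeight 1) (toWord (monotoneCumulant φ)) w = toWord (moment φ) w := by
  rw [toWord_of_ne hw, moment, moment_eq_sum_monotone φ (List.length_pos_iff.2 hw),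
    AddSubmonoidClass.coe_finsetSum, ncWord, ncSum, ← sum_NC]
  refine Finset.sum_congr rfl fun π _ => ?_
  rw [treeWeight, one_pow, Subalgebra.coe_smul, coe_multMap _ hw, treeFactorial_eq]

theorem antichainWeight_one_singleton (S : Finset ℕ) : antichainWeight 1 {S} = 1 := by
  simp [antichainWeight]

theorem treeWeight_one_singleton (S : Finset ℕ) : treeWeight 1 {S} = 1 := by
  simp [treeWeight, famTree, Finset.filter_singleton, Nested.refl]

theorem rightModular_freeCumulant (hφ : ∀ a (b : B), φ (a * b) = φ a * b) :
    RightModular B (toWord (freeCumulant φ)) :=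
  rightModular_of_ncWord (rightModular_moment hφ) (toWord_nil _) (c := fun _ => 1)
    (fun _ => rfl) fun _ hw => ncWord_freeCumulant hw

theorem rightModular_booleanCumulant (hφ : ∀ a (b : B), φ (a * b) = φ a * b) :
    RightModular B (toWord (booleanCumulant φ)) :=
  rightModular_of_ncWord (rightModular_moment hφ) (toWord_nil _)
    (fun _ => antichainWeight_one_singleton _) fun _ hw => ncWord_booleanCumulant hw

theorem rightModular_monotoneCumulant (hφ : ∀ a (b : B), φ (a * b) = φ a * b) :
    RightModular B (toWord (monotoneCumulant φ)) :=
  rightModular_of_ncWord (rightModular_moment hφ) (toWord_nil _)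
    (fun _ => treeWeight_one_singleton _) fun _ hw => ncWord_monotoneCumulant hw

open Classical in
/-- Free cumulants are obtained from the moments by Möbius inversion. -/
theorem freeCumulant_eq_sum_mu (hφ : ∀ a (b : B), φ (a * b) = φ a * b) {w : List A}
    (hw : w ≠ []) : toWord (freeCumulant φ) w = ∑ π : NC w.length,
      IncidenceAlgebra.mu ℂ π (oneNC w.length) •
        val (fun _ => toWord (moment φ)) (natFam π) (letters w) := by
  have hr := rightModular_freeCumulant hφ
  have h : ∀ σ : NC w.length, val (fun _ => toWord (moment φ)) (natFam σ) (letters w) =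
      ∑ π ∈ (Finset.univ : Finset (NC w.length)).filter (· ≤ σ),
        val (fun _ => toWord (freeCumulant φ)) (natFam π) (letters w) := fun σ => by
    obtain ⟨hσ, hs⟩ := mem_ncFams.1 (natFam_mem_ncFams σ)
    rw [hσ.val_eq_sum_refinements hr (fun w hw => ncWord_freeCumulant hw), hs]
    exact (sum_filter_NC (fun π => le_iff_natFam)
      (fun P => val (fun _ => toWord (freeCumulant φ)) P (letters w))).symm
  simp only [h]
  rw [sum_mu_smul_sum_le fun π : NC w.length =>
    val (fun _ => toWord (freeCumulant φ)) (natFam π) (letters w)]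
  have hlen := List.length_pos_iff.2 hw
  rw [natFam, blocks_oneNC hlen]
  have : mapFam (Fin.valOrderEmb w.length) {Finset.univ} = {Finset.Ico 0 w.length} := by
    rw [← map_valOrderEmb_univ]
    rfl
  rw [this, val_singleton_letters]

variable (E' : A →ₗ[ℂ] B)

open Classical in
theorem infFreeCumulant_eq {w : List A} (hw : w ≠ []) :
    toWord (infFreeCumulant φ E') w = ∑ π : NC w.length,
      IncidenceAlgebra.mu ℂ π (oneNC w.length) •
        dval (toWord (moment φ)) (toWord (moment E')) (natFam π) (letters w) := by
  rw [toWord_of_ne hw, infFreeCumulant, AddSubmonoidClass.coe_finsetSum]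
  exact Finset.sum_congr rfl fun π _ => by rw [Subalgebra.coe_smul, coe_partialMap _ _ hw]

theorem infBooleanCumulant_eq {w : List A} (hw : w ≠ []) :
    toWord (infBooleanCumulant φ E') w = - ∑ P ∈ ncFams (Finset.Ico 0 w.length),
      antichainWeight (-1) P • dval (toWord (moment φ)) (toWord (moment E')) P (letters w) := by
  rw [toWord_of_ne hw, infBooleanCumulant, AddSubmonoidClass.coe_finsetSum, ← sum_intervalNC,
    ← Finset.sum_neg_distrib]
  refine Finset.sum_congr rfl fun π _ => ?_
  obtain ⟨k, hk⟩ := Nat.exists_eq_add_of_le' (one_le_size (List.length_pos_iff.2 hw) π)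
  rw [Subalgebra.coe_smul, coe_partialMap _ _ hw, hk, Nat.add_sub_cancel, pow_succ, mul_neg_one,
    neg_smul, neg_neg]

theorem moment_eq_sum_infMonotoneCumulant {w : List A} (hw : w ≠ []) :
    toWord (moment E') w = ∑ P ∈ ncFams (Finset.Ico 0 w.length), treeWeight 1 P •
      dval (toWord (monotoneCumulant φ)) (toWord (infMonotoneCumulant φ E')) P (letters w) := by
  rw [toWord_of_ne hw, moment, infMoment_eq_sum_monotone φ E' (List.length_pos_iff.2 hw),
    AddSubmonoidClass.coe_finsetSum, ← sum_NC]
  refine Finset.sum_congr rfl fun π _ => ?_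
  rw [treeWeight, one_pow, Subalgebra.coe_smul, coe_partialMap _ _ hw, treeFactorial_eq]

end CumulantWords

/-! ### Differentiation of the relations between cumulants -/

section Differentiation

variable {A : Type*} [Ring A] [Algebra ℂ A] {B : Subalgebra ℂ A}

/-- The derivation `∑ c(π) ∂f_π`, summed over the irreducible non-crossing partitions. -/
noncomputable def irrDeriv (c : Finset (Finset ℕ) → ℂ) (f g : List A → A) (w : List A) : A :=
  ∑ P ∈ irrFams 0 w.length, c P • dval f g P (letters w)

variable {f f' : ℂ → List A → A}

theorem polyDeriv_irrWord_irrDeriv (c : Finset (Finset ℕ) → ℂ) (hf : ∀ s, RightModular B (f s))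
    (hf' : ∀ s, RightModular B (f' s)) (h : ∀ w, PolyDeriv (fun s => f s w) (fun s => f' s w))
    (w : List A) :
    PolyDeriv (fun s => irrWord c (f s) w) (fun s => irrDeriv c (f s) (f' s) w) := by
  simp only [irrWord, irrSum, irrDeriv]
  exact PolyDeriv.sum _ fun P hP =>
    ((mem_ncFams.1 (mem_irrFams.1 hP).1).1.polyDeriv_val hf hf' h _).const_smul _

theorem polyDeriv_ncWord (c : Finset (Finset ℕ) → ℂ) (hf : ∀ s, RightModular B (f s))
    (hf' : ∀ s, RightModular B (f' s)) (h : ∀ w, PolyDeriv (fun s => f s w) (fun s => f' s w))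
    (w : List A) : PolyDeriv (fun s => ncWord c (f s) w)
      (fun s => ∑ P ∈ ncFams (Finset.Ico 0 w.length), c P • dval (f s) (f' s) P (letters w)) := by
  simp only [ncWord, ncSum]
  exact PolyDeriv.sum _ fun P hP => ((mem_ncFams.1 hP).1.polyDeriv_val hf hf' h _).const_smul _

theorem PolyDeriv.neg {M : Type*} [AddCommGroup M] [Module ℂ M] {F F' : ℂ → M}
    (h : PolyDeriv F F') : PolyDeriv (fun s => -F s) (fun s => -F' s) :=
  Submodule.neg_mem _ h

theorem PolyDeriv.unique {M : Type*} [AddCommGroup M] [Module ℂ M] {F F' G G' : ℂ → M}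
    (hF : PolyDeriv F F') (hG : PolyDeriv G G') (h : ∀ s, F s = G s) (s : ℂ) : F' s = G' s :=
  (hF.eq_of_nat hG (fun k => h k) s).2

variable {E E' : A →ₗ[ℂ] B}

/-- The maps `E + s E'` are right `B`-linear. -/
theorem IsOVISpace.map_mul (hE : IsOVISpace B E E') (s : ℂ) (a : A) (b : B) :
    (E + s • E') (a * b) = (E + s • E') a * b := by
  have h1 := hE.map_bimodule 1 b a
  have h2 := hE.inf_map_bimodule 1 b a
  simp only [OneMemClass.coe_one, one_mul] at h1 h2
  rw [LinearMap.add_apply, LinearMap.add_apply, LinearMap.smul_apply, LinearMap.smul_apply, h1, h2,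
    add_mul, smul_mul_assoc]

theorem IsOVISpace.inf_map_mul (hE : IsOVISpace B E E') (a : A) (b : B) :
    E' (a * b) = E' a * b := by
  simpa using hE.inf_map_bimodule 1 b a

theorem polyDeriv_moment (E E' : A →ₗ[ℂ] B) (w : List A) :
    PolyDeriv (fun s => toWord (moment (E + s • E')) w) (fun _ => toWord (moment E') w) := by
  rcases eq_or_ne w [] with rfl | hw
  · simpa only [toWord_nil] using polyDeriv_const (0 : A)
  simp only [toWord_moment _ hw, LinearMap.add_apply, LinearMap.smul_apply]
  have h := (polyDeriv_const (E w.prod : A)).add (polyDeriv_eval Polynomial.X (E' w.prod : A))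
  simp only [Polynomial.eval_X, Polynomial.derivative_X, Polynomial.eval_one, one_smul,
    zero_add] at h
  exact h

/-- The derivative is taken term by term in the Möbius inversion formula. -/
theorem IsOVISpace.polyDeriv_freeCumulant (hE : IsOVISpace B E E') (w : List A) :
    PolyDeriv (fun s => toWord (freeCumulant (E + s • E')) w)
      (fun s => toWord (infFreeCumulant (E + s • E') E') w) := by
  rcases eq_or_ne w [] with rfl | hw
  · simpa only [toWord_nil] using polyDeriv_const (0 : A)
  simp only [freeCumulant_eq_sum_mu (hE.map_mul _) hw, infFreeCumulant_eq E' hw]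
  exact PolyDeriv.sum _ fun π _ =>
    ((mem_ncFams.1 (natFam_mem_ncFams π)).1.polyDeriv_val
      (fun s => rightModular_moment (hE.map_mul s))
      (fun _ => rightModular_moment hE.inf_map_mul) (polyDeriv_moment E E') _).const_smul _

/-- The derivative is taken term by term in the alternating sum over interval partitions. -/
theorem IsOVISpace.polyDeriv_booleanCumulant (hE : IsOVISpace B E E') (w : List A) :
    PolyDeriv (fun s => toWord (booleanCumulant (E + s • E')) w)
      (fun s => toWord (infBooleanCumulant (E + s • E') E') w) := by
  rcases eq_or_ne w [] with rfl | hw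
  · simpa only [toWord_nil] using polyDeriv_const (0 : A)
  have h : ∀ s, toWord (booleanCumulant (E + s • E')) w =
      - ncWord (antichainWeight (-1)) (toWord (moment (E + s • E'))) w := fun s =>
    boolean_eq_neg_ncWord (rightModular_moment (hE.map_mul s))
      (rightModular_booleanCumulant (hE.map_mul s)) (toWord_nil _) (toWord_nil _)
      (fun w hw => ncWord_booleanCumulant hw) hw
  simp only [h, infBooleanCumulant_eq E' hw]
  exact (polyDeriv_ncWord _ (fun s => rightModular_moment (hE.map_mul s))
    (fun _ => rightModular_moment hE.inf_map_mul) (polyDeriv_moment E E') w).neg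

/-- The relations between the cumulants of a right `B`-linear map, which are those to be
differentiated. -/
theorem cumulant_relations_of_map_mul {φ : A →ₗ[ℂ] B} (hφ : ∀ a (b : B), φ (a * b) = φ a * b)
    (w : List A) :
    toWord (booleanCumulant φ) w = irrWord (fun _ => 1) (toWord (freeCumulant φ)) w ∧
    toWord (freeCumulant φ) w =
      - irrWord (fun P => (-1) ^ P.card) (toWord (booleanCumulant φ)) w ∧
    toWord (booleanCumulant φ) w = irrWord (treeWeight 1) (toWord (monotoneCumulant φ)) w ∧
    toWord (freeCumulant φ) w = - irrWord (treeWeight (-1)) (toWord (monotoneCumulant φ)) w ∧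
    toWord (monotoneCumulant φ) w =
      irrWord (fun P => (Polynomial.derivative (omegaPoly P)).eval 0)
        (toWord (booleanCumulant φ)) w ∧
    toWord (monotoneCumulant φ) w =
      - irrWord (fun P => (-1) ^ P.card * (Polynomial.derivative (omegaPoly P)).eval 0)
        (toWord (freeCumulant φ)) w := by
  refine cumulant_relations (rightModular_freeCumulant hφ) (rightModular_booleanCumulant hφ)
    (rightModular_monotoneCumulant hφ) (toWord_nil _) (toWord_nil _) (toWord_nil _)
    (funext fun w => ?_) (funext fun w => ?_) w
  all_goals
    rcases eq_or_ne w [] with rfl | hw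
  · rw [ncWord_nil treeWeight_one, ncWord_nil (treeWeight_antichain 1)]
  · rw [ncWord_freeCumulant hw, ncWord_booleanCumulant hw]
  · rw [ncWord_nil (treeWeight_treeWeight 1), ncWord_nil (treeWeight_antichain 1)]
  · rw [ncWord_monotoneCumulant hw, ncWord_booleanCumulant hw]

theorem IsOVISpace.rightModular_infFreeCumulant (hE : IsOVISpace B E E') (s : ℂ) :
    RightModular B (toWord (infFreeCumulant (E + s • E') E')) :=
  rightModular_of_polyDeriv (f := fun s => toWord (freeCumulant (E + s • E')))
    (f' := fun s => toWord (infFreeCumulant (E + s • E') E'))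
    (fun s => rightModular_freeCumulant (hE.map_mul s)) hE.polyDeriv_freeCumulant s

theorem IsOVISpace.rightModular_infBooleanCumulant (hE : IsOVISpace B E E') (s : ℂ) :
    RightModular B (toWord (infBooleanCumulant (E + s • E') E')) :=
  rightModular_of_polyDeriv (f := fun s => toWord (booleanCumulant (E + s • E')))
    (f' := fun s => toWord (infBooleanCumulant (E + s • E') E'))
    (fun s => rightModular_booleanCumulant (hE.map_mul s)) hE.polyDeriv_booleanCumulant s

/-- The monotone cumulants of `E + s E'` have the infinitesimal monotone cumulants as
derivatives. -/
theorem IsOVISpace.polyDeriv_monotoneCumulant (hE : IsOVISpace B E E') (w : List A) :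
    PolyDeriv (fun s => toWord (monotoneCumulant (E + s • E')) w)
      (fun s => toWord (infMonotoneCumulant (E + s • E') E') w) := by
  -- the expression in terms of the Boolean cumulants shows that there is a derivative `g`
  set g : ℂ → List A → A := fun s =>
    irrDeriv (fun P => (Polynomial.derivative (omegaPoly P)).eval 0)
      (toWord (booleanCumulant (E + s • E'))) (toWord (infBooleanCumulant (E + s • E') E'))
  have hg : ∀ w, PolyDeriv (fun s => toWord (monotoneCumulant (E + s • E')) w)
      (fun s => g s w) := fun w => by
    simp only [fun s => (cumulant_relations_of_map_mul (hE.map_mul s) w).2.2.2.2.1]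
    exact polyDeriv_irrWord_irrDeriv _ (fun s => rightModular_booleanCumulant (hE.map_mul s))
      hE.rightModular_infBooleanCumulant hE.polyDeriv_booleanCumulant w
  have hh := fun s => rightModular_monotoneCumulant (hE.map_mul s)
  have hgm := rightModular_of_polyDeriv (f' := g) hh hg
  -- which satisfies the recursion that defines the infinitesimal monotone cumulants
  have heq : ∀ s, g s = toWord (infMonotoneCumulant (E + s • E') E') := fun s => by
    funext w
    refine eq_of_sum_dval_eq (c := treeWeight 1) (f := toWord (monotoneCumulant (E + s • E')))
      ?_ (fun _ => treeWeight_one_singleton _) (fun w hw => ?_) w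
    · rw [toWord_nil]
      simp only [g, irrDeriv, List.length_nil, irrFams_self, Finset.sum_empty]
    · rw [← moment_eq_sum_infMonotoneCumulant E' hw]
      refine (polyDeriv_ncWord (treeWeight 1) hh hgm hg w).unique (polyDeriv_moment E E' w)
        (fun s => ncWord_monotoneCumulant hw) s
  simpa only [heq] using hg w

theorem irrDeriv_eq_sum (f df : ∀ k : ℕ, (Fin k → A) → B) {w : List A} (hw : w ≠ [])
    (c : Finset (Finset ℕ) → ℂ) (d : NC w.length → ℂ) (h : ∀ π, d π = c (natFam π)) :
    irrDeriv c (toWord f) (toWord df) w =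
      ((∑ π ∈ irrNC w.length, d π • partialMap f df π w.get : B) : A) := by
  rw [irrDeriv, ← sum_irrNC (List.length_pos_iff.2 hw), AddSubmonoidClass.coe_finsetSum]
  exact Finset.sum_congr rfl fun π _ => by
    rw [Subalgebra.coe_smul, coe_partialMap _ _ hw, h]

theorem irrDeriv_neg (c : Finset (Finset ℕ) → ℂ) (f g : List A → A) (w : List A) :
    - irrDeriv c f g w = irrDeriv (fun P => - c P) f g w := by
  simp only [irrDeriv, neg_smul, Finset.sum_neg_distrib]

theorem neg_one_pow_size {n : ℕ} (hn : 1 ≤ n) (π : NC n) :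
    (-1 : ℂ) ^ (size π - 1) = -(-1) ^ (natFam π).card := by
  rw [← size_eq]
  obtain ⟨k, hk⟩ := Nat.exists_eq_add_of_le' (one_le_size hn π)
  rw [hk, Nat.add_sub_cancel, pow_succ, mul_neg_one, neg_neg]

end Differentiation

end OVI

theorem mainTheorem3 {A : Type*} [Ring A] [Algebra ℂ A] (B : Subalgebra ℂ A)
    (E E' : A →ₗ[ℂ] B) (hE : OVI.IsOVISpace B E E') (n : ℕ) (hn : 1 ≤ n) (a : Fin n → A) :
    (OVI.infBooleanCumulant E E' n a =
      ∑ π ∈ OVI.irrNC n,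
        OVI.partialMap (OVI.freeCumulant E) (OVI.infFreeCumulant E E') π a) ∧
    (OVI.infFreeCumulant E E' n a =
      ∑ π ∈ OVI.irrNC n, (-1 : ℂ) ^ (OVI.size π - 1) •
        OVI.partialMap (OVI.booleanCumulant E) (OVI.infBooleanCumulant E E') π a) ∧
    (OVI.infBooleanCumulant E E' n a =
      ∑ π ∈ OVI.irrNC n, (1 / (OVI.treeFactorial π : ℂ)) •
        OVI.partialMap (OVI.monotoneCumulant E) (OVI.infMonotoneCumulant E E') π a) ∧
    (OVI.infFreeCumulant E E' n a =
      ∑ π ∈ OVI.irrNC n, ((-1 : ℂ) ^ (OVI.size π - 1) / (OVI.treeFactorial π : ℂ)) •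
        OVI.partialMap (OVI.monotoneCumulant E) (OVI.infMonotoneCumulant E E') π a) ∧
    (OVI.infMonotoneCumulant E E' n a =
      ∑ π ∈ OVI.irrNC n, (OVI.omega π : ℂ) •
        OVI.partialMap (OVI.booleanCumulant E) (OVI.infBooleanCumulant E E') π a) ∧
    (OVI.infMonotoneCumulant E E' n a =
      ∑ π ∈ OVI.irrNC n, ((-1 : ℂ) ^ (OVI.size π - 1) * (OVI.omega π : ℂ)) •
        OVI.partialMap (OVI.freeCumulant E) (OVI.infFreeCumulant E E') π a) := by
  open OVI in
  obtain ⟨w, hw⟩ := List.equivSigmaTuple.surjective ⟨n, a⟩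
  obtain ⟨rfl, ha⟩ := Sigma.mk.inj_iff.1 hw
  obtain rfl := eq_of_heq ha
  have hw : w ≠ [] := List.length_pos_iff.1 hn
  have hr := fun s => rightModular_freeCumulant (hE.map_mul s)
  have hβ := fun s => rightModular_booleanCumulant (hE.map_mul s)
  have hh := fun s => rightModular_monotoneCumulant (hE.map_mul s)
  have hh' := rightModular_of_polyDeriv
    (f' := fun s => toWord (infMonotoneCumulant (E + s • E') E')) hh hE.polyDeriv_monotoneCumulant
  have rel := fun s => cumulant_relations_of_map_mul (hE.map_mul s) w
  have Dr := fun c => polyDeriv_irrWord_irrDeriv c hr hE.rightModular_infFreeCumulant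
    hE.polyDeriv_freeCumulant w
  have Dβ := fun c => polyDeriv_irrWord_irrDeriv c hβ hE.rightModular_infBooleanCumulant
    hE.polyDeriv_booleanCumulant w
  have Dh := fun c => polyDeriv_irrWord_irrDeriv c hh hh' hE.polyDeriv_monotoneCumulant w
  have e0 : E + (0 : ℂ) • E' = E := by rw [zero_smul, add_zero]
  -- each identity compares the two derivatives of a relation for `E + s E'` at `s = 0`
  have h1 := (hE.polyDeriv_booleanCumulant w).unique (Dr _) (fun s => (rel s).1) 0
  have h2 := (hE.polyDeriv_freeCumulant w).unique (Dβ _).neg (fun s => (rel s).2.1) 0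
  have h3 := (hE.polyDeriv_booleanCumulant w).unique (Dh _) (fun s => (rel s).2.2.1) 0
  have h4 := (hE.polyDeriv_freeCumulant w).unique (Dh _).neg (fun s => (rel s).2.2.2.1) 0
  have h5 := (hE.polyDeriv_monotoneCumulant w).unique (Dβ _) (fun s => (rel s).2.2.2.2.1) 0
  have h6 := (hE.polyDeriv_monotoneCumulant w).unique (Dr _).neg (fun s => (rel s).2.2.2.2.2) 0
  simp only [e0, irrDeriv_neg, toWord_of_ne hw] at h1 h2 h3 h4 h5 h6
  refine ⟨?_, ?_, ?_, ?_, ?_, ?_⟩ <;> apply Subtype.ext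
  · refine h1.trans ((irrDeriv_eq_sum _ _ hw _ (fun _ => 1) fun π => rfl).trans ?_)
    simp only [one_smul]
  · exact h2.trans (irrDeriv_eq_sum _ _ hw _ _ fun π => neg_one_pow_size hn π)
  · exact h3.trans (irrDeriv_eq_sum _ _ hw _ _ fun π => by
      rw [treeWeight, one_pow, treeFactorial_eq])
  · exact h4.trans (irrDeriv_eq_sum _ _ hw _ _ fun π => by
      rw [treeWeight, neg_one_pow_size hn, treeFactorial_eq, neg_div])
  · exact h5.trans (irrDeriv_eq_sum _ _ hw _ _ fun π => omega_eq hn π)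
  · exact h6.trans (irrDeriv_eq_sum _ _ hw _ _ fun π => by
      rw [neg_one_pow_size hn, omega_eq hn, neg_mul])
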